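/- Let $d\ge 1$, $H\in(1/2,1)$, $\alpha_H=H(2H-1)$, and $\mathcal F\varphi(\xi)=\int_{\mathbb R^d}e^{-i\xi\cdot x}\varphi(x)\,dx$. Let $\mathcal S(\mathbb R^d)$ denote the real-valued Schwartz functions. **Noise.** Let $f:\mathbb R^d\to[0,\infty]$ be measurable and locally integrable, and the Fourier transform in $\mathcal S'(\mathbb R^d)$ of a tempered measure $\mu$: $\int f\varphi\,dx=\int\mathcal F\varphi\,d\mu$ for all Schwartz $\varphi$. Let $\mathcal E$ be the linear span of the functions $(t,x)\mapsto 1_{[0,a]}(t)\psi(x)$ on $[0,\infty)\times\mathbb R^d$, with $a>0$, $\psi\in\mathcal S(\mathbb R^d)$, let $$\langle h_1,h_2\rangle_{\mathcal{HP}}=\alpha_H\int_0^\infty\!\!\int_0^\infty\!\!\int_{\mathbb R^d}\!\int_{\mathbb R^d}|t-s|^{2H-2}f(x-y)h_1(t,x)h_2(s,y)\,dx\,dy\,dt\,ds,$$ and let $\mathcal{HP}$ be the completion of $\mathcal E$ for this inner product. Let $W=\{W(h);h\in\mathcal E\}$ be a zero-mean Gaussian process with $E[W(h_1)W(h_2)]=\langle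 h_1,h_2\rangle_{\mathcal{HP}}$, and write $\int h\,dW$ for its isometric extension to $h\in\mathcal{HP}$, with values in $L^2(\Omega)$. **Operator.** Let $X=(X_t)_{t\ge0}$ be a Lévy process in $\mathbb R^d$ with characteristic exponent $\Psi$, i.e. $E\,e^{-i\xi\cdot X_t}=e^{-t\Psi(\xi)}$, such that for every $t>0$ the law of $X_t$ has a density $p_t$. Let $\mathcal L$ be the $L^2(\mathbb R^d)$-generator of $X$, so that $G(t,x)=p_t(-x)$ is the fundamental solution of $\partial_tu=\mathcal Lu$. **Solutions.** Consider $$\partial_t u=\mathcal Lu+\dot W\quad(t>0,\ x\in\mathbb R^d),\qquad u(0,\cdot)=0.\tag{1}$$ Its weak solution is $u(t,\varphi)=\int_0^t\!\int_{\mathbb R^d}\big(\int_{\mathbb R^d}G(t-s,x-y)\varphi(x)\,dx\big)W(ds,dy)$, $t\ge0$, $\varphi\in\mathcal S(\mathbb R^d)$, where the integrand, multiplied by $1_{[0,t]}(s)$, has to belong to $\mathcal{HP}$. For $t>0$ let $M_t$ be the completion of $\mathcal S(\mathbb R^d)$ for the inner product $\langle\varphi,\psi\rangle_t=E[u(t,\varphi)u(t,\psi)]$,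 whose norm is given by $$\|\varphi\|_t^2=\int_{\mathbb R^d}N_t(\xi)|\mathcal F\varphi(\xi)|^2\mu(d\xi),\qquad N_t(\xi)=\alpha_H\int_0^t\!\!\int_0^t e^{-r\Psi(\xi)}e^{-s\overline{\Psi(\xi)}}|r-s|^{2H-2}\,dr\,ds.$$ For a point $x\in\mathbb R^d$, $\delta_x\in M_t$ means that there are $\varphi_n\in\mathcal S(\mathbb R^d)$ with $\|\varphi_n-\delta_x\|_t\to0$, i.e. $\int N_t(\xi)\,|\mathcal F\varphi_n(\xi)-e^{-i\xi\cdot x}|^2\mu(d\xi)\to0$; then $u(t,\delta_x)$ is the $L^2(\Omega)$-limit of $u(t,\varphi_n)$. Equation (1) *has a random-field solution* if the weak solution exists and $\delta_x\in M:=\bigcap_{t>0}M_t$ for all $x\in\mathbb R^d$; the random-field solution is then $u(t,x)=u(t,\delta_x)$ for $t>0$, with $u(0,x)=0$. **Theorem (existence of the solution in the parabolic case).** a) If $$\int_{\mathbb R^d}\Big(\frac1{1+\operatorname{Re}\Psi(\xi)}\Big)^{2H}\mu(d\xi)<\infty,\tag{2}$$ then equation (1) has a random-field solution. b) Suppose that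 there is a constant $K>0$ with $|\operatorname{Im}\Psi(\xi)|\le K\operatorname{Re}\Psi(\xi)$ for all $\xi\in\mathbb R^d$. If equation (1) has a random-field solution, then (2) holds. -/

import Mathlib

open MeasureTheory ProbabilityTheory Filter Topology
open scoped SchwartzMap NNReal ENNReal InnerProductSpace

noncomputable section

namespace FracSPDE

/-- Fourier transform with the normalisation `∫ exp (-i ξ·x) g(x) dx`. -/
def fourier {d : ℕ} (g : EuclideanSpace ℝ (Fin d) → ℂ) (ξ : EuclideanSpace ℝ (Fin d)) : ℂ :=
  ∫ x, Complex.exp (-(Complex.I * (⟪ξ, x⟫_ℝ : ℂ))) * g x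

/-- Fourier transform of a real-valued Schwartz function. -/
def schwartzFourier {d : ℕ} (φ : 𝓢(EuclideanSpace ℝ (Fin d), ℝ))
    (ξ : EuclideanSpace ℝ (Fin d)) : ℂ :=
  fourier (fun x => (φ x : ℂ)) ξ

/-- Fourier transform of the Dirac distribution `δ_x`: the function `ξ ↦ exp (-i ξ·x)`. -/
def diracFourier {d : ℕ} (x ξ : EuclideanSpace ℝ (Fin d)) : ℂ :=
  Complex.exp (-(Complex.I * (⟪ξ, x⟫_ℝ : ℂ)))

/-! ### The noise -/

/-- `f : ℝᵈ → [0,∞]` is a measurable, locally integrable kernel which is the Fourier transform in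
`𝓢'(ℝᵈ)` of the tempered measure `μ` : `∫ f φ dx = ∫ 𝓕φ dμ` for all (complex) Schwartz `φ`.
Temperedness of `μ` is the Mathlib class `Measure.HasTemperateGrowth`. -/
structure IsSpatialCovariance {d : ℕ} (f : EuclideanSpace ℝ (Fin d) → ℝ≥0∞)
    (μ : Measure (EuclideanSpace ℝ (Fin d))) : Prop where
  measurable : Measurable f
  locallyIntegrable : ∀ K : Set (EuclideanSpace ℝ (Fin d)), IsCompact K → ∫⁻ x in K, f x < ∞
  tempered : μ.HasTemperateGrowth
  integrable_mul : ∀ φ : 𝓢(EuclideanSpace ℝ (Fin d), ℂ),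
    Integrable (fun x => ((f x).toReal : ℂ) * φ x)
  integral_eq : ∀ φ : 𝓢(EuclideanSpace ℝ (Fin d), ℂ),
    ∫ x, ((f x).toReal : ℂ) * φ x = ∫ ξ, fourier (fun x => φ x) ξ ∂μ

/-- The elementary functions: the linear span of the functions `(t, x) ↦ 1_{[0,a]}(t) ψ(x)` with
`a > 0` and `ψ` a (real-valued) Schwartz function. -/
def elementary (d : ℕ) : Submodule ℝ (ℝ × EuclideanSpace ℝ (Fin d) → ℝ) :=
  Submodule.span ℝ {h | ∃ a : ℝ, 0 < a ∧ ∃ ψ : 𝓢(EuclideanSpace ℝ (Fin d), ℝ),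
    h = fun p => (Set.Icc (0 : ℝ) a).indicator (fun _ => (1 : ℝ)) p.1 * ψ p.2}

/-- Lebesgue measure on `[0,∞) × ℝᵈ`. -/
def spaceTime (d : ℕ) : Measure (ℝ × EuclideanSpace ℝ (Fin d)) :=
  ((volume : Measure ℝ).restrict (Set.Ici 0)).prod volume

/-- The integrand `|t-s|^{2H-2} f(x-y) h₁(t,x) h₂(s,y)` at the point `((t,x),(s,y))`. -/
def hpIntegrand {d : ℕ} (H : ℝ) (f : EuclideanSpace ℝ (Fin d) → ℝ≥0∞)
    (h₁ h₂ : ℝ × EuclideanSpace ℝ (Fin d) → ℝ)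
    (z : (ℝ × EuclideanSpace ℝ (Fin d)) × (ℝ × EuclideanSpace ℝ (Fin d))) : ℝ :=
  |z.1.1 - z.2.1| ^ (2 * H - 2) * (f (z.1.2 - z.2.2)).toReal * h₁ z.1 * h₂ z.2

/-- The inner product
`H(2H-1) ∫∫∫∫ |t-s|^{2H-2} f(x-y) h₁(t,x) h₂(s,y) dx dy dt ds`, meaningful when the integrand is
integrable. -/
def hpInner {d : ℕ} (H : ℝ) (f : EuclideanSpace ℝ (Fin d) → ℝ≥0∞)
    (h₁ h₂ : ℝ × EuclideanSpace ℝ (Fin d) → ℝ) : ℝ :=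
  H * (2 * H - 1) * ∫ z, hpIntegrand H f h₁ h₂ z ∂((spaceTime d).prod (spaceTime d))

/-- `W` is the zero-mean Gaussian process indexed by the elementary functions, with covariance
`E (W h₁ W h₂) = ⟨h₁, h₂⟩`. -/
structure IsFractionalNoise {d : ℕ} {Ω : Type*} [MeasurableSpace Ω] (P : Measure Ω) (H : ℝ)
    (f : EuclideanSpace ℝ (Fin d) → ℝ≥0∞) (W : elementary d → Ω → ℝ) : Prop where
  gaussian : IsGaussianProcess W P
  mean_zero : ∀ h, ∫ ω, W h ω ∂P = 0
  covariance : ∀ h₁ h₂ : elementary d,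
    ∫ ω, W h₁ ω * W h₂ ω ∂P = hpInner H f (h₁ : _ → ℝ) (h₂ : _ → ℝ)

/-- `Z = ∫ h dW` : the function `h` is a limit of elementary functions `gₙ` in the norm of the
inner product `hpInner` (so that it is an element of the completion), and `Z` is the limit in
`L²(Ω)` of the variables `W gₙ`. -/
def IsStochasticIntegral {d : ℕ} {Ω : Type*} [MeasurableSpace Ω] (P : Measure Ω) (H : ℝ)
    (f : EuclideanSpace ℝ (Fin d) → ℝ≥0∞) (W : elementary d → Ω → ℝ)
    (h : ℝ × EuclideanSpace ℝ (Fin d) → ℝ) (Z : Ω → ℝ) : Prop :=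
  MemLp Z 2 P ∧ ∃ g : ℕ → elementary d,
    (∀ n, Integrable (hpIntegrand H f (h - (g n : _ → ℝ)) (h - (g n : _ → ℝ)))
      ((spaceTime d).prod (spaceTime d))) ∧
    Tendsto (fun n => hpInner H f (h - (g n : _ → ℝ)) (h - (g n : _ → ℝ))) atTop (𝓝 0) ∧
    Tendsto (fun n => eLpNorm (W (g n) - Z) 2 P) atTop (𝓝 0)

/-! ### The Lévy process -/

/-- `X` is a Lévy process in `ℝᵈ`: it starts at `0`, has independent and stationary increments and
is stochastically continuous. -/
structure IsLevyProcess {d : ℕ} {Ω : Type*} [MeasurableSpace Ω] (P : Measure Ω)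
    (X : ℝ≥0 → Ω → EuclideanSpace ℝ (Fin d)) : Prop where
  aemeasurable : ∀ t, AEMeasurable (X t) P
  zero : ∀ᵐ ω ∂P, X 0 ω = 0
  indep : HasIndepIncrements X P
  stationary : ∀ s t, IdentDistrib (fun ω => X (s + t) ω - X s ω) (X t) P P
  continuous : ∀ t, TendstoInMeasure P X (𝓝 t) (X t)

/-- `Ψ` is the characteristic exponent of `X` : `E exp (-i ξ·X_t) = exp (-t Ψ(ξ))`. -/
def IsCharExponent {d : ℕ} {Ω : Type*} [MeasurableSpace Ω] (P : Measure Ω)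
    (X : ℝ≥0 → Ω → EuclideanSpace ℝ (Fin d)) (Ψ : EuclideanSpace ℝ (Fin d) → ℂ) : Prop :=
  ∀ (t : ℝ≥0) (ξ : EuclideanSpace ℝ (Fin d)),
    ∫ ω, Complex.exp (-(Complex.I * (⟪ξ, X t ω⟫_ℝ : ℂ))) ∂P
      = Complex.exp (-(((t : ℝ) : ℂ) * Ψ ξ))

/-- The density `p_t` of the law of `X_t` with respect to Lebesgue measure (used for `t > 0`). -/
def density {d : ℕ} {Ω : Type*} [MeasurableSpace Ω] (P : Measure Ω)
    (X : ℝ≥0 → Ω → EuclideanSpace ℝ (Fin d)) (t : ℝ) (z : EuclideanSpace ℝ (Fin d)) : ℝ :=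
  ((P.map (X t.toNNReal)).rnDeriv volume z).toReal

/-- The fundamental solution `G(t,x) = p_t(-x)` of `∂ₜ u = ℒ u`, where `ℒ` is the `L²`-generator of
`X`. -/
def green {d : ℕ} {Ω : Type*} [MeasurableSpace Ω] (P : Measure Ω)
    (X : ℝ≥0 → Ω → EuclideanSpace ℝ (Fin d)) (t : ℝ) (x : EuclideanSpace ℝ (Fin d)) : ℝ :=
  density P X t (-x)

/-! ### Solutions of `∂ₜ u = ℒ u + Ẇ`, `u(0,·) = 0` -/

/-- The function `(s,y) ↦ 1_{[0,t]}(s) ∫ G(t-s, x-y) φ(x) dx`. -/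
def weakIntegrand {d : ℕ} {Ω : Type*} [MeasurableSpace Ω] (P : Measure Ω)
    (X : ℝ≥0 → Ω → EuclideanSpace ℝ (Fin d)) (t : ℝ) (φ : 𝓢(EuclideanSpace ℝ (Fin d), ℝ))
    (p : ℝ × EuclideanSpace ℝ (Fin d)) : ℝ :=
  (Set.Icc (0 : ℝ) t).indicator (fun s => ∫ x, green P X (t - s) (x - p.2) * φ x) p.1

/-- `u` is the weak solution:
`u(t,φ) = ∫₀ᵗ ∫ (∫ G(t-s, x-y) φ(x) dx) W(ds,dy)` for `t ≥ 0` and `φ` Schwartz. -/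
def IsWeakSolution {d : ℕ} {Ω Ω' : Type*} [MeasurableSpace Ω] [MeasurableSpace Ω']
    (P : Measure Ω) (P' : Measure Ω') (H : ℝ) (f : EuclideanSpace ℝ (Fin d) → ℝ≥0∞)
    (W : elementary d → Ω → ℝ) (X : ℝ≥0 → Ω' → EuclideanSpace ℝ (Fin d))
    (u : ℝ → 𝓢(EuclideanSpace ℝ (Fin d), ℝ) → Ω → ℝ) : Prop :=
  ∀ t, 0 ≤ t → ∀ φ, IsStochasticIntegral P H f W (weakIntegrand P' X t φ) (u t φ)

/-- `N_t(ξ) = H(2H-1) ∫₀ᵗ ∫₀ᵗ exp (-rΨ(ξ)) exp (-s conj Ψ(ξ)) |r-s|^{2H-2} dr ds`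
(a nonnegative real number). -/
def N {d : ℕ} (H : ℝ) (Ψ : EuclideanSpace ℝ (Fin d) → ℂ) (t : ℝ)
    (ξ : EuclideanSpace ℝ (Fin d)) : ℝ :=
  (((H * (2 * H - 1) : ℝ) : ℂ) * ∫ r in (0 : ℝ)..t, ∫ s in (0 : ℝ)..t,
    Complex.exp (-((r : ℂ) * Ψ ξ)) * Complex.exp (-((s : ℂ) * (starRingEnd ℂ) (Ψ ξ)))
      * ((|r - s| ^ (2 * H - 2) : ℝ) : ℂ)).re

/-- The square of the norm `‖T‖_t = (∫ N_t(ξ) |𝓕T(ξ)|² μ(dξ))^{1/2}` of a distribution `T` whose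
Fourier transform `𝓕T` is the function `g`. For `T = φ` a Schwartz function this is
`E |u(t,φ)|²`. -/
def normSq {d : ℕ} (H : ℝ) (Ψ : EuclideanSpace ℝ (Fin d) → ℂ)
    (μ : Measure (EuclideanSpace ℝ (Fin d))) (t : ℝ)
    (g : EuclideanSpace ℝ (Fin d) → ℂ) : ℝ≥0∞ :=
  ∫⁻ ξ, ENNReal.ofReal (N H Ψ t ξ) * ‖g ξ‖ₑ ^ 2 ∂μ

/-- `δ_x` belongs to `M_t`, the completion of the Schwartz space for
`⟨φ,ψ⟩_t = E (u(t,φ) u(t,ψ))`, and `U = u(t,δ_x)` is the value at `δ_x` of the extension to `M_t`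
of the isometry `φ ↦ u(t,φ) ∈ L²(Ω)`: there are Schwartz functions `φₙ` with
`‖φₙ - δ_x‖_t → 0` and `u(t,φₙ) → U` in `L²(Ω)`. -/
def IsValueAtDirac {d : ℕ} {Ω : Type*} [MeasurableSpace Ω] (P : Measure Ω) (H : ℝ)
    (Ψ : EuclideanSpace ℝ (Fin d) → ℂ) (μ : Measure (EuclideanSpace ℝ (Fin d)))
    (u : ℝ → 𝓢(EuclideanSpace ℝ (Fin d), ℝ) → Ω → ℝ)
    (t : ℝ) (x : EuclideanSpace ℝ (Fin d)) (U : Ω → ℝ) : Prop :=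
  MemLp U 2 P ∧ ∃ φ : ℕ → 𝓢(EuclideanSpace ℝ (Fin d), ℝ),
    Tendsto (fun n => normSq H Ψ μ t (fun ξ => schwartzFourier (φ n) ξ - diracFourier x ξ))
      atTop (𝓝 0) ∧
    Tendsto (fun n => eLpNorm (u t (φ n) - U) 2 P) atTop (𝓝 0)

/-- `∂ₜ u = ℒ u + Ẇ`, `u(0,·) = 0` has a random-field solution: there is a weak solution
`u(t,φ)`, one has `δ_x ∈ M_t` for all `t > 0` and all `x`, and
the random field is `U(t,x) = u(t,δ_x)`, with `U(0,x) = 0`. -/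
def HasRandomFieldSolution {d : ℕ} {Ω Ω' : Type*} [MeasurableSpace Ω] [MeasurableSpace Ω']
    (P : Measure Ω) (P' : Measure Ω') (H : ℝ) (f : EuclideanSpace ℝ (Fin d) → ℝ≥0∞)
    (μ : Measure (EuclideanSpace ℝ (Fin d))) (W : elementary d → Ω → ℝ)
    (X : ℝ≥0 → Ω' → EuclideanSpace ℝ (Fin d)) (Ψ : EuclideanSpace ℝ (Fin d) → ℂ) : Prop :=
  ∃ (u : ℝ → 𝓢(EuclideanSpace ℝ (Fin d), ℝ) → Ω → ℝ)
    (U : ℝ → EuclideanSpace ℝ (Fin d) → Ω → ℝ),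
    IsWeakSolution P P' H f W X u ∧
    (∀ t, 0 < t → ∀ x, IsValueAtDirac P H Ψ μ u t x (U t x)) ∧
    (∀ x, U 0 x =ᵐ[P] 0)

/-- `∫ (1 / (1 + Re Ψ))^{2H} dμ < ∞`. -/
def ParabolicCondition {d : ℕ} (H : ℝ) (Ψ : EuclideanSpace ℝ (Fin d) → ℂ)
    (μ : Measure (EuclideanSpace ℝ (Fin d))) : Prop :=
  ∫⁻ ξ, ENNReal.ofReal ((1 / (1 + (Ψ ξ).re)) ^ (2 * H)) ∂μ < ∞

end FracSPDE

end

/-!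
The covariance of the noise is diagonalised by the Fourier transform in space. If
`h(s, ·) = 1_{[0,a]}(s) (ν_s * φ)`, with measures `ν_s` of mass at most one and a Schwartz function
`φ`, then `ĥ(s, ξ) = 1_{[0,a]}(s) 𝓕ν_s(ξ) 𝓕φ(ξ)`, and
`⟨h₁, h₂⟩ = H(2H-1) ∫ μ(dξ) ∫∫ |r-s|^{2H-2} ĥ₁(r,ξ) conj (ĥ₂(s,ξ)) dr ds`
for all `h₁, h₂` in the linear span of such functions (`plancherel_of_mem`). The span contains the
elementary functions (`ν_s` a point mass) and the integrands of the weak solution (`ν_s` the law of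
`X_{t-s}`). By definition `μ` gives this identity for test functions only; it extends to the span by
Fubini's theorem, because `∫ f(x) |φ(x - c)| dx` is bounded uniformly in `c`
(`IsSpatialCovariance.exists_lintegral_translate_le`).

The temporal kernel is a superposition of products of indicator functions of intervals:
`|r-s|^{2H-2}` is a constant multiple of `∫ ε^{2H-4} 1_{(v,v+ε)}(r) 1_{(v,v+ε)}(s) dv dε`
(`lintegral_window`). Hence the temporal form of a function `u` is a superposition of the squares
`|∫_v^{v+ε} u|²` (`windowConst_mul_timeForm`), which shows that it is nonnegative, and that it is
bounded below by the contribution of any set of windows.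

For `u(r) = 1_{[0,t]}(r) exp (-r Ψ(ξ))` the form is `N_t(ξ)`, up to the factor `H(2H-1)`. Taking
absolute values, and using `exp (-r Re Ψ) ≤ exp t exp (-r (1 + Re Ψ))` for `r ≤ t`, gives
`N_t ≤ C (1 + Re Ψ)^{-2H}` (`exists_N_le`). If `|Im Ψ| ≤ K Re Ψ`, then `exp (-r Ψ)` has real part
bounded below for `r` up to a small multiple of `1 / (1 + Re Ψ)`, and the windows inside this range
give `N_t ≥ c (1 + Re Ψ)^{-2H}` (`exists_le_N`).

Existence. The integrand of the weak solution is a limit of elementary functions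
(`exists_elementary_tendsto`): the time variable is discretised and the law of `X_{t-s}` is replaced
by finitely supported measures, so that the convolution with `φ` becomes a finite sum of translates
of `φ`. The Fourier transforms are dominated by `1_{[0,t]}(s) |𝓕φ(ξ)|` and converge almost
everywhere, so the norms of the differences tend to zero. The elementary integrals form a Cauchy
sequence in `L²(Ω)`, because `g ↦ W(g)` is an isometry and the norm satisfies
`‖p - q‖² ≤ 2 ‖p‖² + 2 ‖q‖²`. Next, `E |u(t,φ) - u(t,ψ)|²` is controlled by `‖φ - ψ‖_t²`
(`IsStochasticIntegral.norm_sub_sq_le`, `ofReal_hpInner_weakPair_sub`). Under the parabolic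
condition the upper bound makes `N_t` integrable, so by dominated convergence mollifiers `φₙ` of the
Dirac mass satisfy `‖φₙ - δ_x‖_t → 0` (`exists_tendsto_dirac`), and `u(t,φₙ)` converges in `L²(Ω)`.

Necessity. If `‖φ - δ_x‖_t < ∞` for one Schwartz function `φ` and one `t > 0`, then
`‖δ_x‖_t² = ∫ N_t dμ` is finite, because `‖φ‖_t` is (`lintegral_N_lt_top`), and the lower bound for
`N_t` gives the parabolic condition (`parabolicCondition_of_lintegral_N`).
-/

noncomputable section

namespace FracSPDE

/-- The Euclidean space `ℝᵈ`. -/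
abbrev Space (d : ℕ) : Type := EuclideanSpace ℝ (Fin d)

variable {d : ℕ}

/-! ### Fourier transforms of Schwartz functions and measures -/

lemma norm_diracFourier (x ξ : Space d) : ‖diracFourier x ξ‖ = 1 := by
  rw [diracFourier, mul_comm, ← neg_mul, ← Complex.ofReal_neg, Complex.norm_exp_ofReal_mul_I]

@[fun_prop]
lemma continuous_diracFourier {α : Type*} [TopologicalSpace α] {g h : α → Space d}
    (hg : Continuous g) (hh : Continuous h) : Continuous fun a => diracFourier (g a) (h a) := by
  unfold diracFourier
  fun_prop

lemma diracFourier_add (x y ξ : Space d) :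
    diracFourier (x + y) ξ = diracFourier x ξ * diracFourier y ξ := by
  rw [diracFourier, diracFourier, diracFourier, ← Complex.exp_add, inner_add_right]
  congr 1
  push_cast
  ring

lemma conj_diracFourier (x ξ : Space d) :
    (starRingEnd ℂ) (diracFourier x ξ) = diracFourier (-x) ξ := by
  rw [diracFourier, diracFourier, ← Complex.exp_conj]
  congr 1
  simp

lemma norm_diracFourier_sub_le (x y ξ : Space d) :
    ‖diracFourier x ξ - diracFourier y ξ‖ ≤ ‖ξ‖ * ‖x - y‖ := by
  have h : diracFourier x ξ - diracFourier y ξ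
      = diracFourier y ξ * (diracFourier (x - y) ξ - 1) := by
    rw [mul_sub, ← diracFourier_add]
    simp
  rw [h, norm_mul, norm_diracFourier, one_mul]
  have h2 := Real.norm_exp_I_mul_ofReal_sub_one_le (x := -⟪ξ, x - y⟫_ℝ)
  have h3 : diracFourier (x - y) ξ = Complex.exp (Complex.I * ((-⟪ξ, x - y⟫_ℝ : ℝ) : ℂ)) := by
    rw [diracFourier]
    congr 1
    push_cast
    ring
  rw [h3]
  refine h2.trans ?_
  rw [norm_neg]
  exact norm_inner_le_norm _ _

/-- A real-valued Schwartz function, regarded as a complex-valued one. -/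
def toComplex (φ : 𝓢(Space d, ℝ)) : 𝓢(Space d, ℂ) :=
  SchwartzMap.postcompCLM (𝕜 := ℝ) Complex.ofRealCLM φ

@[simp] lemma toComplex_apply (φ : 𝓢(Space d, ℝ)) (x : Space d) : toComplex φ x = (φ x : ℂ) := rfl

/-- The unnormalised Fourier transform of a Schwartz function is again a Schwartz function; it is
Mathlib's Fourier transform dilated by `2π`. -/
lemma exists_schwartz_eq_fourier (φ : 𝓢(Space d, ℂ)) :
    ∃ F : 𝓢(Space d, ℂ), ∀ ξ, F ξ = fourier (fun x => φ x) ξ := by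
  have h2 : ((2 * Real.pi)⁻¹ : ℝ) ≠ 0 := by positivity
  refine ⟨SchwartzMap.compCLMOfContinuousLinearEquiv ℂ
    (ContinuousLinearEquiv.smulLeft (R₁ := ℝ) (M₁ := Space d) (Units.mk0 _ h2))
    (FourierTransform.fourier φ), fun ξ => ?_⟩
  have : (SchwartzMap.compCLMOfContinuousLinearEquiv ℂ
    (ContinuousLinearEquiv.smulLeft (R₁ := ℝ) (M₁ := Space d) (Units.mk0 _ h2))
      (FourierTransform.fourier φ)) ξ
      = FourierTransform.fourier (φ : Space d → ℂ) ((2 * Real.pi)⁻¹ • ξ) := rfl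
  rw [this, Real.fourier_eq']
  refine integral_congr_ae (ae_of_all _ fun x => ?_)
  simp only [smul_eq_mul]
  congr 2
  rw [inner_smul_right, real_inner_comm]
  push_cast
  field_simp

/-- The Fourier transform of a complex Schwartz function as a Schwartz function. -/
def fourierSchwartz (φ : 𝓢(Space d, ℂ)) : 𝓢(Space d, ℂ) := (exists_schwartz_eq_fourier φ).choose

lemma fourierSchwartz_apply (φ : 𝓢(Space d, ℂ)) (ξ : Space d) :
    fourierSchwartz φ ξ = fourier (fun x => φ x) ξ := (exists_schwartz_eq_fourier φ).choose_spec ξ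

lemma schwartzFourier_eq (φ : 𝓢(Space d, ℝ)) :
    schwartzFourier φ = fourierSchwartz (toComplex φ) := by
  funext ξ
  rw [fourierSchwartz_apply]
  rfl

lemma continuous_schwartzFourier (φ : 𝓢(Space d, ℝ)) : Continuous (schwartzFourier φ) := by
  rw [schwartzFourier_eq]
  exact (fourierSchwartz _).continuous

/-- Fourier transform `∫ exp (-i ξ·x) ν(dx)` of a measure `ν`, in the normalisation of `fourier`. -/
def measureFourier (ν : Measure (Space d)) (ξ : Space d) : ℂ := ∫ x, diracFourier x ξ ∂ν

lemma norm_measureFourier_le {ν : Measure (Space d)} (hν : ν Set.univ ≤ 1) (ξ : Space d) :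
    ‖measureFourier ν ξ‖ ≤ 1 := by
  refine (norm_integral_le_integral_norm _).trans ?_
  simp only [norm_diracFourier, integral_const, smul_eq_mul, mul_one]
  exact ENNReal.toReal_le_of_le_ofReal zero_le_one (by simpa using hν)

lemma continuous_measureFourier (ν : Measure (Space d)) [IsFiniteMeasure ν] :
    Continuous (measureFourier ν) := by
  refine continuous_of_dominated (bound := fun _ => 1)
    (fun ξ => (Continuous.aestronglyMeasurable (by fun_prop)))
    (fun ξ => ae_of_all _ fun x => (norm_diracFourier x ξ).le) (integrable_const _)
    (ae_of_all _ fun x => by fun_prop)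

lemma integrable_diracFourier (ν : Measure (Space d)) [IsFiniteMeasure ν] (ξ : Space d) :
    Integrable (fun x => diracFourier x ξ) ν := by
  refine Integrable.of_bound (C := 1)
    (Continuous.aestronglyMeasurable (by fun_prop))
    (ae_of_all _ fun x => (norm_diracFourier x ξ).le)

/-! ### The spatial covariance -/

variable {f : Space d → ℝ≥0∞} {μ : Measure (Space d)}

/-- The defining identity of `μ`, for translated test functions. -/
lemma IsSpatialCovariance.integral_translate (hf : IsSpatialCovariance f μ) (φ : 𝓢(Space d, ℂ))
    (c : Space d) :
    ∫ x, ((f x).toReal : ℂ) * φ (x - c)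
      = ∫ ξ, diracFourier c ξ * fourierSchwartz φ ξ ∂μ := by
  have h := hf.integral_eq (SchwartzMap.compSubConstCLM ℂ c φ)
  simp only [SchwartzMap.compSubConstCLM_apply] at h
  rw [h]
  refine integral_congr_ae (ae_of_all _ fun ξ => ?_)
  simp only [fourierSchwartz_apply]
  have h3 : fourier (fun x => φ (x - c)) ξ
      = ∫ x, diracFourier (x - c + c) ξ * φ (x - c) := by
    simp only [sub_add_cancel]
    rfl
  rw [h3, integral_sub_right_eq_self (fun x => diracFourier (x + c) ξ * φ x) c, fourier,
    ← integral_const_mul]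
  refine integral_congr_ae (ae_of_all _ fun x => ?_)
  simp only [diracFourier_add]
  rw [diracFourier]
  ring

lemma IsSpatialCovariance.integrable_translate (hf : IsSpatialCovariance f μ)
    (φ : 𝓢(Space d, ℝ)) (c : Space d) :
    Integrable (fun x => (f x).toReal * φ (x - c)) := by
  have h := hf.integrable_mul (SchwartzMap.compSubConstCLM ℂ c (toComplex φ))
  simpa using h.re

/-- Nonnegative test functions of integral one supported in a given ball. -/
lemma exists_bump (c : Space d) {r : ℝ} (hr : 0 < r) :
    ∃ B : 𝓢(Space d, ℝ), (∀ x, 0 ≤ B x) ∧ ∫ x, B x = 1 ∧ ∀ x, r ≤ ‖x - c‖ → B x = 0 := by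
  let b : ContDiffBump c := ⟨r / 2, r, by positivity, by linarith⟩
  refine ⟨(b.hasCompactSupport_normed (μ := volume)).toSchwartzMap b.contDiff_normed,
    fun x => b.nonneg_normed x, b.integral_normed, fun x hx => ?_⟩
  have : x ∉ Function.support (b.normed volume) := by
    rw [b.support_normed_eq]
    simpa [dist_eq_norm] using hx
  simpa using this

/-- The integral of `f` against the translates of a nonnegative test function is bounded: in Fourier
variables, a translation only changes the phase. -/
lemma IsSpatialCovariance.lintegral_translate_le_of_nonneg (hf : IsSpatialCovariance f μ)
    (B : 𝓢(Space d, ℝ)) (hB : ∀ x, 0 ≤ B x) (c : Space d) :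
    ∫⁻ x, ENNReal.ofReal ((f x).toReal * B (x - c))
      ≤ ENNReal.ofReal (∫ ξ, ‖fourierSchwartz (toComplex B) ξ‖ ∂μ) := by
  rw [← ofReal_integral_eq_lintegral_ofReal (hf.integrable_translate B c)
    (ae_of_all _ fun x => mul_nonneg ENNReal.toReal_nonneg (hB _))]
  refine ENNReal.ofReal_le_ofReal ?_
  have h := hf.integral_translate (toComplex B) c
  have h2 : ∫ x, ((f x).toReal : ℂ) * toComplex B (x - c)
      = ((∫ x, (f x).toReal * B (x - c) : ℝ) : ℂ) := by
    rw [← integral_complex_ofReal]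
    simp
  rw [h2] at h
  calc ∫ x, (f x).toReal * B (x - c) ≤ ‖((∫ x, (f x).toReal * B (x - c) : ℝ) : ℂ)‖ := by
        rw [Complex.norm_real]
        exact le_abs_self _
    _ ≤ ∫ ξ, ‖diracFourier c ξ * fourierSchwartz (toComplex B) ξ‖ ∂μ := by
        rw [h]
        exact norm_integral_le_integral_norm _
    _ = _ := by simp [norm_diracFourier]

/-- The kernel `f` is uniformly locally integrable, so it is integrable, uniformly over
translations, against any Schwartz function: `|φ|` is at most a superposition of translates of a
nonnegative test function `B`, and `∫ f(x) B(x - c) dx ≤ ∫ |𝓕B| dμ` for every `c`. -/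
lemma IsSpatialCovariance.exists_lintegral_translate_le (hf : IsSpatialCovariance f μ)
    (φ : 𝓢(Space d, ℝ)) :
    ∃ C : ℝ≥0, ∀ c, ∫⁻ x, ENNReal.ofReal ((f x).toReal * |φ (x - c)|) ≤ C := by
  obtain ⟨B, hB0, hB1, hBs⟩ := exists_bump (0 : Space d) one_pos
  set M := ∫ ξ, ‖fourierSchwartz (toComplex B) ξ‖ ∂μ
  set D : ℕ := Module.finrank ℝ (Space d) + 1
  obtain ⟨A, hA⟩ : ∃ A : ℝ, ∀ x, (1 + ‖x‖) ^ D * |φ x| ≤ A := by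
    have h := SchwartzMap.one_add_le_sup_seminorm_apply (𝕜 := ℝ) (m := (D, 0)) (k := D) (n := 0)
      le_rfl le_rfl φ
    simp only [norm_iteratedFDeriv_zero, Real.norm_eq_abs] at h
    exact ⟨_, h⟩
  set k : Space d → ℝ := fun w => (1 + ‖w‖) ^ (-(D : ℝ)) with hk
  have hki : Integrable k := integrable_one_add_norm (by simp [D])
  have hk0 : ∀ w, 0 ≤ k w := fun w => by positivity
  have hA0 : 0 ≤ A := le_trans (by positivity) (hA 0)
  -- For `|x - w| < 1` the weights `1 + |w|` and `1 + |x|` are comparable, so that `|φ(x)|` is at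
  -- most a multiple of `k w`.
  have key : ∀ x, ENNReal.ofReal |φ x| ≤ ∫⁻ w, ENNReal.ofReal (B (x - w) * (A * 2 ^ D * k w)) := by
    intro x
    have h1 : ENNReal.ofReal |φ x| = ∫⁻ w, ENNReal.ofReal (B (x - w) * |φ x|) := by
      rw [← ofReal_integral_eq_lintegral_ofReal, integral_mul_const]
      · rw [integral_sub_left_eq_self (fun w => B w) volume x, hB1, one_mul]
      · exact ((B.integrable (μ := volume)).comp_sub_left x).mul_const _
      · exact ae_of_all _ fun w => mul_nonneg (hB0 _) (abs_nonneg _)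
    rw [h1]
    refine lintegral_mono fun w => ENNReal.ofReal_le_ofReal ?_
    by_cases hw : 1 ≤ ‖x - w - 0‖
    · rw [hBs _ hw]
      simp
    refine mul_le_mul_of_nonneg_left ?_ (hB0 _)
    have h3 : 1 + ‖w‖ ≤ 2 * (1 + ‖x‖) := by
      have : ‖w‖ ≤ ‖x‖ + ‖x - w‖ := by
        have := norm_sub_norm_le w x
        rw [norm_sub_rev] at this
        linarith
      simp only [sub_zero, not_le] at hw
      have := norm_nonneg x
      linarith
    have h4 : k w = ((1 + ‖w‖) ^ D)⁻¹ := by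
      rw [hk]
      simp only
      rw [Real.rpow_neg (by positivity), Real.rpow_natCast]
    rw [h4, ← div_eq_mul_inv, le_div_iff₀ (by positivity)]
    calc |φ x| * (1 + ‖w‖) ^ D ≤ |φ x| * (2 * (1 + ‖x‖)) ^ D := by gcongr
      _ = ((1 + ‖x‖) ^ D * |φ x|) * 2 ^ D := by rw [mul_pow]; ring
      _ ≤ A * 2 ^ D := by gcongr; exact hA x
  have hfm : Measurable fun x => (f x).toReal := hf.measurable.ennreal_toReal
  have hBm : Measurable B := B.continuous.measurable
  have hkm : Measurable k := by
    rw [hk]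
    fun_prop
  refine ⟨(ENNReal.ofReal M * ∫⁻ w, ENNReal.ofReal (A * 2 ^ D * k w)).toNNReal, fun c => ?_⟩
  rw [ENNReal.coe_toNNReal (ENNReal.mul_ne_top ENNReal.ofReal_ne_top
    (Integrable.lintegral_lt_top (hki.const_mul _)).ne)]
  calc ∫⁻ x, ENNReal.ofReal ((f x).toReal * |φ (x - c)|)
      ≤ ∫⁻ x, ENNReal.ofReal (f x).toReal *
          ∫⁻ w, ENNReal.ofReal (B (x - c - w) * (A * 2 ^ D * k w)) := by
        refine lintegral_mono fun x => ?_
        rw [ENNReal.ofReal_mul ENNReal.toReal_nonneg]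
        gcongr
        exact key _
    _ = ∫⁻ x, ∫⁻ w, ENNReal.ofReal ((f x).toReal * B (x - (c + w))) *
          ENNReal.ofReal (A * 2 ^ D * k w) := by
        refine lintegral_congr fun x => ?_
        rw [← lintegral_const_mul _ (by fun_prop)]
        refine lintegral_congr fun w => ?_
        rw [← ENNReal.ofReal_mul ENNReal.toReal_nonneg, ← ENNReal.ofReal_mul
          (mul_nonneg ENNReal.toReal_nonneg (hB0 _))]
        congr 1
        rw [sub_sub]
        ring
    _ = ∫⁻ w, ∫⁻ x, ENNReal.ofReal ((f x).toReal * B (x - (c + w))) *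
          ENNReal.ofReal (A * 2 ^ D * k w) := by
        refine lintegral_lintegral_swap (Measurable.aemeasurable ?_)
        simp only [Function.uncurry_def]
        exact ((hfm.comp measurable_fst).mul (hBm.comp (by fun_prop))).ennreal_ofReal.mul
          (by fun_prop)
    _ ≤ ∫⁻ w, ENNReal.ofReal M * ENNReal.ofReal (A * 2 ^ D * k w) := by
        refine lintegral_mono fun w => ?_
        rw [lintegral_mul_const _ (by fun_prop)]
        gcongr
        exact hf.lintegral_translate_le_of_nonneg B hB0 _
    _ = _ := lintegral_const_mul _ (by fun_prop)

/-- Temperate growth bounds the measure of every ball. -/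
lemma sigmaFinite_of_hasTemperateGrowth (μ : Measure (Space d)) [hμ : μ.HasTemperateGrowth] :
    SigmaFinite μ := by
  obtain ⟨n, hn⟩ := hμ.exists_integrable
  have : IsLocallyFiniteMeasure μ := by
    refine ⟨fun x => ⟨Metric.ball x 1, Metric.ball_mem_nhds x one_pos, ?_⟩⟩
    refine lt_of_le_of_lt (measure_mono fun y hy => ?_)
      (hn.measure_norm_ge_lt_top (ε := (2 + ‖x‖) ^ (-(n : ℝ))) (by positivity))
    have h1 : ‖y‖ ≤ ‖x‖ + 1 := by
      have h2 := norm_sub_norm_le y x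
      have h3 : ‖y - x‖ < 1 := by simpa [dist_eq_norm] using hy
      linarith
    simp only [Set.mem_ofPred_eq]
    refine le_trans ?_ (le_abs_self _)
    exact Real.rpow_le_rpow_of_nonpos (by positivity) (by linarith) (by simp)
  infer_instance

/-! ### Convolution of a measure with a test function -/

/-- The convolution `ν * φ` of a measure with a Schwartz function. -/
def smear (ν : Measure (Space d)) (φ : 𝓢(Space d, ℝ)) (y : Space d) : ℝ := ∫ x, φ (y - x) ∂ν

lemma isFiniteMeasure_of_le_one {ν : Measure (Space d)} (hν : ν Set.univ ≤ 1) :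
    IsFiniteMeasure ν := ⟨hν.trans_lt ENNReal.one_lt_top⟩

lemma exists_norm_le (φ : 𝓢(Space d, ℝ)) : ∃ C, ∀ x, ‖φ x‖ ≤ C :=
  ⟨_, SchwartzMap.norm_le_seminorm ℝ φ⟩

lemma continuous_smear {ν : Measure (Space d)} (hν : ν Set.univ ≤ 1) (φ : 𝓢(Space d, ℝ)) :
    Continuous (smear ν φ) := by
  have := isFiniteMeasure_of_le_one hν
  obtain ⟨C, hC⟩ := exists_norm_le φ
  refine continuous_of_dominated (bound := fun _ => C) (fun y => ?_)
    (fun y => ae_of_all _ fun x => hC _) (integrable_const _) (ae_of_all _ fun x => ?_)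
  · exact (φ.continuous.comp (by fun_prop)).aestronglyMeasurable
  · exact φ.continuous.comp (by fun_prop)

lemma ofReal_abs_smear_le (ν : Measure (Space d)) (φ : 𝓢(Space d, ℝ))
    (y : Space d) : ENNReal.ofReal |smear ν φ y| ≤ ∫⁻ x, ENNReal.ofReal |φ (y - x)| ∂ν := by
  rw [← Real.enorm_eq_ofReal_abs]
  refine (enorm_integral_le_lintegral_enorm _).trans (le_of_eq ?_)
  simp only [Real.enorm_eq_ofReal_abs]

lemma lintegral_smear_le {ν : Measure (Space d)} (hν : ν Set.univ ≤ 1) (φ : 𝓢(Space d, ℝ)) :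
    ∫⁻ y, ENNReal.ofReal |smear ν φ y| ≤ ∫⁻ y, ENNReal.ofReal |φ y| := by
  have := isFiniteMeasure_of_le_one hν
  have hφ : Measurable φ := φ.continuous.measurable
  calc ∫⁻ y, ENNReal.ofReal |smear ν φ y|
      ≤ ∫⁻ y, ∫⁻ x, ENNReal.ofReal |φ (y - x)| ∂ν :=
        lintegral_mono fun y => ofReal_abs_smear_le ν φ y
    _ = ∫⁻ x, (∫⁻ y, ENNReal.ofReal |φ (y - x)|) ∂ν := by
        refine lintegral_lintegral_swap (Measurable.aemeasurable ?_)
        simp only [Function.uncurry_def]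
        fun_prop
    _ = (∫⁻ y, ENNReal.ofReal |φ y|) * ν Set.univ := by
        simp_rw [lintegral_sub_right_eq_self (fun y => ENNReal.ofReal |φ y|)]
        rw [lintegral_const]
    _ ≤ _ := mul_le_of_le_one_right' hν

lemma integrable_smear {ν : Measure (Space d)} (hν : ν Set.univ ≤ 1) (φ : 𝓢(Space d, ℝ)) :
    Integrable (smear ν φ) := by
  refine ⟨(continuous_smear hν φ).aestronglyMeasurable, ?_⟩
  refine lt_of_le_of_lt ?_ (φ.integrable (μ := volume)).2
  simpa only [Real.enorm_eq_ofReal_abs] using lintegral_smear_le hν φ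

lemma fourier_smear {ν : Measure (Space d)} (hν : ν Set.univ ≤ 1) (φ : 𝓢(Space d, ℝ))
    (ξ : Space d) :
    fourier (fun y => (smear ν φ y : ℂ)) ξ = measureFourier ν ξ * schwartzFourier φ ξ := by
  have := isFiniteMeasure_of_le_one hν
  have hφ : Measurable φ := φ.continuous.measurable
  have h1 : fourier (fun y => (smear ν φ y : ℂ)) ξ
      = ∫ y, ∫ x, diracFourier y ξ * (φ (y - x) : ℂ) ∂ν := by
    refine integral_congr_ae (ae_of_all _ fun y => ?_)
    simp only [smear]
    rw [integral_const_mul, integral_complex_ofReal]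
    rfl
  have hint : Integrable (Function.uncurry fun (y x : Space d) => diracFourier y ξ * (φ (y - x) : ℂ))
      (volume.prod ν) := by
    refine (integrable_prod_iff' ?_).2 ⟨ae_of_all _ fun x => ?_, ?_⟩
    · refine Continuous.aestronglyMeasurable ?_
      simp only [Function.uncurry_def]
      exact Continuous.mul (by fun_prop)
        (Complex.continuous_ofReal.comp (φ.continuous.comp (by fun_prop)))
    · refine ((φ.integrable (μ := volume)).comp_sub_right x).ofReal.bdd_mul (c := 1)
        (Continuous.aestronglyMeasurable (by fun_prop))
        (ae_of_all _ fun y => (norm_diracFourier y ξ).le)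
    · simp only [Function.uncurry_def, norm_mul, norm_diracFourier, one_mul, Complex.norm_real]
      simp_rw [integral_sub_right_eq_self (fun y => ‖φ y‖)]
      exact integrable_const _
  rw [h1, integral_integral_swap hint]
  have h2 : ∀ x, ∫ y, diracFourier y ξ * (φ (y - x) : ℂ)
      = diracFourier x ξ * schwartzFourier φ ξ := by
    intro x
    have h3 := integral_sub_right_eq_self (μ := (volume : Measure (Space d)))
      (fun y => diracFourier (y + x) ξ * (φ y : ℂ)) x
    simp only [sub_add_cancel] at h3
    rw [h3, schwartzFourier, fourier, ← integral_const_mul]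
    refine integral_congr_ae (ae_of_all _ fun y => ?_)
    simp only [diracFourier_add]
    rw [diracFourier, diracFourier]
    ring
  simp_rw [h2]
  rw [integral_mul_const, measureFourier]

/-! ### The spatial bilinear form -/

/-- A bound for `∫ f(x) |φ(x - c)| dx` that is uniform in `c` is inherited by the superpositions of
translates of `|φ|`. -/
lemma lintegral_covariance_smear_le {ν : Measure (Space d)} (hν : ν Set.univ ≤ 1)
    (hf : IsSpatialCovariance f μ) {φ : 𝓢(Space d, ℝ)} {C : ℝ≥0}
    (hC : ∀ c, ∫⁻ x, ENNReal.ofReal ((f x).toReal * |φ (x - c)|) ≤ C) (y : Space d) :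
    ∫⁻ x, ∫⁻ a, ENNReal.ofReal ((f (x - y)).toReal * |φ (x - a)|) ∂ν ≤ C := by
  have := isFiniteMeasure_of_le_one hν
  have hφ : Measurable φ := φ.continuous.measurable
  have hfm : Measurable fun x => (f x).toReal := hf.measurable.ennreal_toReal
  rw [lintegral_lintegral_swap]
  · calc ∫⁻ a, (∫⁻ x, ENNReal.ofReal ((f (x - y)).toReal * |φ (x - a)|)) ∂ν
        ≤ ∫⁻ _, (C : ℝ≥0∞) ∂ν := by
          refine lintegral_mono fun a => le_trans (le_of_eq ?_) (hC (a - y))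
          rw [← lintegral_sub_right_eq_self
            (fun x => ENNReal.ofReal ((f x).toReal * |φ (x - (a - y))|)) y]
          simp only [sub_sub_sub_cancel_right]
      _ ≤ C := by
          rw [lintegral_const]
          exact mul_le_of_le_one_right' hν
  · refine Measurable.aemeasurable ?_
    simp only [Function.uncurry_def]
    exact ((hfm.comp (by fun_prop)).mul (by fun_prop)).ennreal_ofReal

/-- `∫ f(x - y) (ν * φ)(x) dx` in Fourier variables. -/
lemma integral_covariance_smear {ν : Measure (Space d)} (hν : ν Set.univ ≤ 1)
    (hf : IsSpatialCovariance f μ) (φ : 𝓢(Space d, ℝ)) (y : Space d) :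
    ∫ x, (((f (x - y)).toReal * smear ν φ x : ℝ) : ℂ)
      = ∫ ξ, diracFourier (-y) ξ * (measureFourier ν ξ * schwartzFourier φ ξ) ∂μ := by
  have := isFiniteMeasure_of_le_one hν
  have := hf.tempered
  have := sigmaFinite_of_hasTemperateGrowth μ
  have hφ : Measurable φ := φ.continuous.measurable
  have hfm : Measurable fun x => (f x).toReal := hf.measurable.ennreal_toReal
  obtain ⟨C, hC⟩ := hf.exists_lintegral_translate_le φ
  have hm : Measurable (Function.uncurry fun (x a : Space d) =>
      (((f (x - y)).toReal * φ (x - a) : ℝ) : ℂ)) := by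
    simp only [Function.uncurry_def]
    exact Complex.measurable_ofReal.comp ((hfm.comp (by fun_prop)).mul (by fun_prop))
  have hint : Integrable (Function.uncurry fun (x a : Space d) =>
      (((f (x - y)).toReal * φ (x - a) : ℝ) : ℂ)) (volume.prod ν) := by
    refine ⟨hm.aestronglyMeasurable, ?_⟩
    rw [HasFiniteIntegral, lintegral_prod _ hm.enorm.aemeasurable]
    refine lt_of_le_of_lt (le_of_eq ?_)
      ((lintegral_covariance_smear_le hν hf hC y).trans_lt ENNReal.coe_lt_top)
    refine lintegral_congr fun x => lintegral_congr fun a => ?_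
    simp only [Function.uncurry_def]
    rw [← ofReal_norm, Complex.norm_real, norm_mul, Real.norm_eq_abs, Real.norm_eq_abs,
      abs_of_nonneg ENNReal.toReal_nonneg]
  have hint2 : Integrable (Function.uncurry fun (a ξ : Space d) =>
      diracFourier (a - y) ξ * schwartzFourier φ ξ) (ν.prod μ) := by
    have h1 : Integrable (fun p : Space d × Space d => schwartzFourier φ p.2) (ν.prod μ) := by
      rw [schwartzFourier_eq]
      exact ((fourierSchwartz (toComplex φ)).integrable (μ := μ)).comp_snd ν
    refine h1.bdd_mul (c := 1) (Continuous.aestronglyMeasurable (by fun_prop))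
      (ae_of_all _ fun p => (norm_diracFourier _ _).le)
  calc ∫ x, (((f (x - y)).toReal * smear ν φ x : ℝ) : ℂ)
      = ∫ x, ∫ a, (((f (x - y)).toReal * φ (x - a) : ℝ) : ℂ) ∂ν := by
        refine integral_congr_ae (ae_of_all _ fun x => ?_)
        simp only [smear]
        rw [← integral_const_mul, integral_complex_ofReal]
    _ = ∫ a, (∫ x, (((f (x - y)).toReal * φ (x - a) : ℝ) : ℂ)) ∂ν := integral_integral_swap hint
    _ = ∫ a, (∫ ξ, diracFourier (a - y) ξ * schwartzFourier φ ξ ∂μ) ∂ν := by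
        refine integral_congr_ae (ae_of_all _ fun a => ?_)
        simp only
        rw [schwartzFourier_eq, ← hf.integral_translate (toComplex φ) (a - y),
          ← integral_sub_right_eq_self
            (fun x => ((f x).toReal : ℂ) * toComplex φ (x - (a - y))) y]
        simp [sub_sub_sub_cancel_right]
    _ = ∫ ξ, (∫ a, diracFourier (a - y) ξ * schwartzFourier φ ξ ∂ν) ∂μ :=
        integral_integral_swap hint2
    _ = _ := by
        refine integral_congr_ae (ae_of_all _ fun ξ => ?_)
        simp only [sub_eq_neg_add, diracFourier_add]
        rw [integral_mul_const, integral_const_mul, measureFourier, mul_assoc]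

/-- The bilinear form with kernel `f(x - y)` converges absolutely on the functions `ν₁ * φ₁` and
`ν₂ * φ₂`, uniformly over the measures `ν₁` and `ν₂` of mass at most one. -/
lemma lintegral_spatial_le (hf : IsSpatialCovariance f μ) (φ₁ φ₂ : 𝓢(Space d, ℝ)) :
    ∃ C : ℝ≥0, ∀ ν₁ ν₂ : Measure (Space d), ν₁ Set.univ ≤ 1 → ν₂ Set.univ ≤ 1 →
      ∫⁻ p : Space d × Space d,
        ‖(f (p.1 - p.2)).toReal * smear ν₁ φ₁ p.1 * smear ν₂ φ₂ p.2‖ₑ ≤ C := by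
  obtain ⟨C, hC⟩ := hf.exists_lintegral_translate_le φ₁
  have hfin : ∫⁻ y, ENNReal.ofReal |φ₂ y| ≠ ∞ := by
    have := (φ₂.integrable (μ := volume)).2
    simp only [HasFiniteIntegral, Real.enorm_eq_ofReal_abs] at this
    exact this.ne
  refine ⟨C * (∫⁻ y, ENNReal.ofReal |φ₂ y|).toNNReal, fun ν₁ ν₂ h₁ h₂ => ?_⟩
  have hfm : Measurable fun x => (f x).toReal := hf.measurable.ennreal_toReal
  have hs1 : Measurable (smear ν₁ φ₁) := (continuous_smear h₁ φ₁).measurable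
  have hs2 : Measurable (smear ν₂ φ₂) := (continuous_smear h₂ φ₂).measurable
  have hφ : Measurable φ₁ := φ₁.continuous.measurable
  have := isFiniteMeasure_of_le_one h₁
  have hm : Measurable fun p : Space d × Space d =>
      (f (p.1 - p.2)).toReal * smear ν₁ φ₁ p.1 * smear ν₂ φ₂ p.2 :=
    ((hfm.comp (by fun_prop)).mul (by fun_prop)).mul (by fun_prop)
  rw [Measure.volume_eq_prod, lintegral_prod_symm _ hm.enorm.aemeasurable, ENNReal.coe_mul,
    ENNReal.coe_toNNReal hfin]
  calc ∫⁻ y, ∫⁻ x, ‖(f (x - y)).toReal * smear ν₁ φ₁ x * smear ν₂ φ₂ y‖ₑ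
      ≤ ∫⁻ y, C * ENNReal.ofReal |smear ν₂ φ₂ y| := by
        refine lintegral_mono fun y => ?_
        simp only [enorm_mul]
        rw [lintegral_mul_const, Real.enorm_eq_ofReal_abs (smear ν₂ φ₂ y)]
        · gcongr
          refine le_trans (lintegral_mono fun x => ?_) (lintegral_covariance_smear_le h₁ hf hC y)
          rw [Real.enorm_eq_ofReal_abs, Real.enorm_eq_ofReal_abs,
            abs_of_nonneg ENNReal.toReal_nonneg]
          simp_rw [ENNReal.ofReal_mul ENNReal.toReal_nonneg]
          rw [lintegral_const_mul _ (by fun_prop)]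
          gcongr
          exact ofReal_abs_smear_le ν₁ φ₁ x
        · exact ((hfm.comp (by fun_prop)).enorm).mul hs1.enorm
    _ = C * ∫⁻ y, ENNReal.ofReal |smear ν₂ φ₂ y| := lintegral_const_mul _ (by fun_prop)
    _ ≤ _ := mul_le_mul_right (lintegral_smear_le h₂ φ₂) _

lemma measurable_spatial (hf : IsSpatialCovariance f μ) {k₁ k₂ : Space d → ℝ}
    (h₁ : Measurable k₁) (h₂ : Measurable k₂) :
    Measurable fun p : Space d × Space d => (f (p.1 - p.2)).toReal * k₁ p.1 * k₂ p.2 :=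
  ((hf.measurable.ennreal_toReal.comp (measurable_fst.sub measurable_snd)).mul
    (h₁.comp measurable_fst)).mul (h₂.comp measurable_snd)

lemma integrable_spatial (hf : IsSpatialCovariance f μ) (φ₁ φ₂ : 𝓢(Space d, ℝ))
    {ν₁ ν₂ : Measure (Space d)} (h₁ : ν₁ Set.univ ≤ 1) (h₂ : ν₂ Set.univ ≤ 1) :
    Integrable (fun p : Space d × Space d =>
      (f (p.1 - p.2)).toReal * smear ν₁ φ₁ p.1 * smear ν₂ φ₂ p.2) := by
  obtain ⟨C, hC⟩ := lintegral_spatial_le hf φ₁ φ₂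
  exact ⟨(measurable_spatial hf (continuous_smear h₁ φ₁).measurable
    (continuous_smear h₂ φ₂).measurable).aestronglyMeasurable,
    (hC ν₁ ν₂ h₁ h₂).trans_lt ENNReal.coe_lt_top⟩

/-- The spectral form of the spatial covariance:
`∫∫ f(x-y) (ν₁ * φ₁)(x) (ν₂ * φ₂)(y) dx dy = ∫ 𝓕(ν₁ * φ₁) conj (𝓕(ν₂ * φ₂)) dμ`. -/
lemma integral_spatial (hf : IsSpatialCovariance f μ) (φ₁ φ₂ : 𝓢(Space d, ℝ))
    {ν₁ ν₂ : Measure (Space d)} (h₁ : ν₁ Set.univ ≤ 1) (h₂ : ν₂ Set.univ ≤ 1) :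
    ((∫ p : Space d × Space d,
      (f (p.1 - p.2)).toReal * smear ν₁ φ₁ p.1 * smear ν₂ φ₂ p.2 : ℝ) : ℂ)
      = ∫ ξ, (measureFourier ν₁ ξ * schwartzFourier φ₁ ξ) *
          (starRingEnd ℂ) (measureFourier ν₂ ξ * schwartzFourier φ₂ ξ) ∂μ := by
  have := hf.tempered
  have := sigmaFinite_of_hasTemperateGrowth μ
  have := isFiniteMeasure_of_le_one h₁
  have hc1 := continuous_measureFourier ν₁
  rw [Measure.volume_eq_prod, integral_prod_symm _ (integrable_spatial hf φ₁ φ₂ h₁ h₂),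
    ← integral_complex_ofReal]
  have hint : Integrable (Function.uncurry fun (y ξ : Space d) =>
      (diracFourier (-y) ξ * (measureFourier ν₁ ξ * schwartzFourier φ₁ ξ)) * (smear ν₂ φ₂ y : ℂ))
      (volume.prod μ) := by
    have h3 : Integrable (fun p : Space d × Space d =>
        (smear ν₂ φ₂ p.1 : ℂ) * schwartzFourier φ₁ p.2) (volume.prod μ) := by
      rw [schwartzFourier_eq]
      exact (integrable_smear h₂ φ₂).ofReal.mul_prod
        ((fourierSchwartz (toComplex φ₁)).integrable (μ := μ))
    have h4 := h3.bdd_mul (c := 1) (f := fun p => diracFourier (-p.1) p.2 * measureFourier ν₁ p.2)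
      (Continuous.aestronglyMeasurable (by fun_prop))
      (ae_of_all _ fun p => by
        rw [norm_mul, norm_diracFourier, one_mul]
        exact norm_measureFourier_le h₁ _)
    refine h4.congr (ae_of_all _ fun p => ?_)
    simp only [Function.uncurry_def]
    ring
  calc ∫ y, ((∫ x, (f (x - y)).toReal * smear ν₁ φ₁ x * smear ν₂ φ₂ y : ℝ) : ℂ)
      = ∫ y, ∫ ξ, (diracFourier (-y) ξ * (measureFourier ν₁ ξ * schwartzFourier φ₁ ξ)) *
          (smear ν₂ φ₂ y : ℂ) ∂μ := by
        refine integral_congr_ae (ae_of_all _ fun y => ?_)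
        simp only
        rw [integral_mul_const, integral_mul_const, Complex.ofReal_mul,
          ← integral_covariance_smear h₁ hf, integral_complex_ofReal]
    _ = ∫ ξ, (∫ y, (diracFourier (-y) ξ * (measureFourier ν₁ ξ * schwartzFourier φ₁ ξ)) *
          (smear ν₂ φ₂ y : ℂ)) ∂μ := integral_integral_swap hint
    _ = _ := by
        refine integral_congr_ae (ae_of_all _ fun ξ => ?_)
        simp only
        rw [← fourier_smear h₂, fourier, ← integral_conj, ← integral_const_mul]
        refine integral_congr_ae (ae_of_all _ fun y => ?_)
        simp only [← conj_diracFourier, map_mul, Complex.conj_ofReal]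
        rw [diracFourier]
        ring

variable {H : ℝ}

/-! ### Space-time functions with a spectral representation -/

/-- Lebesgue measure on the half-line of times. -/
abbrev timeMeasure : Measure ℝ := (volume : Measure ℝ).restrict (Set.Ici 0)

/-- The indicator function of `[0,a]`. -/
def timeIndicator (a r : ℝ) : ℝ := (Set.Icc (0 : ℝ) a).indicator (fun _ => (1 : ℝ)) r

@[fun_prop]
lemma measurable_timeIndicator (a : ℝ) : Measurable (timeIndicator a) :=
  measurable_const.indicator measurableSet_Icc

lemma timeIndicator_nonneg (a r : ℝ) : 0 ≤ timeIndicator a r :=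
  Set.indicator_nonneg (fun _ _ => zero_le_one) _

/-- The kernel `|r - s|^{2H-2}` restricted to `[0,a] × [0,b]`. -/
def timeKernel (H a b : ℝ) (z : ℝ × ℝ) : ℝ :=
  timeIndicator a z.1 * timeIndicator b z.2 * |z.1 - z.2| ^ (2 * H - 2)

lemma timeKernel_nonneg (H a b : ℝ) (z : ℝ × ℝ) : 0 ≤ timeKernel H a b z :=
  mul_nonneg (mul_nonneg (timeIndicator_nonneg _ _) (timeIndicator_nonneg _ _)) (by positivity)

@[fun_prop]
lemma measurable_timeKernel (H a b : ℝ) : Measurable (timeKernel H a b) := by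
  unfold timeKernel
  fun_prop

lemma lintegral_abs_rpow_lt_top (hH : 1 / 2 < H) (hH' : H < 1) (T : ℝ) :
    ∫⁻ u in Set.Icc (-T) T, ENNReal.ofReal (|u| ^ (2 * H - 2)) < ∞ := by
  have h1 : IntegrableOn (fun u : ℝ => u ^ (2 * H - 2)) (Set.Ioc 0 T) := by
    rcases le_or_gt 0 T with h | h
    · rw [← intervalIntegrable_iff_integrableOn_Ioc_of_le h]
      exact intervalIntegral.intervalIntegrable_rpow' (by linarith)
    · rw [Set.Ioc_eq_empty (not_lt.2 h.le)]
      exact integrableOn_empty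
  have h2 : ∫⁻ u in Set.Ioc 0 T, ENNReal.ofReal (|u| ^ (2 * H - 2)) < ∞ := by
    refine lt_of_le_of_lt (le_of_eq ?_) h1.2
    refine setLIntegral_congr_fun measurableSet_Ioc fun u hu => ?_
    simp only
    rw [Real.enorm_eq_ofReal_abs, abs_of_pos hu.1, abs_of_nonneg (Real.rpow_nonneg hu.1.le _)]
  have h3 : ∫⁻ u, (Set.Ioc 0 T).indicator (fun u => ENNReal.ofReal (|u| ^ (2 * H - 2))) u < ∞ := by
    rwa [lintegral_indicator measurableSet_Ioc]
  have h4 : ∫⁻ u, (Set.Ioc 0 T).indicator (fun u => ENNReal.ofReal (|u| ^ (2 * H - 2))) (-u) < ∞ := by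
    rwa [lintegral_neg_eq_self (fun u : ℝ =>
      (Set.Ioc 0 T).indicator (fun u => ENNReal.ofReal (|u| ^ (2 * H - 2))) u)]
  rw [← lintegral_indicator measurableSet_Icc]
  refine lt_of_le_of_lt (lintegral_mono fun u => ?_)
    (lt_of_le_of_lt (lintegral_add_right _ ?_).le (ENNReal.add_lt_top.2 ⟨h3, h4⟩))
  · by_cases hu : u ∈ Set.Icc (-T) T
    · rw [Set.indicator_of_mem hu]
      rcases lt_trichotomy u 0 with h | h | h
      · have hmem : -u ∈ Set.Ioc 0 T := ⟨by linarith, by linarith [hu.1]⟩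
        rw [Set.indicator_of_mem hmem, abs_neg]
        exact le_add_self
      · rw [h, abs_zero, Real.zero_rpow (by linarith)]
        simp
      · have hmem : u ∈ Set.Ioc 0 T := ⟨h, hu.2⟩
        rw [Set.indicator_of_mem hmem]
        exact le_self_add
    · rw [Set.indicator_of_notMem hu]
      exact zero_le
  · exact (Measurable.indicator (by fun_prop) measurableSet_Ioc).comp measurable_neg

lemma integrable_timeKernel (hH : 1 / 2 < H) (hH' : H < 1) (a b : ℝ) :
    Integrable (timeKernel H a b) (timeMeasure.prod timeMeasure) := by
  refine Integrable.mono_measure (ν := volume.prod volume) ?_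
    (Measure.prod_mono Measure.restrict_le_self Measure.restrict_le_self)
  refine ⟨(measurable_timeKernel H a b).aestronglyMeasurable, ?_⟩
  rw [HasFiniteIntegral, lintegral_prod _ (measurable_timeKernel H a b).enorm.aemeasurable]
  set T := |a| + |b|
  set C := ∫⁻ u in Set.Icc (-T) T, ENNReal.ofReal (|u| ^ (2 * H - 2)) with hC
  have hCt : C < ∞ := lintegral_abs_rpow_lt_top hH hH' T
  have hb : ∀ r, ∫⁻ s, ‖timeKernel H a b (r, s)‖ₑ ≤ (Set.Icc 0 a).indicator (fun _ => C) r := by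
    intro r
    by_cases hr : r ∈ Set.Icc 0 a
    · rw [Set.indicator_of_mem hr, hC, ← lintegral_indicator measurableSet_Icc,
        ← lintegral_sub_left_eq_self ((Set.Icc (-T) T).indicator
          fun u => ENNReal.ofReal (|u| ^ (2 * H - 2))) r]
      refine lintegral_mono fun s => ?_
      by_cases hs : s ∈ Set.Icc 0 b
      · have hmem : r - s ∈ Set.Icc (-T) T := by
          have h1 := le_abs_self a
          have h2 := le_abs_self b
          have h3 := abs_nonneg a
          have h4 := abs_nonneg b
          constructor
          · have := hr.1; have := hs.2; simp only [T]; linarith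
          · have := hr.2; have := hs.1; simp only [T]; linarith
        rw [Set.indicator_of_mem hmem]
        simp only [timeKernel, timeIndicator, Set.indicator_of_mem hr, Set.indicator_of_mem hs]
        rw [one_mul, one_mul, Real.enorm_eq_ofReal (by positivity)]
      · simp [timeKernel, timeIndicator, Set.indicator_of_notMem hs]
    · rw [Set.indicator_of_notMem hr]
      simp [timeKernel, timeIndicator, Set.indicator_of_notMem hr]
  refine lt_of_le_of_lt (lintegral_mono hb) ?_
  rw [lintegral_indicator measurableSet_Icc, setLIntegral_const]
  exact ENNReal.mul_lt_top hCt (by simp)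

/-- Regrouping of `((r,s),(x,y))` as `((r,x),(s,y))`. -/
def regroup (α β : Type*) [MeasurableSpace α] [MeasurableSpace β] :
    (α × α) × (β × β) ≃ᵐ (α × β) × (α × β) where
  toEquiv := Equiv.prodProdProdComm α α β β
  measurable_toFun := by
    change Measurable fun z : (α × α) × (β × β) => ((z.1.1, z.2.1), (z.1.2, z.2.2))
    fun_prop
  measurable_invFun := by
    change Measurable fun z : (α × β) × (α × β) => ((z.1.1, z.2.1), (z.1.2, z.2.2))
    fun_prop

lemma measurePreserving_regroup {α β : Type*} [MeasurableSpace α] [MeasurableSpace β]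
    (m : Measure α) (n : Measure β) [SFinite m] [SFinite n] :
    MeasurePreserving (regroup α β) ((m.prod m).prod (n.prod n)) ((m.prod n).prod (m.prod n)) := by
  have h1 := measurePreserving_prodAssoc m m (n.prod n)
  have h2 : MeasurePreserving (Prod.map id (MeasurableEquiv.prodAssoc.symm))
      (m.prod (m.prod (n.prod n))) (m.prod ((m.prod n).prod n)) :=
    (MeasurePreserving.id m).prod (measurePreserving_prodAssoc m n n).symm
  have h3 : MeasurePreserving (Prod.map id (Prod.map Prod.swap id))
      (m.prod ((m.prod n).prod n)) (m.prod ((n.prod m).prod n)) :=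
    (MeasurePreserving.id m).prod
      ((Measure.measurePreserving_swap (μ := m) (ν := n)).prod (MeasurePreserving.id n))
  have h4 : MeasurePreserving (Prod.map id MeasurableEquiv.prodAssoc)
      (m.prod ((n.prod m).prod n)) (m.prod (n.prod (m.prod n))) :=
    (MeasurePreserving.id m).prod (measurePreserving_prodAssoc n m n)
  exact (measurePreserving_prodAssoc m n (m.prod n)).symm.comp (h4.comp (h3.comp (h2.comp h1)))

/-- The space-time function `(s,y) ↦ 1_{[0,a]}(s) (ν_s * φ)(y)`. -/
def atomFun (a : ℝ) (ν : ℝ → Measure (Space d)) (φ : 𝓢(Space d, ℝ)) (p : ℝ × Space d) : ℝ :=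
  timeIndicator a p.1 * smear (ν p.1) φ p.2

/-- The spatial Fourier transform of `atomFun a ν φ`. -/
def atomHat (a : ℝ) (ν : ℝ → Measure (Space d)) (φ : 𝓢(Space d, ℝ)) (p : ℝ × Space d) : ℂ :=
  timeIndicator a p.1 * (measureFourier (ν p.1) p.2 * schwartzFourier φ p.2)

/-- The linear span of the pairs `(h, ĥ)`, where `h(s,y) = 1_{[0,a]}(s) (ν_s * φ)(y)` with measures
`ν_s` of mass at most one and a Schwartz function `φ`, and `ĥ(s,·)` is the Fourier transform of
`h(s,·)`. It contains the elementary functions and the integrands of the weak solution. -/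
def spectralPairs (μ : Measure (Space d)) :
    Submodule ℝ ((ℝ × Space d → ℝ) × (ℝ × Space d → ℂ)) :=
  Submodule.span ℝ {p | ∃ (a : ℝ) (ν : ℝ → Measure (Space d)) (φ : 𝓢(Space d, ℝ)),
    (∀ s, ν s Set.univ ≤ 1) ∧ p = (atomFun a ν φ, atomHat a ν φ) ∧
    AEStronglyMeasurable (atomFun a ν φ) (spaceTime d) ∧
    AEStronglyMeasurable (atomHat a ν φ) (timeMeasure.prod μ)}

/-- The integrand `|r-s|^{2H-2} g₁(r,ξ) conj (g₂(s,ξ))` of the spectral form of the inner product,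
at the point `((r,s),ξ)`. -/
def spectralIntegrand (H : ℝ) (g₁ g₂ : ℝ × Space d → ℂ) (z : (ℝ × ℝ) × Space d) : ℂ :=
  ((|z.1.1 - z.1.2| ^ (2 * H - 2) : ℝ) : ℂ) * g₁ (z.1.1, z.2)
    * (starRingEnd ℂ) (g₂ (z.1.2, z.2))

lemma quasiMeasurePreserving_fst_snd (μ : Measure (Space d)) [SFinite μ] :
    Measure.QuasiMeasurePreserving (fun z : (ℝ × ℝ) × Space d => (z.1.1, z.2))
      ((timeMeasure.prod timeMeasure).prod μ) (timeMeasure.prod μ) := by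
  have h : MeasurePreserving (fun z : (ℝ × ℝ) × Space d => (z.1.2, (z.1.1, z.2)))
      ((timeMeasure.prod timeMeasure).prod μ) (timeMeasure.prod (timeMeasure.prod μ)) :=
    (measurePreserving_prodAssoc timeMeasure timeMeasure μ).comp
      ((Measure.measurePreserving_swap (μ := timeMeasure) (ν := timeMeasure)).prod
        (MeasurePreserving.id μ))
  exact Measure.quasiMeasurePreserving_snd.comp h.quasiMeasurePreserving

lemma quasiMeasurePreserving_snd_snd (μ : Measure (Space d)) [SFinite μ] :
    Measure.QuasiMeasurePreserving (fun z : (ℝ × ℝ) × Space d => (z.1.2, z.2))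
      ((timeMeasure.prod timeMeasure).prod μ) (timeMeasure.prod μ) :=
  Measure.quasiMeasurePreserving_snd.comp
    (measurePreserving_prodAssoc timeMeasure timeMeasure μ).quasiMeasurePreserving

lemma aestronglyMeasurable_spectralIntegrand [SFinite μ] {g₁ g₂ : ℝ × Space d → ℂ}
    (h₁ : AEStronglyMeasurable g₁ (timeMeasure.prod μ))
    (h₂ : AEStronglyMeasurable g₂ (timeMeasure.prod μ)) :
    AEStronglyMeasurable (spectralIntegrand H g₁ g₂) ((timeMeasure.prod timeMeasure).prod μ) := by
  refine AEStronglyMeasurable.mul (AEStronglyMeasurable.mul ?_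
    (h₁.comp_quasiMeasurePreserving (quasiMeasurePreserving_fst_snd μ)))
    (Complex.continuous_conj.comp_aestronglyMeasurable
      (h₂.comp_quasiMeasurePreserving (quasiMeasurePreserving_snd_snd μ)))
  refine Measurable.aestronglyMeasurable (Complex.measurable_ofReal.comp ?_)
  fun_prop

lemma aestronglyMeasurable_hpIntegrand (hf : IsSpatialCovariance f μ)
    {h₁ h₂ : ℝ × Space d → ℝ} (hm₁ : AEStronglyMeasurable h₁ (spaceTime d))
    (hm₂ : AEStronglyMeasurable h₂ (spaceTime d)) :
    AEStronglyMeasurable (hpIntegrand H f h₁ h₂) ((spaceTime d).prod (spaceTime d)) := by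
  have : SFinite (spaceTime d) := by unfold spaceTime; infer_instance
  refine AEStronglyMeasurable.mul (AEStronglyMeasurable.mul ?_ hm₁.comp_fst) hm₂.comp_snd
  refine Measurable.aestronglyMeasurable (Measurable.mul (by fun_prop) ?_)
  exact hf.measurable.ennreal_toReal.comp (by fun_prop)

/-- The pairs `p = (h₁, g₁)` and `q = (h₂, g₂)` satisfy Plancherel's identity
`⟨h₁,h₂⟩ = ∫∫∫ |r-s|^{2H-2} g₁(r,ξ) conj (g₂(s,ξ)) dr ds μ(dξ)`, with absolutely convergent
integrals (up to the factor `H(2H-1)`). -/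
structure Plancherel (H : ℝ) (f : Space d → ℝ≥0∞) (μ : Measure (Space d))
    (p q : (ℝ × Space d → ℝ) × (ℝ × Space d → ℂ)) : Prop where
  integrable : Integrable (hpIntegrand H f p.1 q.1) ((spaceTime d).prod (spaceTime d))
  integrable_spectral : Integrable (spectralIntegrand H p.2 q.2)
    ((timeMeasure.prod timeMeasure).prod μ)
  integral_eq : ((∫ z, hpIntegrand H f p.1 q.1 z ∂((spaceTime d).prod (spaceTime d)) : ℝ) : ℂ)
    = ∫ z, spectralIntegrand H p.2 q.2 z ∂((timeMeasure.prod timeMeasure).prod μ)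

lemma integrable_norm_schwartzFourier_mul [μ.HasTemperateGrowth] (φ₁ φ₂ : 𝓢(Space d, ℝ)) :
    Integrable (fun ξ => ‖schwartzFourier φ₁ ξ‖ * ‖schwartzFourier φ₂ ξ‖) μ := by
  rw [schwartzFourier_eq, schwartzFourier_eq]
  obtain ⟨C, hC⟩ : ∃ C, ∀ x, ‖fourierSchwartz (toComplex φ₁) x‖ ≤ C :=
    ⟨_, SchwartzMap.norm_le_seminorm ℝ _⟩
  exact ((fourierSchwartz (toComplex φ₂)).integrable (μ := μ)).norm.bdd_mul (c := C)
    (fourierSchwartz (toComplex φ₁)).continuous.norm.aestronglyMeasurable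
    (ae_of_all _ fun x => by simpa using hC x)

/-- Plancherel's identity for the generators of `spectralPairs`: for fixed times it is
`integral_spatial`, and the bounds there are uniform in time, so that only the integrability of the
temporal kernel on a rectangle is needed. -/
lemma plancherel_atom (hH : 1 / 2 < H) (hH' : H < 1) (hf : IsSpatialCovariance f μ)
    {a₁ a₂ : ℝ} {ν₁ ν₂ : ℝ → Measure (Space d)} {φ₁ φ₂ : 𝓢(Space d, ℝ)}
    (h₁ : ∀ s, ν₁ s Set.univ ≤ 1) (h₂ : ∀ s, ν₂ s Set.univ ≤ 1)
    (hm₁ : AEStronglyMeasurable (atomFun a₁ ν₁ φ₁) (spaceTime d))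
    (hm₂ : AEStronglyMeasurable (atomFun a₂ ν₂ φ₂) (spaceTime d))
    (hm₁' : AEStronglyMeasurable (atomHat a₁ ν₁ φ₁) (timeMeasure.prod μ))
    (hm₂' : AEStronglyMeasurable (atomHat a₂ ν₂ φ₂) (timeMeasure.prod μ)) :
    Plancherel H f μ (atomFun a₁ ν₁ φ₁, atomHat a₁ ν₁ φ₁) (atomFun a₂ ν₂ φ₂, atomHat a₂ ν₂ φ₂) := by
  have := hf.tempered
  have := sigmaFinite_of_hasTemperateGrowth μ
  have hK := integrable_timeKernel hH hH' a₁ a₂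
  have hmp : MeasurePreserving (regroup ℝ (Space d))
      ((timeMeasure.prod timeMeasure).prod (volume.prod volume))
      ((spaceTime d).prod (spaceTime d)) :=
    measurePreserving_regroup timeMeasure (volume : Measure (Space d))
  have hval : ∀ z : (ℝ × ℝ) × (Space d × Space d),
      hpIntegrand H f (atomFun a₁ ν₁ φ₁) (atomFun a₂ ν₂ φ₂) (regroup ℝ (Space d) z)
        = timeKernel H a₁ a₂ z.1 * ((f (z.2.1 - z.2.2)).toReal * smear (ν₁ z.1.1) φ₁ z.2.1 *
          smear (ν₂ z.1.2) φ₂ z.2.2) := by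
    intro z
    change |z.1.1 - z.1.2| ^ (2 * H - 2) * (f (z.2.1 - z.2.2)).toReal
      * (timeIndicator a₁ z.1.1 * smear (ν₁ z.1.1) φ₁ z.2.1)
      * (timeIndicator a₂ z.1.2 * smear (ν₂ z.1.2) φ₂ z.2.2) = _
    rw [timeKernel]
    ring
  have hm := (aestronglyMeasurable_hpIntegrand (H := H) hf hm₁ hm₂).comp_measurePreserving hmp
  have hint : Integrable (hpIntegrand H f (atomFun a₁ ν₁ φ₁) (atomFun a₂ ν₂ φ₂) ∘
      regroup ℝ (Space d)) ((timeMeasure.prod timeMeasure).prod (volume.prod volume)) := by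
    obtain ⟨C, hC⟩ := lintegral_spatial_le hf φ₁ φ₂
    refine ⟨hm, ?_⟩
    rw [HasFiniteIntegral, lintegral_prod _ hm.enorm]
    refine lt_of_le_of_lt (lintegral_mono fun z => ?_)
      ((lintegral_mul_const (C : ℝ≥0∞) (measurable_timeKernel H a₁ a₂).enorm).trans_lt
        (ENNReal.mul_lt_top hK.2 ENNReal.coe_lt_top))
    simp only [Function.comp_apply, hval, enorm_mul _ (_ * _ * _)]
    rw [lintegral_const_mul']
    · gcongr
      exact hC _ _ (h₁ _) (h₂ _)
    · simp
  have hspec : ∀ z : (ℝ × ℝ) × Space d,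
      spectralIntegrand H (atomHat a₁ ν₁ φ₁) (atomHat a₂ ν₂ φ₂) z
        = (timeKernel H a₁ a₂ z.1 : ℂ) * ((measureFourier (ν₁ z.1.1) z.2 * schwartzFourier φ₁ z.2) *
          (starRingEnd ℂ) (measureFourier (ν₂ z.1.2) z.2 * schwartzFourier φ₂ z.2)) := by
    intro z
    simp only [spectralIntegrand, atomHat, timeKernel, map_mul, Complex.conj_ofReal]
    push_cast
    ring
  have hints : Integrable (spectralIntegrand H (atomHat a₁ ν₁ φ₁) (atomHat a₂ ν₂ φ₂))
      ((timeMeasure.prod timeMeasure).prod μ) := by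
    refine (hK.mul_prod (integrable_norm_schwartzFourier_mul (μ := μ) φ₁ φ₂)).mono'
      (aestronglyMeasurable_spectralIntegrand hm₁' hm₂') (ae_of_all _ fun z => ?_)
    rw [hspec, norm_mul, Complex.norm_real, Real.norm_of_nonneg (timeKernel_nonneg _ _ _ _)]
    refine mul_le_mul_of_nonneg_left ?_ (timeKernel_nonneg _ _ _ _)
    rw [norm_mul, RCLike.norm_conj, norm_mul, norm_mul]
    gcongr
    · exact mul_le_of_le_one_left (norm_nonneg _) (norm_measureFourier_le (h₁ _) _)
    · exact mul_le_of_le_one_left (norm_nonneg _) (norm_measureFourier_le (h₂ _) _)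
  refine ⟨(hmp.integrable_comp_emb (regroup ℝ (Space d)).measurableEmbedding).1 hint, hints, ?_⟩
  rw [← hmp.integral_comp (regroup ℝ (Space d)).measurableEmbedding]
  change ((∫ z, (hpIntegrand H f (atomFun a₁ ν₁ φ₁) (atomFun a₂ ν₂ φ₂) ∘
      regroup ℝ (Space d)) z ∂((timeMeasure.prod timeMeasure).prod (volume.prod volume)) : ℝ) : ℂ)
    = _
  rw [integral_prod _ hint, integral_prod _ hints, ← integral_complex_ofReal]
  refine integral_congr_ae (ae_of_all _ fun z => ?_)
  simp only [Function.comp_apply, hval, hspec]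
  rw [integral_const_mul, integral_const_mul, Complex.ofReal_mul, ← Measure.volume_eq_prod,
    integral_spatial hf φ₁ φ₂ (h₁ _) (h₂ _)]

lemma Plancherel.add_left {p p' q : (ℝ × Space d → ℝ) × (ℝ × Space d → ℂ)}
    (h : Plancherel H f μ p q) (h' : Plancherel H f μ p' q) : Plancherel H f μ (p + p') q := by
  have e1 : hpIntegrand H f (p + p').1 q.1 = hpIntegrand H f p.1 q.1 + hpIntegrand H f p'.1 q.1 := by
    funext z
    simp only [hpIntegrand, Prod.fst_add, Pi.add_apply]
    ring
  have e2 : spectralIntegrand H (p + p').2 q.2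
      = spectralIntegrand H p.2 q.2 + spectralIntegrand H p'.2 q.2 := by
    funext z
    simp only [spectralIntegrand, Prod.snd_add, Pi.add_apply]
    ring
  refine ⟨e1 ▸ h.integrable.add h'.integrable,
    e2 ▸ h.integrable_spectral.add h'.integrable_spectral, ?_⟩
  rw [e1, e2, integral_add' h.integrable h'.integrable,
    integral_add' h.integrable_spectral h'.integrable_spectral, Complex.ofReal_add,
    h.integral_eq, h'.integral_eq]

lemma Plancherel.add_right {p q q' : (ℝ × Space d → ℝ) × (ℝ × Space d → ℂ)}
    (h : Plancherel H f μ p q) (h' : Plancherel H f μ p q') : Plancherel H f μ p (q + q') := by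
  have e1 : hpIntegrand H f p.1 (q + q').1 = hpIntegrand H f p.1 q.1 + hpIntegrand H f p.1 q'.1 := by
    funext z
    simp only [hpIntegrand, Prod.fst_add, Pi.add_apply]
    ring
  have e2 : spectralIntegrand H p.2 (q + q').2
      = spectralIntegrand H p.2 q.2 + spectralIntegrand H p.2 q'.2 := by
    funext z
    simp only [spectralIntegrand, Prod.snd_add, Pi.add_apply, map_add]
    ring
  refine ⟨e1 ▸ h.integrable.add h'.integrable,
    e2 ▸ h.integrable_spectral.add h'.integrable_spectral, ?_⟩
  rw [e1, e2, integral_add' h.integrable h'.integrable,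
    integral_add' h.integrable_spectral h'.integrable_spectral, Complex.ofReal_add,
    h.integral_eq, h'.integral_eq]

lemma Plancherel.smul_left {p q : (ℝ × Space d → ℝ) × (ℝ × Space d → ℂ)}
    (h : Plancherel H f μ p q) (c : ℝ) : Plancherel H f μ (c • p) q := by
  have e1 : hpIntegrand H f (c • p).1 q.1 = fun z => c * hpIntegrand H f p.1 q.1 z := by
    funext z
    simp only [hpIntegrand, Prod.smul_fst, Pi.smul_apply, smul_eq_mul]
    ring
  have e2 : spectralIntegrand H (c • p).2 q.2 = fun z => (c : ℂ) * spectralIntegrand H p.2 q.2 z := by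
    funext z
    simp only [spectralIntegrand, Prod.smul_snd, Pi.smul_apply, Complex.real_smul]
    ring
  refine ⟨e1 ▸ h.integrable.const_mul c, e2 ▸ h.integrable_spectral.const_mul (c : ℂ), ?_⟩
  rw [e1, e2, integral_const_mul, integral_const_mul, Complex.ofReal_mul, h.integral_eq]

lemma Plancherel.smul_right {p q : (ℝ × Space d → ℝ) × (ℝ × Space d → ℂ)}
    (h : Plancherel H f μ p q) (c : ℝ) : Plancherel H f μ p (c • q) := by
  have e1 : hpIntegrand H f p.1 (c • q).1 = fun z => c * hpIntegrand H f p.1 q.1 z := by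
    funext z
    simp only [hpIntegrand, Prod.smul_fst, Pi.smul_apply, smul_eq_mul]
    ring
  have e2 : spectralIntegrand H p.2 (c • q).2 = fun z => (c : ℂ) * spectralIntegrand H p.2 q.2 z := by
    funext z
    simp only [spectralIntegrand, Prod.smul_snd, Pi.smul_apply, Complex.real_smul, map_mul,
      Complex.conj_ofReal]
    ring
  refine ⟨e1 ▸ h.integrable.const_mul c, e2 ▸ h.integrable_spectral.const_mul (c : ℂ), ?_⟩
  rw [e1, e2, integral_const_mul, integral_const_mul, Complex.ofReal_mul, h.integral_eq]

lemma Plancherel.zero_left (q : (ℝ × Space d → ℝ) × (ℝ × Space d → ℂ)) :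
    Plancherel H f μ 0 q := by
  have e1 : hpIntegrand H f (0 : (ℝ × Space d → ℝ) × (ℝ × Space d → ℂ)).1 q.1 = 0 := by
    funext z
    simp [hpIntegrand]
  have e2 : spectralIntegrand H (0 : (ℝ × Space d → ℝ) × (ℝ × Space d → ℂ)).2 q.2 = 0 := by
    funext z
    simp [spectralIntegrand]
  refine ⟨e1 ▸ integrable_zero _ _ _, e2 ▸ integrable_zero _ _ _, ?_⟩
  rw [e1, e2]
  simp

lemma Plancherel.zero_right (p : (ℝ × Space d → ℝ) × (ℝ × Space d → ℂ)) :
    Plancherel H f μ p 0 := by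
  have e1 : hpIntegrand H f p.1 (0 : (ℝ × Space d → ℝ) × (ℝ × Space d → ℂ)).1 = 0 := by
    funext z
    simp [hpIntegrand]
  have e2 : spectralIntegrand H p.2 (0 : (ℝ × Space d → ℝ) × (ℝ × Space d → ℂ)).2 = 0 := by
    funext z
    simp [spectralIntegrand]
  refine ⟨e1 ▸ integrable_zero _ _ _, e2 ▸ integrable_zero _ _ _, ?_⟩
  rw [e1, e2]
  simp

/-- The inner product of the noise in Fourier variables, on the span of the pairs `(h, ĥ)`; both
sides are sesquilinear, so that the generators suffice. -/
lemma plancherel_of_mem (hH : 1 / 2 < H) (hH' : H < 1) (hf : IsSpatialCovariance f μ)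
    {p q : (ℝ × Space d → ℝ) × (ℝ × Space d → ℂ)} (hp : p ∈ spectralPairs μ)
    (hq : q ∈ spectralPairs μ) : Plancherel H f μ p q := by
  refine Submodule.span_induction₂ (p := fun p q _ _ => Plancherel H f μ p q) ?_ ?_ ?_ ?_ ?_ ?_ ?_
    hp hq
  · rintro _ _ ⟨a, ν, φ, h, rfl, hm, hm'⟩ ⟨a', ν', φ', h', rfl, hn, hn'⟩
    exact plancherel_atom hH hH' hf h h' hm hn hm' hn'
  · exact fun q _ => Plancherel.zero_left q
  · exact fun p _ => Plancherel.zero_right p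
  · exact fun _ _ _ _ _ _ h h' => h.add_left h'
  · exact fun _ _ _ _ _ _ h h' => h.add_right h'
  · exact fun c _ _ _ _ h => h.smul_left c
  · exact fun c _ _ _ _ h => h.smul_right c

lemma aestronglyMeasurable_of_mem {p : (ℝ × Space d → ℝ) × (ℝ × Space d → ℂ)}
    (hp : p ∈ spectralPairs μ) : AEStronglyMeasurable p.2 (timeMeasure.prod μ) := by
  refine Submodule.span_induction (p := fun p _ => AEStronglyMeasurable p.2 (timeMeasure.prod μ))
    ?_ ?_ ?_ ?_ hp
  · rintro _ ⟨a, ν, φ, h, rfl, hm, hm'⟩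
    exact hm'
  · exact aestronglyMeasurable_zero
  · exact fun _ _ _ _ h h' => h.add h'
  · exact fun c _ _ h => h.const_smul c

/-! ### The temporal quadratic form -/

/-- The measure `ε^{2H-4} dv dε` on the set of windows `(v, v + ε)`. -/
def windowMeasure (H : ℝ) : Measure (ℝ × ℝ) :=
  ((volume : Measure ℝ).prod (volume.restrict (Set.Ioi 0))).withDensity
    fun w => ENNReal.ofReal (w.2 ^ (2 * H - 4))

instance (H : ℝ) : SFinite (windowMeasure H) := by
  unfold windowMeasure
  infer_instance

/-- The indicator function of the window `(v, v + ε)`, for `w = (v, ε)`. -/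
def window (w : ℝ × ℝ) (r : ℝ) : ℝ := (Set.Ioo w.1 (w.1 + w.2)).indicator (fun _ => 1) r

lemma measurable_window_uncurry : Measurable fun p : (ℝ × ℝ) × ℝ => window p.1 p.2 := by
  have : (fun p : (ℝ × ℝ) × ℝ => window p.1 p.2)
      = Set.indicator {p : (ℝ × ℝ) × ℝ | p.1.1 < p.2 ∧ p.2 < p.1.1 + p.1.2} (fun _ => 1) := by
    funext p
    simp [window, Set.indicator, Set.mem_Ioo]
  rw [this]
  refine measurable_const.indicator ?_
  have h1 : Measurable fun p : (ℝ × ℝ) × ℝ => p.1.1 := by fun_prop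
  have h2 : Measurable fun p : (ℝ × ℝ) × ℝ => p.1.1 + p.1.2 := by fun_prop
  exact (measurableSet_lt h1 measurable_snd).inter (measurableSet_lt measurable_snd h2)

@[fun_prop]
lemma measurable_window {α : Type*} [MeasurableSpace α] {g : α → ℝ × ℝ} {h : α → ℝ}
    (hg : Measurable g) (hh : Measurable h) : Measurable fun a => window (g a) (h a) :=
  measurable_window_uncurry.comp (hg.prodMk hh)

lemma window_nonneg (w : ℝ × ℝ) (r : ℝ) : 0 ≤ window w r :=
  Set.indicator_nonneg (fun _ _ => zero_le_one) _

/-- The constant in the representation of `|r-s|^{2H-2}` by windows. -/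
def windowConst (H : ℝ) : ℝ := 1 / (2 - 2 * H) - 1 / (3 - 2 * H)

lemma windowConst_pos (hH' : H < 1) : 0 < windowConst H := by
  rw [windowConst, sub_pos]
  exact one_div_lt_one_div_of_lt (by linarith) (by linarith)

lemma mul_rpow_self {x : ℝ} (hx : 0 < x) (a : ℝ) : x * x ^ a = x ^ (a + 1) := by
  rw [Real.rpow_add_one hx.ne', mul_comm]

/-- The superposition of the functions `u ↦ (ε - u)⁺`, the measure of the set of windows of length
`ε` that contain two given points at distance `u`. -/
lemma lintegral_window_length (hH' : H < 1) {u : ℝ} (hu : 0 < u) :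
    ∫⁻ ε in Set.Ioi 0, ENNReal.ofReal (ε ^ (2 * H - 4)) * ENNReal.ofReal (ε - u)
      = ENNReal.ofReal (windowConst H * u ^ (2 * H - 2)) := by
  have h3 := integrableOn_Ioi_rpow_of_lt (a := 2 * H - 3) (by linarith) hu
  have h4 := integrableOn_Ioi_rpow_of_lt (a := 2 * H - 4) (by linarith) hu
  have hval : ∫ ε in Set.Ioi u, (ε ^ (2 * H - 3) - u * ε ^ (2 * H - 4))
      = windowConst H * u ^ (2 * H - 2) := by
    rw [integral_sub h3 (h4.const_mul u), integral_const_mul,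
      integral_Ioi_rpow_of_lt (by linarith) hu, integral_Ioi_rpow_of_lt (by linarith) hu]
    have e1 : u * (-u ^ (2 * H - 4 + 1) / (2 * H - 4 + 1))
        = -(u ^ (2 * H - 2)) / (2 * H - 4 + 1) := by
      have : u ^ (2 * H - 2) = u * u ^ (2 * H - 4 + 1) := by
        rw [mul_rpow_self hu]
        congr 1
        ring
      rw [this]
      ring
    rw [e1, windowConst, show 2 * H - 3 + 1 = 2 * H - 2 by ring,
      show 2 * H - 4 + 1 = -(3 - 2 * H) by ring]
    generalize u ^ (2 * H - 2) = y
    rw [show 2 * H - 2 = -(2 - 2 * H) by ring]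
    have h7 : 2 - 2 * H ≠ 0 := by linarith
    have h8 : 3 - 2 * H ≠ 0 := by linarith
    field_simp
  have hnn : ∀ ε ∈ Set.Ioi u, 0 ≤ ε ^ (2 * H - 3) - u * ε ^ (2 * H - 4) := by
    intro ε hε
    have hε0 : 0 < ε := hu.trans hε
    have : ε ^ (2 * H - 3) = ε * ε ^ (2 * H - 4) := by
      rw [mul_rpow_self hε0]
      congr 1
      ring
    rw [this, ← sub_mul]
    exact mul_nonneg (sub_nonneg.2 (le_of_lt hε)) (by positivity)
  have hsub : IntegrableOn (fun ε => ε ^ (2 * H - 3) - u * ε ^ (2 * H - 4)) (Set.Ioi u) :=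
    h3.sub (h4.const_mul u)
  rw [← hval, ofReal_integral_eq_lintegral_ofReal hsub
    ((ae_restrict_iff' measurableSet_Ioi).2 (ae_of_all _ hnn)),
    ← lintegral_indicator measurableSet_Ioi, ← lintegral_indicator measurableSet_Ioi]
  refine lintegral_congr fun ε => ?_
  by_cases hε : u < ε
  · have hε0 : 0 < ε := hu.trans hε
    rw [Set.indicator_of_mem (show ε ∈ Set.Ioi 0 from hε0),
      Set.indicator_of_mem (show ε ∈ Set.Ioi u from hε), ← ENNReal.ofReal_mul (by positivity)]
    congr 1
    have : ε ^ (2 * H - 3) = ε * ε ^ (2 * H - 4) := by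
      rw [mul_rpow_self hε0]
      congr 1
      ring
    rw [this]
    ring
  · rw [Set.indicator_of_notMem (show ε ∉ Set.Ioi u from hε)]
    refine Set.indicator_apply_eq_zero.2 fun _ => ?_
    rw [ENNReal.ofReal_of_nonpos (p := ε - u) (by linarith [not_lt.1 hε]), mul_zero]

/-- Away from the diagonal, `|r-s|^{2H-2}` is a superposition of products of indicator functions of
intervals. Hence the quadratic form with kernel `|r-s|^{2H-2}` is nonnegative. -/
lemma lintegral_window (hH' : H < 1) {r s : ℝ} (hrs : r ≠ s) :
    ∫⁻ w, ENNReal.ofReal (window w r * window w s) ∂(windowMeasure H)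
      = ENNReal.ofReal (windowConst H * |r - s| ^ (2 * H - 2)) := by
  have hu : 0 < |r - s| := abs_pos.2 (sub_ne_zero.2 hrs)
  rw [windowMeasure, lintegral_withDensity_eq_lintegral_mul _ (by fun_prop) (by fun_prop),
    lintegral_prod_symm _ (by fun_prop), ← lintegral_window_length hH' hu]
  refine setLIntegral_congr_fun measurableSet_Ioi fun ε hε => ?_
  simp only [Pi.mul_apply]
  rw [lintegral_const_mul _ (by fun_prop)]
  congr 1
  -- The windows of length `ε` containing `r` and `s` start in an interval of length `ε - |r - s|`.
  have h1 : ∀ v, ENNReal.ofReal (window (v, ε) r * window (v, ε) s)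
      = (Set.Ioo (max r s - ε) (min r s)).indicator (fun _ => 1) v := by
    intro v
    simp only [window]
    by_cases h : v ∈ Set.Ioo (max r s - ε) (min r s)
    · have hlt := h.1
      have hgt := h.2
      rw [sub_lt_iff_lt_add, max_lt_iff] at hlt
      rw [lt_min_iff] at hgt
      rw [Set.indicator_of_mem h, Set.indicator_of_mem (show r ∈ Set.Ioo v (v + ε) from
        ⟨hgt.1, hlt.1⟩), Set.indicator_of_mem (show s ∈ Set.Ioo v (v + ε) from ⟨hgt.2, hlt.2⟩)]
      simp
    · rw [Set.indicator_of_notMem h]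
      by_cases hr : r ∈ Set.Ioo v (v + ε)
      · have hs : s ∉ Set.Ioo v (v + ε) := fun hs =>
          h ⟨by rw [sub_lt_iff_lt_add]; exact max_lt hr.2 hs.2, lt_min hr.1 hs.1⟩
        rw [Set.indicator_of_notMem hs]
        simp
      · rw [Set.indicator_of_notMem hr]
        simp
  simp_rw [h1]
  rw [lintegral_indicator measurableSet_Ioo, setLIntegral_one, Real.volume_Ioo]
  congr 1
  have := max_sub_min_eq_abs r s
  rw [abs_sub_comm] at this
  linarith

/-- The sesquilinear form `∫∫ |r-s|^{2H-2} u(r) conj (u(s)) dr ds`. -/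
def timeForm (H : ℝ) (u : ℝ → ℂ) : ℂ :=
  ∫ z, ((|z.1 - z.2| ^ (2 * H - 2) : ℝ) : ℂ) * u z.1 * (starRingEnd ℂ) (u z.2)
    ∂(timeMeasure.prod timeMeasure)

lemma ae_ne_diagonal : ∀ᵐ z ∂(timeMeasure.prod timeMeasure), z.1 ≠ z.2 := by
  refine (Measure.ae_prod_iff_ae_ae (p := fun z : ℝ × ℝ => z.1 ≠ z.2)
    (measurableSet_eq_fun measurable_fst measurable_snd).compl).2 ?_
  refine ae_of_all _ fun r => ?_
  have : ∀ᵐ s ∂timeMeasure, s ≠ r := by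
    refine ae_restrict_of_ae ?_
    simp [ae_iff]
  filter_upwards [this] with s hs using hs.symm

/-- The temporal form as a superposition of squares. -/
lemma windowConst_mul_timeForm (hH' : H < 1) {u : ℝ → ℂ}
    (hu : AEStronglyMeasurable u timeMeasure)
    (hint : Integrable (fun z : ℝ × ℝ => ((|z.1 - z.2| ^ (2 * H - 2) : ℝ) : ℂ) * u z.1
      * (starRingEnd ℂ) (u z.2)) (timeMeasure.prod timeMeasure)) :
    Integrable (fun w => ‖∫ r, (window w r : ℂ) * u r ∂timeMeasure‖ ^ 2) (windowMeasure H) ∧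
    (windowConst H : ℂ) * timeForm H u
      = ((∫ w, ‖∫ r, (window w r : ℂ) * u r ∂timeMeasure‖ ^ 2 ∂(windowMeasure H) : ℝ) : ℂ) := by
  set G : (ℝ × ℝ) × (ℝ × ℝ) → ℂ := fun p =>
    ((window p.2 p.1.1 * window p.2 p.1.2 : ℝ) : ℂ) * (u p.1.1 * (starRingEnd ℂ) (u p.1.2)) with hG
  have hm : AEStronglyMeasurable G
      ((timeMeasure.prod timeMeasure).prod (windowMeasure H)) := by
    refine AEStronglyMeasurable.mul (Measurable.aestronglyMeasurable
      (Complex.measurable_ofReal.comp (by fun_prop))) ?_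
    exact (hu.comp_fst.mul (Complex.continuous_conj.comp_aestronglyMeasurable hu.comp_snd)).comp_fst
  have hwin : ∀ z : ℝ × ℝ, z.1 ≠ z.2 →
      ∫ w, window w z.1 * window w z.2 ∂(windowMeasure H)
        = windowConst H * |z.1 - z.2| ^ (2 * H - 2) := by
    intro z hz
    rw [integral_eq_lintegral_of_nonneg_ae
      (ae_of_all _ fun w => mul_nonneg (window_nonneg _ _) (window_nonneg _ _))
      (Measurable.aestronglyMeasurable (by fun_prop)), lintegral_window hH' hz,
      ENNReal.toReal_ofReal (mul_nonneg (windowConst_pos hH').le (by positivity))]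
  have hGint : Integrable G ((timeMeasure.prod timeMeasure).prod (windowMeasure H)) := by
    refine ⟨hm, ?_⟩
    rw [HasFiniteIntegral, lintegral_prod _ hm.enorm]
    refine lt_of_le_of_lt (le_of_eq ?_) (hint.const_mul (windowConst H : ℂ)).2
    refine lintegral_congr_ae ?_
    filter_upwards [ae_ne_diagonal] with z hz
    simp only [hG, enorm_mul _ (u z.1 * _)]
    have h1 : ∀ w, ‖((window w z.1 * window w z.2 : ℝ) : ℂ)‖ₑ
        = ENNReal.ofReal (window w z.1 * window w z.2) := fun w => by
      rw [← ofReal_norm, Complex.norm_real, Real.norm_of_nonneg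
        (mul_nonneg (window_nonneg _ _) (window_nonneg _ _))]
    simp_rw [h1]
    rw [lintegral_mul_const _ (by fun_prop), lintegral_window hH' hz, mul_assoc, ← mul_assoc,
      enorm_mul _ (u z.1 * _),
      ← Complex.ofReal_mul, ← ofReal_norm ((windowConst H * _ : ℝ) : ℂ), Complex.norm_real,
      Real.norm_of_nonneg (mul_nonneg (windowConst_pos hH').le (by positivity))]
  have hsq : ∀ w, ∫ z, G (z, w) ∂(timeMeasure.prod timeMeasure)
      = ((‖∫ r, (window w r : ℂ) * u r ∂timeMeasure‖ ^ 2 : ℝ) : ℂ) := by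
    intro w
    have h1 : ∀ z : ℝ × ℝ, G (z, w) = ((window w z.1 : ℂ) * u z.1)
        * (starRingEnd ℂ) ((window w z.2 : ℂ) * u z.2) := fun z => by
      simp only [hG, map_mul, Complex.conj_ofReal]
      push_cast
      ring
    simp_rw [h1]
    rw [integral_prod_mul (fun r => (window w r : ℂ) * u r)
      (fun s => (starRingEnd ℂ) ((window w s : ℂ) * u s)), integral_conj, Complex.mul_conj,
      Complex.normSq_eq_norm_sq]
  constructor
  · have h1 := hGint.integral_prod_right
    simp_rw [hsq] at h1
    exact h1.re
  · rw [← integral_complex_ofReal]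
    simp_rw [← hsq]
    rw [← integral_prod_symm _ hGint, integral_prod _ hGint, timeForm, ← integral_const_mul]
    refine integral_congr_ae ?_
    filter_upwards [ae_ne_diagonal] with z hz
    simp only [hG]
    rw [integral_mul_const, integral_complex_ofReal, hwin z hz]
    push_cast
    ring

lemma timeForm_nonneg (hH' : H < 1) {u : ℝ → ℂ} (hu : AEStronglyMeasurable u timeMeasure)
    (hint : Integrable (fun z : ℝ × ℝ => ((|z.1 - z.2| ^ (2 * H - 2) : ℝ) : ℂ) * u z.1
      * (starRingEnd ℂ) (u z.2)) (timeMeasure.prod timeMeasure)) :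
    0 ≤ (timeForm H u).re := by
  have h := congrArg Complex.re (windowConst_mul_timeForm hH' hu hint).2
  rw [Complex.re_ofReal_mul, Complex.ofReal_re] at h
  have h2 : 0 ≤ ∫ w, ‖∫ r, (window w r : ℂ) * u r ∂timeMeasure‖ ^ 2 ∂(windowMeasure H) :=
    integral_nonneg fun w => by positivity
  rw [← h] at h2
  exact nonneg_of_mul_nonneg_right h2 (windowConst_pos hH')

/-! ### The function `N_t` -/

/-- The function `r ↦ 1_{[0,t]}(r) exp (-r ψ)`. -/
def truncExp (t : ℝ) (ψ : ℂ) (r : ℝ) : ℂ := (timeIndicator t r : ℂ) * Complex.exp (-((r : ℂ) * ψ))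

@[fun_prop]
lemma measurable_truncExp {α : Type*} [MeasurableSpace α] (t : ℝ) {g : α → ℂ} {h : α → ℝ}
    (hg : Measurable g) (hh : Measurable h) : Measurable fun a => truncExp t (g a) (h a) := by
  unfold truncExp
  refine Measurable.mul (Complex.measurable_ofReal.comp (by fun_prop)) ?_
  exact Complex.measurable_exp.comp (((Complex.measurable_ofReal.comp hh).mul hg).neg)

lemma norm_exp_neg_mul_le {r : ℝ} (hr : 0 ≤ r) {ψ : ℂ} (hψ : 0 ≤ ψ.re) :
    ‖Complex.exp (-((r : ℂ) * ψ))‖ ≤ 1 := by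
  rw [Complex.norm_exp, Complex.neg_re, Complex.re_ofReal_mul]
  exact Real.exp_le_one_iff.2 (neg_nonpos.2 (mul_nonneg hr hψ))

lemma timeIndicator_of_mem {t r : ℝ} (hr : r ∈ Set.Icc 0 t) : timeIndicator t r = 1 :=
  Set.indicator_of_mem hr _

lemma timeIndicator_of_notMem {t r : ℝ} (hr : r ∉ Set.Icc 0 t) : timeIndicator t r = 0 :=
  Set.indicator_of_notMem hr _

/-- The form of a function supported in `[0,t]` that is bounded by one converges. -/
lemma integrable_timeForm (hH : 1 / 2 < H) (hH' : H < 1) {t : ℝ} {g : ℝ → ℂ}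
    (hg : Measurable g) (hg1 : ∀ r ∈ Set.Icc 0 t, ‖g r‖ ≤ 1) :
    Integrable (fun z : ℝ × ℝ => ((|z.1 - z.2| ^ (2 * H - 2) : ℝ) : ℂ)
      * ((timeIndicator t z.1 : ℂ) * g z.1)
      * (starRingEnd ℂ) ((timeIndicator t z.2 : ℂ) * g z.2)) (timeMeasure.prod timeMeasure) := by
  refine (integrable_timeKernel hH hH' t t).mono' ?_ (ae_of_all _ fun z => ?_)
  · have hti : Measurable fun r => (timeIndicator t r : ℂ) * g r :=
      (Complex.measurable_ofReal.comp (measurable_timeIndicator t)).mul hg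
    refine Measurable.aestronglyMeasurable (((Complex.measurable_ofReal.comp (by fun_prop)).mul
      (hti.comp measurable_fst)).mul (Complex.continuous_conj.measurable.comp
        (hti.comp measurable_snd)))
  · have h1 : ∀ r, ‖(timeIndicator t r : ℂ) * g r‖ ≤ timeIndicator t r := by
      intro r
      rw [norm_mul, Complex.norm_real, Real.norm_of_nonneg (timeIndicator_nonneg _ _)]
      by_cases hr : r ∈ Set.Icc 0 t
      · exact mul_le_of_le_one_right (timeIndicator_nonneg _ _) (hg1 r hr)
      · rw [timeIndicator_of_notMem hr, zero_mul]
    rw [norm_mul, norm_mul, RCLike.norm_conj, Complex.norm_real, Real.norm_of_nonneg (by positivity),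
      timeKernel]
    calc _ ≤ |z.1 - z.2| ^ (2 * H - 2) * timeIndicator t z.1 * timeIndicator t z.2 := by
          have := timeIndicator_nonneg t z.1
          gcongr
          · exact h1 _
          · exact h1 _
      _ = _ := by ring

/-- On functions supported in `[0,t]` the form is an iterated interval integral. -/
lemma timeForm_eq_intervalIntegral (hH : 1 / 2 < H) (hH' : H < 1) {t : ℝ} (ht : 0 ≤ t) {g : ℝ → ℂ}
    (hg : Measurable g) (hg1 : ∀ r ∈ Set.Icc 0 t, ‖g r‖ ≤ 1) :
    timeForm H (fun r => (timeIndicator t r : ℂ) * g r)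
      = ∫ r in (0 : ℝ)..t, ∫ s in (0 : ℝ)..t,
          g r * (starRingEnd ℂ) (g s) * ((|r - s| ^ (2 * H - 2) : ℝ) : ℂ) := by
  have hind : ∀ h : ℝ → ℂ, ∫ r, (timeIndicator t r : ℂ) * h r ∂timeMeasure
      = ∫ r in (0 : ℝ)..t, h r := by
    intro h
    rw [intervalIntegral.integral_of_le ht, ← integral_Icc_eq_integral_Ioc,
      ← integral_indicator measurableSet_Icc, ← integral_indicator measurableSet_Ici]
    refine integral_congr_ae (ae_of_all _ fun r => ?_)
    by_cases hr : r ∈ Set.Icc 0 t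
    · rw [Set.indicator_of_mem hr, Set.indicator_of_mem (show r ∈ Set.Ici 0 from hr.1),
        timeIndicator_of_mem hr, Complex.ofReal_one, one_mul]
    · rw [Set.indicator_of_notMem hr, Set.indicator_apply_eq_zero]
      intro _
      rw [timeIndicator_of_notMem hr, Complex.ofReal_zero, zero_mul]
  rw [timeForm, integral_prod _ (integrable_timeForm hH hH' hg hg1), ← hind]
  refine integral_congr_ae (ae_of_all _ fun r => ?_)
  simp only
  rw [← hind, ← integral_const_mul]
  refine integral_congr_ae (ae_of_all _ fun s => ?_)
  simp only [map_mul, Complex.conj_ofReal]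
  ring

lemma measurable_exp_neg_mul (ψ : ℂ) : Measurable fun r : ℝ => Complex.exp (-((r : ℂ) * ψ)) := by
  fun_prop

/-- `N_t` is the real part of the temporal form, which is real. -/
lemma N_eq (hH : 1 / 2 < H) (hH' : H < 1) {t : ℝ} (ht : 0 ≤ t) {Ψ : Space d → ℂ} {ξ : Space d}
    (hψ : 0 ≤ (Ψ ξ).re) :
    N H Ψ t ξ = H * (2 * H - 1) * (timeForm H (truncExp t (Ψ ξ))).re := by
  have h := timeForm_eq_intervalIntegral hH hH' ht (measurable_exp_neg_mul (Ψ ξ))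
    (fun r hr => norm_exp_neg_mul_le hr.1 hψ)
  have h2 : timeForm H (truncExp t (Ψ ξ)) = ∫ r in (0 : ℝ)..t, ∫ s in (0 : ℝ)..t,
      Complex.exp (-((r : ℂ) * Ψ ξ)) * Complex.exp (-((s : ℂ) * (starRingEnd ℂ) (Ψ ξ)))
      * ((|r - s| ^ (2 * H - 2) : ℝ) : ℂ) := by
    refine h.trans ?_
    simp only [← Complex.exp_conj, map_neg, map_mul, Complex.conj_ofReal]
  rw [N, ← h2, Complex.re_ofReal_mul]

/-- Time reversal in the temporal form: the integrand of the weak solution involves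
`exp (-(t-r) Ψ)`, whereas `N_t` is defined with `exp (-r Ψ)`. -/
lemma timeForm_reverse (hH : 1 / 2 < H) (hH' : H < 1) {t : ℝ} (ht : 0 ≤ t) {ψ : ℂ}
    (hψ : 0 ≤ ψ.re) :
    timeForm H (fun r => (timeIndicator t r : ℂ) * Complex.exp (-(((t - r : ℝ) : ℂ) * ψ)))
      = timeForm H (truncExp t ψ) := by
  have h1 := timeForm_eq_intervalIntegral hH hH' ht (measurable_exp_neg_mul ψ)
    (fun r hr => norm_exp_neg_mul_le hr.1 hψ)
  have h2 := timeForm_eq_intervalIntegral hH hH' ht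
    ((measurable_exp_neg_mul ψ).comp (measurable_const_sub t))
    (fun r hr => norm_exp_neg_mul_le (r := t - r) (sub_nonneg.2 hr.2) hψ)
  refine Eq.trans h2 (Eq.trans ?_ h1.symm)
  simp only [Function.comp_apply]
  have h3 : ∀ F : ℝ → ℂ, ∫ r in (0 : ℝ)..t, F (t - r) = ∫ r in (0 : ℝ)..t, F r := fun F => by
    rw [intervalIntegral.integral_comp_sub_left, sub_self, sub_zero]
  conv_rhs => rw [← h3]
  refine intervalIntegral.integral_congr fun r _ => ?_
  conv_rhs => rw [← h3]
  refine intervalIntegral.integral_congr fun s _ => ?_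
  rw [show t - r - (t - s) = s - r by ring, abs_sub_comm s r]

lemma measurable_N (hH : 1 / 2 < H) (hH' : H < 1) {t : ℝ} (ht : 0 ≤ t) {Ψ : Space d → ℂ}
    (hψ : ∀ ξ, 0 ≤ (Ψ ξ).re) (hΨm : Measurable Ψ) : Measurable (N H Ψ t) := by
  have h : N H Ψ t = fun ξ => H * (2 * H - 1) * (timeForm H (truncExp t (Ψ ξ))).re :=
    funext fun ξ => N_eq hH hH' ht (hψ ξ)
  rw [h]
  have h3 : Measurable fun p : Space d × (ℝ × ℝ) => |p.2.1 - p.2.2| ^ (2 * H - 2) := by fun_prop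
  have h4 : Measurable fun p : Space d × (ℝ × ℝ) => truncExp t (Ψ p.1) p.2.1 :=
    measurable_truncExp t (by fun_prop) (by fun_prop)
  have h5 : Measurable fun p : Space d × (ℝ × ℝ) => truncExp t (Ψ p.1) p.2.2 :=
    measurable_truncExp t (by fun_prop) (by fun_prop)
  have h6 : StronglyMeasurable fun p : Space d × (ℝ × ℝ) =>
      ((|p.2.1 - p.2.2| ^ (2 * H - 2) : ℝ) : ℂ)
        * truncExp t (Ψ p.1) p.2.1 * (starRingEnd ℂ) (truncExp t (Ψ p.1) p.2.2) :=
    (((Complex.measurable_ofReal.comp h3).mul h4).mul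
      (Complex.continuous_conj.measurable.comp h5)).stronglyMeasurable
  have h2 : StronglyMeasurable fun ξ => timeForm H (truncExp t (Ψ ξ)) :=
    h6.integral_prod_right' (ν := timeMeasure.prod timeMeasure)
  exact measurable_const.mul (Complex.measurable_re.comp h2.measurable)

lemma N_nonneg (hH : 1 / 2 < H) (hH' : H < 1) {t : ℝ} (ht : 0 ≤ t) {Ψ : Space d → ℂ} {ξ : Space d}
    (hψ : 0 ≤ (Ψ ξ).re) : 0 ≤ N H Ψ t ξ := by
  rw [N_eq hH hH' ht hψ]
  refine mul_nonneg (mul_nonneg (by linarith) (by linarith)) (timeForm_nonneg hH' ?_ ?_)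
  · exact Measurable.aestronglyMeasurable (by fun_prop)
  · have h := integrable_timeForm hH hH' (t := t) (measurable_exp_neg_mul (Ψ ξ))
      (fun r hr => norm_exp_neg_mul_le hr.1 hψ)
    simp only [truncExp]
    exact h

/-! ### Two-sided bounds for `N_t` -/

lemma lintegral_abs_rpow_mul_exp (hH : 1 / 2 < H) {b : ℝ} (hb : 0 < b) :
    ∫⁻ u : ℝ, ENNReal.ofReal (|u| ^ (2 * H - 2) * Real.exp (-(b * |u|)))
      = ENNReal.ofReal (2 * ((1 / b) ^ (2 * H - 1) * Real.Gamma (2 * H - 1))) := by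
  have h1 : ∫ u : ℝ, |u| ^ (2 * H - 2) * Real.exp (-(b * |u|))
      = 2 * ((1 / b) ^ (2 * H - 1) * Real.Gamma (2 * H - 1)) := by
    rw [integral_comp_abs (f := fun u => u ^ (2 * H - 2) * Real.exp (-(b * u))),
      ← Real.integral_rpow_mul_exp_neg_mul_Ioi (by linarith) hb,
      show 2 * H - 1 - 1 = 2 * H - 2 by ring]
  have hpos : 0 < 2 * ((1 / b) ^ (2 * H - 1) * Real.Gamma (2 * H - 1)) := by
    have := Real.Gamma_pos_of_pos (s := 2 * H - 1) (by linarith)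
    positivity
  -- A nonzero value of the Bochner integral forces integrability.
  have hint : Integrable fun u : ℝ => |u| ^ (2 * H - 2) * Real.exp (-(b * |u|)) := by
    by_contra hn
    rw [integral_undef hn] at h1
    exact hpos.ne h1
  rw [← h1, ofReal_integral_eq_lintegral_ofReal hint (ae_of_all _ fun u => by positivity)]

/-- The double integral of `|r-s|^{2H-2} exp (-(r+s) b)` scales as `b^{-2H}`; it is bounded by a product
of one-dimensional integrals in the variables `r` and `r - s`. -/
lemma lintegral_exp_kernel_le (hH : 1 / 2 < H) {b : ℝ} (hb : 0 < b) :
    ∫⁻ z, ENNReal.ofReal (|z.1 - z.2| ^ (2 * H - 2) * Real.exp (-((z.1 + z.2) * b)))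
        ∂(timeMeasure.prod timeMeasure)
      ≤ ENNReal.ofReal (2 * Real.Gamma (2 * H - 1) * 2 ^ (2 * H) * (1 / b) ^ (2 * H)) := by
  set g : ℝ → ℝ≥0∞ := fun u =>
    ENNReal.ofReal (|u| ^ (2 * H - 2) * Real.exp (-(b / 2 * |u|))) with hg
  have hgm : Measurable g := by fun_prop
  rw [lintegral_prod _ (by fun_prop)]
  have hexp : ∫⁻ r in Set.Ici 0, ENNReal.ofReal (Real.exp (-(b / 2) * r))
      = ENNReal.ofReal (2 / b) := by
    have hi := integrableOn_exp_mul_Ioi (a := -(b / 2)) (by linarith) 0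
    rw [← restrict_Ioi_eq_restrict_Ici,
      ← ofReal_integral_eq_lintegral_ofReal hi (ae_of_all _ fun r => (Real.exp_pos _).le),
      integral_exp_mul_Ioi (by linarith)]
    congr 1
    simp
  calc ∫⁻ r in Set.Ici 0, ∫⁻ s in Set.Ici 0,
        ENNReal.ofReal (|r - s| ^ (2 * H - 2) * Real.exp (-((r + s) * b)))
      ≤ ∫⁻ r in Set.Ici 0, ENNReal.ofReal (Real.exp (-(b / 2) * r)) * ∫⁻ u, g u := by
        refine setLIntegral_mono (by fun_prop) fun r hr => ?_
        calc ∫⁻ s in Set.Ici 0,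
              ENNReal.ofReal (|r - s| ^ (2 * H - 2) * Real.exp (-((r + s) * b)))
            ≤ ∫⁻ s in Set.Ici 0, ENNReal.ofReal (Real.exp (-(b / 2) * r)) * g (r - s) := by
              refine setLIntegral_mono (by fun_prop) fun s hs => ?_
              rw [hg, ← ENNReal.ofReal_mul (Real.exp_pos _).le]
              refine ENNReal.ofReal_le_ofReal ?_
              rw [mul_left_comm, ← Real.exp_add]
              refine mul_le_mul_of_nonneg_left (Real.exp_le_exp.2 ?_) (by positivity)
              -- Both `r` and `|r - s|` are at most `r + s`.
              have h1 : |r - s| ≤ r + s := abs_le.2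
                ⟨by linarith [Set.mem_Ici.1 hr], by linarith [Set.mem_Ici.1 hs]⟩
              have h2 : 0 ≤ s := hs
              nlinarith
          _ ≤ ∫⁻ s, ENNReal.ofReal (Real.exp (-(b / 2) * r)) * g (r - s) :=
              setLIntegral_le_lintegral _ _
          _ = ENNReal.ofReal (Real.exp (-(b / 2) * r)) * ∫⁻ u, g u := by
              rw [lintegral_const_mul _ (by fun_prop), lintegral_sub_left_eq_self g r]
    _ = ENNReal.ofReal (2 / b) * ∫⁻ u, g u := by
        rw [lintegral_mul_const _ (by fun_prop), hexp]
    _ = _ := by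
        rw [hg, lintegral_abs_rpow_mul_exp hH (half_pos hb), ← ENNReal.ofReal_mul (by positivity)]
        congr 1
        have h1 : 2 / b * (2 / b) ^ (2 * H - 1) = 2 ^ (2 * H) * (1 / b) ^ (2 * H) := by
          rw [mul_rpow_self (by positivity), ← Real.mul_rpow (by positivity) (by positivity)]
          congr 1
          · ring
          · ring
        rw [show (1 / (b / 2)) = 2 / b by field_simp]
        linear_combination (2 * Real.Gamma (2 * H - 1)) * h1

/-- `N_t(ξ)` is at most a constant times `(1 + Re Ψ(ξ))^{-2H}`. -/
lemma exists_N_le (hH : 1 / 2 < H) (hH' : H < 1) {t : ℝ} (ht : 0 ≤ t) :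
    ∃ C : ℝ, 0 ≤ C ∧ ∀ (Ψ : Space d → ℂ) (ξ : Space d), 0 ≤ (Ψ ξ).re →
      N H Ψ t ξ ≤ C * (1 / (1 + (Ψ ξ).re)) ^ (2 * H) := by
  have hG := Real.Gamma_pos_of_pos (s := 2 * H - 1) (by linarith)
  have hα : 0 ≤ H * (2 * H - 1) := mul_nonneg (by linarith) (by linarith)
  -- The factor `exp (2t)` pays for the replacement of `Re Ψ` by `1 + Re Ψ` in the exponent.
  refine ⟨H * (2 * H - 1) * (Real.exp (2 * t) * (2 * Real.Gamma (2 * H - 1) * 2 ^ (2 * H))),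
    by positivity, fun Ψ ξ hψ => ?_⟩
  set b := 1 + (Ψ ξ).re with hb
  have hb0 : 0 < b := by positivity
  rw [N_eq hH hH' ht hψ, mul_assoc _ (Real.exp (2 * t) * _)]
  refine mul_le_mul_of_nonneg_left ((Complex.re_le_norm _).trans ?_) hα
  refine (norm_integral_le_lintegral_norm _).trans ?_
  have hle : ∫⁻ z, ENNReal.ofReal ‖((|z.1 - z.2| ^ (2 * H - 2) : ℝ) : ℂ) * truncExp t (Ψ ξ) z.1
      * (starRingEnd ℂ) (truncExp t (Ψ ξ) z.2)‖ ∂(timeMeasure.prod timeMeasure)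
      ≤ ENNReal.ofReal (Real.exp (2 * t)) *
        ENNReal.ofReal (2 * Real.Gamma (2 * H - 1) * 2 ^ (2 * H) * (1 / b) ^ (2 * H)) := by
    refine le_trans ?_ (mul_le_mul_right (lintegral_exp_kernel_le hH hb0) _)
    rw [← lintegral_const_mul _ (by fun_prop)]
    refine lintegral_mono fun z => ?_
    rw [← ENNReal.ofReal_mul (Real.exp_pos _).le]
    refine ENNReal.ofReal_le_ofReal ?_
    by_cases hz : z.1 ∈ Set.Icc 0 t ∧ z.2 ∈ Set.Icc 0 t
    · rw [norm_mul, norm_mul, RCLike.norm_conj, Complex.norm_real,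
        Real.norm_of_nonneg (by positivity), truncExp, truncExp, timeIndicator_of_mem hz.1,
        timeIndicator_of_mem hz.2, Complex.ofReal_one, one_mul, one_mul, Complex.norm_exp,
        Complex.norm_exp, mul_left_comm, mul_assoc, ← Real.exp_add, ← Real.exp_add]
      refine mul_le_mul_of_nonneg_left (Real.exp_le_exp.2 ?_) (by positivity)
      simp only [Complex.neg_re, Complex.re_ofReal_mul, hb]
      have h1 := hz.1.2
      have h2 := hz.2.2
      linarith
    · have h0 : truncExp t (Ψ ξ) z.1 * (starRingEnd ℂ) (truncExp t (Ψ ξ) z.2) = 0 := by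
        rw [not_and_or] at hz
        rcases hz with h | h
        · simp [truncExp, timeIndicator_of_notMem h]
        · simp [truncExp, timeIndicator_of_notMem h]
      rw [mul_assoc, h0, mul_zero, norm_zero]
      positivity
  rw [← ENNReal.ofReal_mul (Real.exp_pos _).le] at hle
  refine (ENNReal.toReal_le_of_le_ofReal (by positivity) hle).trans (le_of_eq ?_)
  ring

/-- On a window `(v, v + ε)` inside `[0,t]` on which `r Re ψ` and `r |Im ψ|` are at most one, the
function `exp (-r ψ)` has real part at least `exp (-1) cos 1`. -/
lemma norm_integral_window_truncExp_ge {t : ℝ} {ψ : ℂ} {w : ℝ × ℝ} (hw1 : 0 ≤ w.1) (hw2 : 0 ≤ w.2)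
    (ht : w.1 + w.2 ≤ t) (ha : (w.1 + w.2) * ψ.re ≤ 1) (ha0 : 0 ≤ ψ.re)
    (hb : (w.1 + w.2) * |ψ.im| ≤ 1) :
    Real.exp (-1) * Real.cos 1 * w.2 ≤ ‖∫ r, (window w r : ℂ) * truncExp t ψ r ∂timeMeasure‖ := by
  refine le_trans ?_ (Complex.re_le_norm _)
  have hmem : ∀ r ∈ Set.Ioo w.1 (w.1 + w.2), r ∈ Set.Icc 0 t := fun r hr =>
    ⟨hw1.trans hr.1.le, hr.2.le.trans ht⟩
  have h1 : ∫ r, (window w r : ℂ) * truncExp t ψ r ∂timeMeasure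
      = ∫ r in Set.Ioo w.1 (w.1 + w.2), Complex.exp (-((r : ℂ) * ψ)) := by
    rw [← integral_indicator measurableSet_Ici, ← integral_indicator measurableSet_Ioo]
    refine integral_congr_ae (ae_of_all _ fun r => ?_)
    by_cases hr : r ∈ Set.Ioo w.1 (w.1 + w.2)
    · simp only [window, truncExp]
      rw [Set.indicator_of_mem hr, Set.indicator_of_mem (show r ∈ Set.Ici 0 from (hmem r hr).1),
        Set.indicator_of_mem hr, timeIndicator_of_mem (hmem r hr)]
      simp
    · simp only [window]
      rw [Set.indicator_of_notMem hr, Set.indicator_apply_eq_zero, Set.indicator_of_notMem hr]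
      intro _
      simp
  have hfin : IsFiniteMeasure (volume.restrict (Set.Ioo w.1 (w.1 + w.2))) :=
    ⟨by simp⟩
  have hint : Integrable (fun r : ℝ => Complex.exp (-((r : ℂ) * ψ)))
      (volume.restrict (Set.Ioo w.1 (w.1 + w.2))) := by
    refine Integrable.of_bound (C := 1) (measurable_exp_neg_mul ψ).aestronglyMeasurable ?_
    exact (ae_restrict_iff' measurableSet_Ioo).2 (ae_of_all _ fun r hr =>
      norm_exp_neg_mul_le (hmem r hr).1 ha0)
  have h2 : (∫ r in Set.Ioo w.1 (w.1 + w.2), Complex.exp (-((r : ℂ) * ψ))).re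
      = ∫ r in Set.Ioo w.1 (w.1 + w.2), (Complex.exp (-((r : ℂ) * ψ))).re := (integral_re hint).symm
  rw [h1, h2]
  have h3 : Real.exp (-1) * Real.cos 1 * w.2
      = ∫ _ in Set.Ioo w.1 (w.1 + w.2), Real.exp (-1) * Real.cos 1 := by
    rw [setIntegral_const, Measure.real, Real.volume_Ioo, add_sub_cancel_left,
      ENNReal.toReal_ofReal hw2, smul_eq_mul, mul_comm]
  rw [h3]
  refine setIntegral_mono_on (integrable_const _) hint.re measurableSet_Ioo fun r hr => ?_
  have hr0 : 0 ≤ r := (hmem r hr).1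
  rw [Complex.exp_re]
  simp only [Complex.neg_re, Complex.neg_im, Complex.re_ofReal_mul, Complex.im_ofReal_mul]
  refine mul_le_mul (Real.exp_le_exp.2 ?_) ?_ Real.cos_one_pos.le (Real.exp_pos _).le
  · have := mul_le_mul_of_nonneg_right hr.2.le ha0
    linarith
  · rw [← Real.cos_abs (-(r * ψ.im))]
    refine Real.cos_le_cos_of_nonneg_of_le_pi (abs_nonneg _) (by linarith [Real.pi_gt_three]) ?_
    rw [abs_neg, abs_mul, abs_of_nonneg hr0]
    exact (mul_le_mul_of_nonneg_right hr.2.le (abs_nonneg _)).trans hb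

/-- In the sector `|Im Ψ| ≤ K Re Ψ`, the function `N_t` is at least a constant times
`(1 + Re Ψ)^{-2H}`: of the representation of `N_t` as a superposition of squares, keep only the
windows contained in an interval of length comparable to `1 / (1 + Re Ψ)`. -/
lemma exists_le_N (hH : 1 / 2 < H) (hH' : H < 1) {t K : ℝ} (ht : 0 < t) (hK : 0 < K) :
    ∃ c : ℝ, 0 < c ∧ ∀ (Ψ : Space d → ℂ) (ξ : Space d), 0 ≤ (Ψ ξ).re →
      |(Ψ ξ).im| ≤ K * (Ψ ξ).re → c * (1 / (1 + (Ψ ξ).re)) ^ (2 * H) ≤ N H Ψ t ξ := by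
  -- With this `δ`, the windows inside `(0, 2δ/(1 + Re Ψ))` lie in `[0,t]`, and both `r Re Ψ` and
  -- `r |Im Ψ|` are at most one on them.
  set δ := min (t / 2) (min (1 / 2) (1 / (2 * K))) with hδ
  have hδ0 : 0 < δ := by positivity
  have hδt : δ ≤ t / 2 := min_le_left _ _
  have hδ1 : δ ≤ 1 / 2 := (min_le_right _ _).trans (min_le_left _ _)
  have hδK : δ ≤ 1 / (2 * K) := (min_le_right _ _).trans (min_le_right _ _)
  have hw := windowConst_pos hH'
  have hα : 0 < H * (2 * H - 1) := mul_pos (by linarith) (by linarith)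
  have hcos := Real.cos_one_pos
  set c₀ := Real.exp (-1) * Real.cos 1 with hc₀
  have hc0 : 0 < c₀ := by positivity
  have h2H : 0 < 2 * H - 1 := by linarith
  refine ⟨H * (2 * H - 1) * (c₀ ^ 2 * δ ^ (2 * H) / (2 * H - 1) / windowConst H), by positivity,
    fun Ψ ξ ha hK' => ?_⟩
  set a := (Ψ ξ).re with ha'
  set η := δ / (1 + a) with hη
  have h1a : 0 < 1 + a := by positivity
  have hη0 : 0 < η := by positivity
  have hηδ : η ≤ δ := div_le_self hδ0.le (by linarith)
  have hηa : η * a ≤ δ := by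
    rw [hη, div_mul_eq_mul_div, div_le_iff₀ h1a]
    nlinarith
  have hm : AEStronglyMeasurable (truncExp t (Ψ ξ)) timeMeasure :=
    Measurable.aestronglyMeasurable (by fun_prop)
  have hi := integrable_timeForm hH hH' (t := t) (measurable_exp_neg_mul (Ψ ξ))
      (fun r hr => norm_exp_neg_mul_le hr.1 ha)
  obtain ⟨hint, heq⟩ := windowConst_mul_timeForm hH' hm hi
  have heq' := congrArg Complex.re heq
  rw [Complex.re_ofReal_mul, Complex.ofReal_re] at heq'
  rw [N_eq hH hH' ht.le ha, mul_assoc (H * (2 * H - 1))]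
  refine mul_le_mul_of_nonneg_left ?_ hα.le
  have h1 : c₀ ^ 2 * δ ^ (2 * H) / (2 * H - 1) / windowConst H * (1 / (1 + a)) ^ (2 * H)
      = (c₀ ^ 2 * η ^ (2 * H) / (2 * H - 1)) / windowConst H := by
    rw [hη, div_eq_mul_one_div δ, Real.mul_rpow hδ0.le (by positivity)]
    ring
  rw [h1, div_le_iff₀ hw, mul_comm _ (windowConst H), heq']
  -- The set of windows `(v, ε)` with `0 < v < η` and `0 < ε < η`.
  set S : Set (ℝ × ℝ) := Set.Ioo 0 η ×ˢ Set.Ioo 0 η with hS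
  have hSm : MeasurableSet S := measurableSet_Ioo.prod measurableSet_Ioo
  have hlow : ∫⁻ w in S, ENNReal.ofReal (c₀ ^ 2 * w.2 ^ 2) ∂(windowMeasure H)
      = ENNReal.ofReal (c₀ ^ 2 * η ^ (2 * H) / (2 * H - 1)) := by
    have hint2 : IntegrableOn (fun ε : ℝ => c₀ ^ 2 * ε ^ (2 * H - 2)) (Set.Ioo 0 η) := by
      rw [← integrableOn_Ioc_iff_integrableOn_Ioo,
        ← intervalIntegrable_iff_integrableOn_Ioc_of_le hη0.le]
      exact (intervalIntegral.intervalIntegrable_rpow' (by linarith)).const_mul _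
    have hval : ∫⁻ ε in Set.Ioo 0 η, ENNReal.ofReal (c₀ ^ 2 * ε ^ (2 * H - 2))
        = ENNReal.ofReal (c₀ ^ 2 * (η ^ (2 * H - 1) / (2 * H - 1))) := by
      rw [← ofReal_integral_eq_lintegral_ofReal hint2
        ((ae_restrict_iff' measurableSet_Ioo).2 (ae_of_all _ fun ε hε => by
          have := hε.1
          simp only [Pi.zero_apply]
          positivity)), integral_const_mul, ← integral_Ioc_eq_integral_Ioo,
        ← intervalIntegral.integral_of_le hη0.le, integral_rpow (Or.inl (by linarith)),
        show 2 * H - 2 + 1 = 2 * H - 1 by ring, Real.zero_rpow h2H.ne', sub_zero]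
    rw [windowMeasure, setLIntegral_withDensity_eq_setLIntegral_mul _ (by fun_prop) (by fun_prop) hSm,
      hS, ← Measure.prod_restrict, lintegral_prod _ (by fun_prop),
      Measure.restrict_restrict measurableSet_Ioo,
      Set.inter_eq_left.2 (show Set.Ioo 0 η ⊆ Set.Ioi 0 from fun x hx => hx.1)]
    simp only [Pi.mul_apply]
    have hin : ∫⁻ ε in Set.Ioo 0 η, ENNReal.ofReal (ε ^ (2 * H - 4)) *
        ENNReal.ofReal (c₀ ^ 2 * ε ^ 2)
        = ENNReal.ofReal (c₀ ^ 2 * (η ^ (2 * H - 1) / (2 * H - 1))) := by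
      rw [← hval]
      refine setLIntegral_congr_fun measurableSet_Ioo fun ε hε => ?_
      have hε0 : 0 < ε := hε.1
      rw [← ENNReal.ofReal_mul (by positivity)]
      congr 1
      rw [show 2 * H - 2 = 2 * H - 4 + 2 by ring, Real.rpow_add hε0, Real.rpow_two]
      ring
    rw [hin, setLIntegral_const, Real.volume_Ioo, sub_zero, ← ENNReal.ofReal_mul (by positivity)]
    congr 1
    have := mul_rpow_self hη0 (2 * H - 1)
    rw [sub_add_cancel] at this
    rw [← this]
    ring
  have hnn : 0 ≤ᵐ[windowMeasure H] fun w =>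
      ‖∫ r, (window w r : ℂ) * truncExp t (Ψ ξ) r ∂timeMeasure‖ ^ 2 :=
    ae_of_all _ fun w => by simp only [Pi.zero_apply]; positivity
  rw [← ENNReal.ofReal_le_ofReal_iff (integral_nonneg_of_ae hnn)]
  refine le_trans ?_ (ofReal_integral_eq_lintegral_ofReal hint hnn).ge
  rw [← hlow]
  refine le_trans (setLIntegral_mono' hSm fun w hw => ?_) (setLIntegral_le_lintegral S _)
  refine ENNReal.ofReal_le_ofReal ?_
  rw [← mul_pow]
  have hw1 := hw.1.1
  have hw2 := hw.2.1
  have hw12 : w.1 + w.2 ≤ 2 * η := by linarith [hw.1.2, hw.2.2]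
  have hKδ : 2 * δ * K ≤ 1 := by
    rw [le_div_iff₀ (by positivity)] at hδK
    linarith
  refine pow_le_pow_left₀ (by positivity) ?_ 2
  refine norm_integral_window_truncExp_ge hw1.le hw2.le (by linarith) ?_ ha ?_
  · have := mul_le_mul_of_nonneg_right hw12 ha
    linarith
  · calc (w.1 + w.2) * |(Ψ ξ).im| ≤ 2 * η * (K * a) := by gcongr
      _ = 2 * (η * a) * K := by ring
      _ ≤ 2 * δ * K := by gcongr
      _ ≤ 1 := hKδ

/-! ### The Lévy process and the integrand of the weak solution -/

variable {Ω' : Type*} [MeasurableSpace Ω'] {P' : Measure Ω'}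
  {X : ℝ≥0 → Ω' → Space d} {Ψ : Space d → ℂ}

lemma measureFourier_map (hX : IsLevyProcess P' X) (hΨ : IsCharExponent P' X Ψ) (t : ℝ≥0)
    (ξ : Space d) :
    measureFourier (P'.map (X t)) ξ = Complex.exp (-(((t : ℝ) : ℂ) * Ψ ξ)) := by
  rw [measureFourier, integral_map (hX.aemeasurable t) (Continuous.aestronglyMeasurable
    (by fun_prop)), ← hΨ t ξ]
  rfl

lemma isProbabilityMeasure_map [IsProbabilityMeasure P'] (hX : IsLevyProcess P' X) (t : ℝ≥0) :
    IsProbabilityMeasure (P'.map (X t)) := Measure.isProbabilityMeasure_map (hX.aemeasurable t)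

lemma re_charExponent_nonneg [IsProbabilityMeasure P'] (hX : IsLevyProcess P' X)
    (hΨ : IsCharExponent P' X Ψ) (ξ : Space d) : 0 ≤ (Ψ ξ).re := by
  have := isProbabilityMeasure_map hX 1
  have h := norm_measureFourier_le (ν := P'.map (X 1)) prob_le_one ξ
  rw [measureFourier_map hX hΨ, Complex.norm_exp] at h
  simpa using Real.exp_le_one_iff.1 h

lemma measurable_charExponent [IsProbabilityMeasure P'] (hX : IsLevyProcess P' X)
    (hΨ : IsCharExponent P' X Ψ) : Measurable Ψ := by
  -- `Ψ` is minus the derivative at `0` of the characteristic functions `exp (-t Ψ)`.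
  set τ : ℕ → ℝ := fun n => 1 / ((n : ℝ) + 1) with hτ
  have hτpos : ∀ n, 0 < τ n := fun n => by positivity
  refine measurable_of_tendsto_metrizable
    (f := fun n ξ => -((τ n)⁻¹ • (measureFourier (P'.map (X (τ n).toNNReal)) ξ - 1))) (fun n => ?_)
    (tendsto_pi_nhds.2 fun ξ => ?_)
  · have := isProbabilityMeasure_map hX (τ n).toNNReal
    have hc := continuous_measureFourier (P'.map (X (τ n).toNNReal))
    have h1 : Continuous fun ξ =>
      -((τ n)⁻¹ • (measureFourier (P'.map (X (τ n).toNNReal)) ξ - 1)) := by fun_prop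
    exact h1.measurable
  · have hd : HasDerivAt (fun t : ℝ => Complex.exp (-((t : ℂ) * Ψ ξ))) (-Ψ ξ) 0 := by
      have h1 : HasDerivAt (fun t : ℝ => -((t : ℂ) * Ψ ξ)) (-(1 * Ψ ξ)) 0 :=
        ((hasDerivAt_id (0 : ℝ)).ofReal_comp.mul_const (Ψ ξ)).neg
      have h2 := h1.cexp
      simpa using h2
    have h3 : Tendsto τ atTop (𝓝[>] 0) := by
      refine tendsto_nhdsWithin_iff.2 ⟨tendsto_one_div_add_atTop_nhds_zero_nat, ?_⟩
      exact Eventually.of_forall hτpos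
    have h4 := (hd.tendsto_slope_zero_right.comp h3).neg
    rw [neg_neg] at h4
    refine h4.congr fun n => ?_
    rw [measureFourier_map hX hΨ, Real.coe_toNNReal _ (hτpos n).le]
    simp

/-- The absolutely continuous part of the law of `X_{t-s}`, which is the measure with density
`density P' X (t - s)`. For `s < t` it is the whole law; for `s = t` the law is the point mass at
`0` and need not have a density, which matters only on a null set of times. -/
def greenMeasure (P' : Measure Ω') (X : ℝ≥0 → Ω' → Space d) (t s : ℝ) : Measure (Space d) :=
  volume.withDensity ((P'.map (X (t - s).toNNReal)).rnDeriv volume)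

lemma greenMeasure_univ_le [IsProbabilityMeasure P'] (hX : IsLevyProcess P' X) (t s : ℝ) :
    greenMeasure P' X t s Set.univ ≤ 1 := by
  have := isProbabilityMeasure_map hX (t - s).toNNReal
  exact (Measure.withDensity_rnDeriv_le _ _ _).trans prob_le_one

lemma greenMeasure_eq [IsProbabilityMeasure P'] (hX : IsLevyProcess P' X)
    (hdens : ∀ t : ℝ≥0, 0 < t → (P'.map (X t)) ≪ volume) {t s : ℝ} (hs : s < t) :
    greenMeasure P' X t s = P'.map (X (t - s).toNNReal) := by
  have := isProbabilityMeasure_map hX (t - s).toNNReal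
  exact Measure.withDensity_rnDeriv_eq _ _ (hdens _ (by simpa using hs))

/-- The inner integral in the integrand of the weak solution is a convolution: the reflection in
`G(t,x) = p_t(-x)` turns `∫ G(t-s, x-y) φ(x) dx` into `∫ φ(y-z) p_{t-s}(z) dz`. -/
lemma weakIntegrand_eq [IsProbabilityMeasure P'] (hX : IsLevyProcess P' X) (t : ℝ)
    (φ : 𝓢(Space d, ℝ)) :
    weakIntegrand P' X t φ = atomFun t (greenMeasure P' X t) φ := by
  funext p
  have h : ∫ x, green P' X (t - p.1) (x - p.2) * φ x = smear (greenMeasure P' X t p.1) φ p.2 := by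
    have := isProbabilityMeasure_map hX (t - p.1).toNNReal
    rw [smear, greenMeasure, integral_withDensity_eq_integral_toReal_smul
      (Measure.measurable_rnDeriv _ _) (Measure.rnDeriv_lt_top _ _),
      ← integral_sub_left_eq_self _ volume p.2]
    refine integral_congr_ae (ae_of_all _ fun x => ?_)
    simp [green, density]
  rw [weakIntegrand, atomFun, ← h, timeIndicator]
  by_cases hp : p.1 ∈ Set.Icc 0 t
  · rw [Set.indicator_of_mem hp, Set.indicator_of_mem hp, one_mul]
  · rw [Set.indicator_of_notMem hp, Set.indicator_of_notMem hp, zero_mul]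

/-- Stochastic continuity of `X`, tested on translates of `φ`. It provides the joint measurability of
`(s,y) ↦ E φ(y - X_s)`. -/
lemma continuous_smear_map [IsProbabilityMeasure P'] (hX : IsLevyProcess P' X) (φ : 𝓢(Space d, ℝ))
    (y : Space d) : Continuous fun t => smear (P'.map (X t)) φ y := by
  refine continuous_iff_continuousAt.2 fun t => ?_
  have h := ((hX.continuous t).tendstoInDistribution hX.aemeasurable).tendsto
  have h2 := ProbabilityMeasure.tendsto_iff_forall_integral_tendsto.1 h
    (BoundedContinuousFunction.compContinuous φ.toBoundedContinuousFunction
      ⟨fun x => y - x, by fun_prop⟩)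
  exact h2

lemma ae_fst_ne {α : Type*} [MeasurableSpace α] (m : Measure α) [SFinite m] (t : ℝ) :
    ∀ᵐ p ∂(timeMeasure.prod m), p.1 ≠ t := by
  have h : ∀ᵐ s ∂timeMeasure, s ≠ t := by
    refine ae_restrict_of_ae ?_
    simp [ae_iff]
  exact Measure.quasiMeasurePreserving_fst.ae h

lemma aestronglyMeasurable_atomFun_green [IsProbabilityMeasure P'] (hX : IsLevyProcess P' X)
    (hdens : ∀ t : ℝ≥0, 0 < t → (P'.map (X t)) ≪ volume) (t : ℝ) (φ : 𝓢(Space d, ℝ)) :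
    AEStronglyMeasurable (atomFun t (greenMeasure P' X t) φ) (spaceTime d) := by
  have hm : Measurable (Function.uncurry fun (τ : ℝ≥0) (y : Space d) =>
      smear (P'.map (X τ)) φ y) := by
    refine measurable_uncurry_of_continuous_of_measurable (fun y => continuous_smear_map hX φ y)
      fun τ => ?_
    have := isProbabilityMeasure_map hX τ
    exact (continuous_smear prob_le_one φ).measurable
  have hm2 : Measurable fun p : ℝ × Space d =>
      timeIndicator t p.1 * smear (P'.map (X (t - p.1).toNNReal)) φ p.2 := by
    refine Measurable.mul (by fun_prop) ?_
    have h : Measurable fun p : ℝ × Space d => ((t - p.1).toNNReal, p.2) := by fun_prop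
    exact hm.comp h
  refine hm2.aestronglyMeasurable.congr ?_
  filter_upwards [ae_fst_ne (volume : Measure (Space d)) t] with p hp
  rw [atomFun]
  by_cases h : p.1 ∈ Set.Icc 0 t
  · rw [greenMeasure_eq hX hdens (lt_of_le_of_ne h.2 hp)]
  · rw [timeIndicator_of_notMem h, zero_mul, zero_mul]

lemma atomHat_green_eq [IsProbabilityMeasure P'] (hX : IsLevyProcess P' X)
    (hdens : ∀ t : ℝ≥0, 0 < t → (P'.map (X t)) ≪ volume) (hΨ : IsCharExponent P' X Ψ) {t : ℝ}
    (φ : 𝓢(Space d, ℝ)) {p : ℝ × Space d} (hp : p.1 ≠ t) :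
    atomHat t (greenMeasure P' X t) φ p = ((timeIndicator t p.1 : ℂ)
      * Complex.exp (-(((t - p.1 : ℝ) : ℂ) * Ψ p.2))) * schwartzFourier φ p.2 := by
  rw [atomHat]
  by_cases h : p.1 ∈ Set.Icc 0 t
  · rw [greenMeasure_eq hX hdens (lt_of_le_of_ne h.2 hp), measureFourier_map hX hΨ,
      Real.coe_toNNReal _ (sub_nonneg.2 h.2)]
    ring
  · rw [timeIndicator_of_notMem h]
    simp

lemma aestronglyMeasurable_atomHat_green [IsProbabilityMeasure P'] [SFinite μ]
    (hX : IsLevyProcess P' X)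
    (hdens : ∀ t : ℝ≥0, 0 < t → (P'.map (X t)) ≪ volume) (hΨ : IsCharExponent P' X Ψ) (t : ℝ)
    (φ : 𝓢(Space d, ℝ)) :
    AEStronglyMeasurable (atomHat t (greenMeasure P' X t) φ) (timeMeasure.prod μ) := by
  have hΨm := measurable_charExponent hX hΨ
  have hφ : Measurable (schwartzFourier φ) := (continuous_schwartzFourier φ).measurable
  have hm2 : Measurable fun p : ℝ × Space d => ((timeIndicator t p.1 : ℂ)
      * Complex.exp (-(((t - p.1 : ℝ) : ℂ) * Ψ p.2))) * schwartzFourier φ p.2 := by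
    have h1 : Measurable fun p : ℝ × Space d => timeIndicator t p.1 := by fun_prop
    have h2 : Measurable fun p : ℝ × Space d => t - p.1 := by fun_prop
    exact ((Complex.measurable_ofReal.comp h1).mul (Complex.measurable_exp.comp
      ((Complex.measurable_ofReal.comp h2).mul (hΨm.comp measurable_snd)).neg)).mul
      (hφ.comp measurable_snd)
  refine hm2.aestronglyMeasurable.congr ?_
  filter_upwards [ae_fst_ne μ t] with p hp
  exact (atomHat_green_eq hX hdens hΨ φ hp).symm

/-- The integrand of the weak solution with its spatial Fourier transform. -/
def weakPair (P' : Measure Ω') (X : ℝ≥0 → Ω' → Space d) (t : ℝ) (φ : 𝓢(Space d, ℝ)) :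
    (ℝ × Space d → ℝ) × (ℝ × Space d → ℂ) :=
  (atomFun t (greenMeasure P' X t) φ, atomHat t (greenMeasure P' X t) φ)

lemma weakPair_mem [IsProbabilityMeasure P'] [SFinite μ] (hX : IsLevyProcess P' X)
    (hdens : ∀ t : ℝ≥0, 0 < t → (P'.map (X t)) ≪ volume) (hΨ : IsCharExponent P' X Ψ) (t : ℝ)
    (φ : 𝓢(Space d, ℝ)) : weakPair P' X t φ ∈ spectralPairs μ :=
  Submodule.subset_span ⟨t, greenMeasure P' X t, φ, greenMeasure_univ_le hX t, rfl,
    aestronglyMeasurable_atomFun_green hX hdens t φ,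
    aestronglyMeasurable_atomHat_green hX hdens hΨ t φ⟩

/-! ### Elementary functions -/

lemma smear_dirac (c : Space d) (φ : 𝓢(Space d, ℝ)) (y : Space d) :
    smear (Measure.dirac c) φ y = φ (y - c) := integral_dirac _ _

lemma measureFourier_dirac (c ξ : Space d) :
    measureFourier (Measure.dirac c) ξ = diracFourier c ξ := integral_dirac _ _

/-- The elementary function `(s,y) ↦ 1_{[0,a]}(s) φ(y - c)` with its spatial Fourier transform. -/
def elementaryPair (a : ℝ) (c : Space d) (φ : 𝓢(Space d, ℝ)) :
    (ℝ × Space d → ℝ) × (ℝ × Space d → ℂ) :=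
  (atomFun a (fun _ => Measure.dirac c) φ, atomHat a (fun _ => Measure.dirac c) φ)

lemma elementaryPair_snd (a : ℝ) (c : Space d) (φ : 𝓢(Space d, ℝ)) (p : ℝ × Space d) :
    (elementaryPair a c φ).2 p
      = timeIndicator a p.1 * (diracFourier c p.2 * schwartzFourier φ p.2) := by
  simp only [elementaryPair, atomHat, measureFourier_dirac]

lemma elementaryPair_mem (a : ℝ) (c : Space d) (φ : 𝓢(Space d, ℝ)) :
    elementaryPair a c φ ∈ spectralPairs μ := by
  refine Submodule.subset_span ⟨a, fun _ => Measure.dirac c, φ, fun _ => prob_le_one, rfl, ?_, ?_⟩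
  · have hφ : Measurable φ := φ.continuous.measurable
    have h : atomFun a (fun _ => Measure.dirac c) φ
        = fun p : ℝ × Space d => timeIndicator a p.1 * φ (p.2 - c) := by
      funext p
      rw [atomFun, smear_dirac]
    rw [h]
    exact Measurable.aestronglyMeasurable (by fun_prop)
  · have hφ : Measurable (schwartzFourier φ) := (continuous_schwartzFourier φ).measurable
    have h : atomHat a (fun _ => Measure.dirac c) φ
        = fun p : ℝ × Space d =>
          (timeIndicator a p.1 : ℂ) * (diracFourier c p.2 * schwartzFourier φ p.2) :=
      funext fun p => elementaryPair_snd a c φ p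
    rw [h]
    have h1 : Measurable fun p : ℝ × Space d => timeIndicator a p.1 := by fun_prop
    have h2 : Continuous fun p : ℝ × Space d => diracFourier c p.2 := by fun_prop
    exact ((Complex.measurable_ofReal.comp h1).mul
      (h2.measurable.mul (hφ.comp measurable_snd))).aestronglyMeasurable

lemma elementaryPair_fst_mem {a : ℝ} (ha : 0 < a) (c : Space d) (φ : 𝓢(Space d, ℝ)) :
    (elementaryPair a c φ).1 ∈ elementary d := by
  refine Submodule.subset_span ⟨a, ha, SchwartzMap.compSubConstCLM ℝ c φ, ?_⟩
  funext p
  simp only [elementaryPair, atomFun, smear_dirac]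
  rfl

/-- Every elementary function has a spectral representation. -/
lemma exists_pair_of_elementary {g : ℝ × Space d → ℝ} (hg : g ∈ elementary d) :
    ∃ ĝ, (g, ĝ) ∈ spectralPairs μ := by
  have hle : elementary d ≤ (spectralPairs μ).map (LinearMap.fst ℝ _ _) := by
    refine Submodule.span_le.2 ?_
    rintro _ ⟨a, ha, ψ, rfl⟩
    refine ⟨elementaryPair a 0 ψ, elementaryPair_mem a 0 ψ, ?_⟩
    funext p
    simp only [LinearMap.fst_apply, elementaryPair, atomFun, smear_dirac, sub_zero]
    rfl
  obtain ⟨⟨h, ĝ⟩, hp, rfl⟩ := hle hg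
  exact ⟨ĝ, hp⟩

/-! ### Approximation of the integrand by elementary functions -/

/-- A probability measure is approximated by finitely supported ones, at a rate that is uniform in
the Fourier variable up to linear growth. -/
lemma exists_finite_approx (ν : Measure (Space d)) [IsProbabilityMeasure ν] {ε : ℝ} (hε : 0 < ε) :
    ∃ (S : Finset (Space d)) (w : Space d → ℝ), (∀ ξ, ‖∑ c ∈ S, (w c : ℂ) * diracFourier c ξ‖ ≤ 1) ∧
      ∀ ξ, ‖∑ c ∈ S, (w c : ℂ) * diracFourier c ξ - measureFourier ν ξ‖ ≤ ε * (1 + ‖ξ‖) := by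
  have hid : StronglyMeasurable (id : Space d → Space d) := stronglyMeasurable_id
  have hlim : Tendsto (fun n => ∫ x, min 2 ‖hid.approx n x - x‖ ∂ν) atTop (𝓝 0) := by
    have h := tendsto_integral_of_dominated_convergence (μ := ν)
      (F := fun n x => min 2 ‖hid.approx n x - x‖) (f := fun _ => 0) (fun _ => 2)
      (fun n => Measurable.aestronglyMeasurable
        (measurable_const.min ((hid.approx n).measurable.sub measurable_id).norm))
      (integrable_const _) (fun n => ae_of_all _ fun x => by
        rw [Real.norm_of_nonneg (le_min zero_le_two (norm_nonneg _))]
        exact min_le_left _ _)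
      (ae_of_all _ fun x => by
        have h1 := (hid.tendsto_approx x).sub_const x
        simp only [id, sub_self] at h1
        have h2 := (tendsto_const_nhds (x := (2 : ℝ))).min h1.norm
        simpa using h2)
    simpa using h
  -- The approximating measure is the image of `ν` under the simple function `Q`, and
  -- `∫ min 2 |Q x - x| ν(dx) < ε` controls the difference of the Fourier transforms.
  obtain ⟨n, hn⟩ := (hlim.eventually (gt_mem_nhds hε)).exists
  set Q := hid.approx n with hQ
  have hQm : Measurable Q := Q.measurable
  have hsum : ∀ ξ, ∑ c ∈ Q.range, (ν.real (Q ⁻¹' {c}) : ℂ) * diracFourier c ξ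
      = ∫ x, diracFourier (Q x) ξ ∂ν := by
    intro ξ
    have h1 : ∀ x, diracFourier (Q x) ξ
        = ∑ c ∈ Q.range, (Q ⁻¹' {c}).indicator (fun _ => diracFourier c ξ) x := by
      intro x
      rw [Finset.sum_eq_single (Q x)]
      · rw [Set.indicator_of_mem (by simp)]
      · intro c _ hc
        exact Set.indicator_of_notMem (fun h => hc (by simpa using h.symm)) _
      · intro h
        exact absurd (Q.mem_range_self x) h
    simp_rw [h1]
    rw [integral_finsetSum _ fun c _ => (integrable_const _).indicator (Q.measurableSet_fiber c)]
    refine Finset.sum_congr rfl fun c _ => ?_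
    rw [integral_indicator_const _ (Q.measurableSet_fiber c), Complex.real_smul]
  have hmeas : ∀ ξ, AEStronglyMeasurable (fun x => diracFourier (Q x) ξ) ν := fun ξ =>
    ((continuous_diracFourier continuous_id continuous_const).measurable.comp
      hQm).aestronglyMeasurable
  refine ⟨Q.range, fun c => ν.real (Q ⁻¹' {c}), fun ξ => ?_, fun ξ => ?_⟩
  · rw [hsum]
    refine (norm_integral_le_integral_norm _).trans ?_
    simp [norm_diracFourier]
  · rw [hsum, measureFourier, ← integral_sub (Integrable.of_bound (hmeas ξ) 1
      (ae_of_all _ fun x => (norm_diracFourier _ _).le)) (integrable_diracFourier ν ξ)]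
    have hb : ∀ x, ‖diracFourier (Q x) ξ - diracFourier x ξ‖ ≤ min 2 ‖Q x - x‖ * (1 + ‖ξ‖) := by
      intro x
      have h1 : ‖diracFourier (Q x) ξ - diracFourier x ξ‖ ≤ 2 := by
        refine (norm_sub_le _ _).trans ?_
        rw [norm_diracFourier, norm_diracFourier]
        norm_num
      have h2 := norm_diracFourier_sub_le (Q x) x ξ
      have h3 := norm_nonneg ξ
      have h4 := norm_nonneg (Q x - x)
      rcases le_total 2 ‖Q x - x‖ with h | h
      · rw [min_eq_left h]
        nlinarith
      · rw [min_eq_right h]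
        nlinarith
    have hmin : Integrable (fun x => min 2 ‖Q x - x‖) ν := by
      refine Integrable.of_bound (C := 2) (Measurable.aestronglyMeasurable
        (measurable_const.min (hQm.sub measurable_id).norm)) (ae_of_all _ fun x => ?_)
      rw [Real.norm_of_nonneg (le_min zero_le_two (norm_nonneg _))]
      exact min_le_left _ _
    refine (norm_integral_le_of_norm_le (hmin.mul_const _) (ae_of_all _ hb)).trans ?_
    rw [integral_mul_const]
    gcongr

/-- The point `t j / (n + 1)` of the uniform grid on `[0,t]`. -/
def gridPoint (t : ℝ) (n j : ℕ) : ℝ := t * j / (n + 1)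

lemma gridPoint_nonneg {t : ℝ} (ht : 0 ≤ t) (n j : ℕ) : 0 ≤ gridPoint t n j := by
  unfold gridPoint
  positivity

lemma gridPoint_mono {t : ℝ} (ht : 0 ≤ t) (n : ℕ) {i j : ℕ} (h : i ≤ j) :
    gridPoint t n i ≤ gridPoint t n j := by
  unfold gridPoint
  gcongr

lemma timeIndicator_sub {a b : ℝ} (ha : 0 ≤ a) (hab : a ≤ b) (r : ℝ) :
    timeIndicator b r - timeIndicator a r = (Set.Ioc a b).indicator (fun _ => 1) r := by
  by_cases h : r ∈ Set.Ioc a b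
  · rw [Set.indicator_of_mem h, timeIndicator_of_mem ⟨ha.trans h.1.le, h.2⟩,
      timeIndicator_of_notMem (fun h' => not_le.2 h.1 h'.2), sub_zero]
  · rw [Set.indicator_of_notMem h]
    by_cases h2 : r ∈ Set.Icc 0 a
    · rw [timeIndicator_of_mem h2, timeIndicator_of_mem ⟨h2.1, h2.2.trans hab⟩, sub_self]
    · rw [timeIndicator_of_notMem h2, timeIndicator_of_notMem, sub_zero]
      intro h3
      refine h ⟨?_, h3.2⟩
      by_contra h4
      exact h2 ⟨h3.1, not_lt.1 h4⟩

/-- The value of a step function on the grid. The first grid interval is left out, because the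
elementary functions do not contain the indicator function of `(0, b]`. -/
lemma sum_grid_indicator {t : ℝ} (ht : 0 ≤ t) {n j : ℕ} (hj : j < n) {r : ℝ}
    (hr : r ∈ Set.Ioc (gridPoint t n (j + 1)) (gridPoint t n (j + 2))) (x : ℕ → ℂ) :
    ∑ i ∈ Finset.range n, (((Set.Ioc (gridPoint t n (i + 1)) (gridPoint t n (i + 2))).indicator
      (fun _ => (1 : ℝ)) r : ℝ) : ℂ) * x i = x j := by
  rw [Finset.sum_eq_single j]
  · rw [Set.indicator_of_mem hr, Complex.ofReal_one, one_mul]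
  · intro i _ hij
    rw [Set.indicator_of_notMem, Complex.ofReal_zero, zero_mul]
    intro hi
    rcases lt_or_gt_of_ne hij with h | h
    · have := gridPoint_mono ht n (show i + 2 ≤ j + 1 by omega)
      linarith [hi.2, hr.1]
    · have := gridPoint_mono ht n (show j + 2 ≤ i + 1 by omega)
      linarith [hr.2, hi.1]
  · intro h
    exact absurd (Finset.mem_range.2 hj) h

/-- A point of `(0,t)` lies in one of the grid intervals after the first, once the grid is fine
enough. -/
lemma exists_grid_index {t r : ℝ} (ht : 0 < t) (hr : 0 < r) (hrt : r < t) :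
    ∃ j : ℕ → ℕ, ∀ᶠ n in atTop, j n < n ∧
      r ∈ Set.Ioc (gridPoint t n (j n + 1)) (gridPoint t n (j n + 2)) := by
  refine ⟨fun n => ⌈r * (n + 1) / t⌉₊ - 2, ?_⟩
  have hlarge : ∀ᶠ n : ℕ in atTop, 1 < r * ((n : ℝ) + 1) / t := by
    have h1 : Tendsto (fun n : ℕ => (n : ℝ) + 1) atTop atTop :=
      tendsto_natCast_atTop_atTop.atTop_add tendsto_const_nhds
    have h2 : Tendsto (fun n : ℕ => r * ((n : ℝ) + 1) / t) atTop atTop :=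
      (h1.const_mul_atTop hr).atTop_div_const ht
    exact h2.eventually_gt_atTop 1
  filter_upwards [hlarge] with n hn
  set x := r * ((n : ℝ) + 1) / t with hx
  have hxn : x < n + 1 := by
    rw [hx, div_lt_iff₀ ht, mul_comm]
    gcongr
  have hk1 : 1 < ⌈x⌉₊ := Nat.lt_ceil.2 (by simpa using hn)
  have hk2 : ⌈x⌉₊ ≤ n + 1 := Nat.ceil_le.2 (by push_cast; exact hxn.le)
  have hrx : r = t * x / (n + 1) := by
    rw [hx]
    field_simp
  have e1 : ⌈x⌉₊ - 2 + 2 = ⌈x⌉₊ := by omega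
  have e2 : ((⌈x⌉₊ - 2 + 1 : ℕ) : ℝ) = ⌈x⌉₊ - 1 := by
    rw [show ⌈x⌉₊ - 2 + 1 = ⌈x⌉₊ - 1 by omega, Nat.cast_sub hk1.le, Nat.cast_one]
  have hlt : (⌈x⌉₊ : ℝ) - 1 < x := by
    have := Nat.ceil_lt_add_one (show 0 ≤ x by linarith)
    linarith
  refine ⟨by omega, ?_, ?_⟩
  · rw [gridPoint, e2]
    conv_rhs => rw [hrx]
    gcongr
  · rw [gridPoint, e1]
    conv_lhs => rw [hrx]
    gcongr
    exact Nat.le_ceil x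

/-- Elementary functions whose Fourier transforms approximate that of the integrand of the weak
solution: the time variable is discretised, and the law of `X_{t-s}` is replaced by finitely
supported measures, which turns its convolution with `φ` into a combination of translates. -/
lemma exists_elementary_approx [IsProbabilityMeasure P'] (hX : IsLevyProcess P' X)
    (hΨ : IsCharExponent P' X Ψ) {t : ℝ} (ht : 0 < t) (φ : 𝓢(Space d, ℝ)) :
    ∃ G : ℕ → (ℝ × Space d → ℝ) × (ℝ × Space d → ℂ),
      (∀ n, G n ∈ spectralPairs μ) ∧ (∀ n, (G n).1 ∈ elementary d) ∧
      (∀ n p, ‖(G n).2 p‖ ≤ timeIndicator t p.1 * ‖schwartzFourier φ p.2‖) ∧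
      ∀ r ξ, 0 < r → r < t → Tendsto (fun n => (G n).2 (r, ξ)) atTop
        (𝓝 (Complex.exp (-(((t - r : ℝ) : ℂ) * Ψ ξ)) * schwartzFourier φ ξ)) := by
  have hex : ∀ n j : ℕ, ∃ (S : Finset (Space d)) (w : Space d → ℝ),
      (∀ ξ, ‖∑ c ∈ S, (w c : ℂ) * diracFourier c ξ‖ ≤ 1) ∧
      ∀ ξ, ‖∑ c ∈ S, (w c : ℂ) * diracFourier c ξ
        - measureFourier (P'.map (X (t - gridPoint t n (j + 1)).toNNReal)) ξ‖
        ≤ (1 / ((n : ℝ) + 1)) * (1 + ‖ξ‖) := by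
    intro n j
    have := isProbabilityMeasure_map hX (t - gridPoint t n (j + 1)).toNNReal
    exact exists_finite_approx _ (by positivity)
  choose S w hw1 hw2 using hex
  set m : ℕ → ℕ → Space d → ℂ := fun n j ξ => ∑ c ∈ S n j, (w n j c : ℂ) * diracFourier c ξ with hm
  set G : ℕ → (ℝ × Space d → ℝ) × (ℝ × Space d → ℂ) := fun n =>
    ∑ j ∈ Finset.range n, ∑ c ∈ S n j, w n j c •
      (elementaryPair (gridPoint t n (j + 2)) c φ - elementaryPair (gridPoint t n (j + 1)) c φ)
    with hG
  have hval : ∀ n p, (G n).2 p = ∑ j ∈ Finset.range n,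
      (((Set.Ioc (gridPoint t n (j + 1)) (gridPoint t n (j + 2))).indicator
        (fun _ => (1 : ℝ)) p.1 : ℝ) : ℂ) * (m n j p.2 * schwartzFourier φ p.2) := by
    intro n p
    simp only [hG, Prod.snd_sum, Finset.sum_apply, Prod.smul_snd, Prod.snd_sub, Pi.smul_apply,
      Pi.sub_apply, elementaryPair_snd, Complex.real_smul]
    refine Finset.sum_congr rfl fun j _ => ?_
    rw [← timeIndicator_sub (gridPoint_nonneg ht.le n (j + 1))
      (gridPoint_mono ht.le n (show j + 1 ≤ j + 2 by omega)), hm, Finset.sum_mul, Finset.mul_sum]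
    refine Finset.sum_congr rfl fun c _ => ?_
    push_cast
    ring
  refine ⟨G, fun n => ?_, fun n => ?_, fun n p => ?_, fun r ξ hr hrt => ?_⟩
  · exact Submodule.sum_mem _ fun j _ => Submodule.sum_mem _ fun c _ => Submodule.smul_mem _ _
      (Submodule.sub_mem _ (elementaryPair_mem _ c φ) (elementaryPair_mem _ c φ))
  · have hpos : ∀ j, 0 < gridPoint t n (j + 1) := fun j => by
      unfold gridPoint
      positivity
    simp only [hG, Prod.fst_sum, Prod.smul_fst, Prod.fst_sub]
    exact Submodule.sum_mem _ fun j _ => Submodule.sum_mem _ fun c _ => Submodule.smul_mem _ _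
      (Submodule.sub_mem _ (elementaryPair_fst_mem (hpos (j + 1)) c φ)
        (elementaryPair_fst_mem (hpos j) c φ))
  · rw [hval]
    by_cases h : ∃ j < n, p.1 ∈ Set.Ioc (gridPoint t n (j + 1)) (gridPoint t n (j + 2))
    · obtain ⟨j, hj, hp⟩ := h
      rw [sum_grid_indicator ht.le hj hp (fun j => m n j p.2 * schwartzFourier φ p.2), norm_mul]
      have hlast : gridPoint t n (j + 2) ≤ t := by
        have h1 := gridPoint_mono ht.le n (show j + 2 ≤ n + 1 by omega)
        have h2 : gridPoint t n (n + 1) = t := by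
          unfold gridPoint
          push_cast
          field_simp
        linarith
      rw [timeIndicator_of_mem ⟨(gridPoint_nonneg ht.le n (j + 1)).trans hp.1.le, hp.2.trans hlast⟩]
      exact mul_le_mul_of_nonneg_right (hw1 n j p.2) (norm_nonneg _)
    · rw [Finset.sum_eq_zero]
      · rw [norm_zero]
        exact mul_nonneg (timeIndicator_nonneg _ _) (norm_nonneg _)
      · intro j hj
        rw [Set.indicator_of_notMem fun hp => h ⟨j, Finset.mem_range.1 hj, hp⟩, Complex.ofReal_zero,
          zero_mul]
  · obtain ⟨j, hj⟩ := exists_grid_index ht hr hrt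
    have hone : Tendsto (fun n : ℕ => 1 / ((n : ℝ) + 1)) atTop (𝓝 0) :=
      tendsto_one_div_add_atTop_nhds_zero_nat
    have hT : Tendsto (fun n => gridPoint t n (j n + 1)) atTop (𝓝 r) := by
      have hlow : Tendsto (fun n : ℕ => r - t * (1 / ((n : ℝ) + 1))) atTop (𝓝 r) := by
        simpa using tendsto_const_nhds.sub (hone.const_mul t)
      refine tendsto_of_tendsto_of_tendsto_of_le_of_le' hlow tendsto_const_nhds ?_ ?_
      · filter_upwards [hj] with n hn
        have h1 := hn.2.2
        have h2 : gridPoint t n (j n + 2) = gridPoint t n (j n + 1) + t * (1 / ((n : ℝ) + 1)) := by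
          unfold gridPoint
          push_cast
          ring
        linarith
      · filter_upwards [hj] with n hn using hn.2.1.le
    have hcont : Continuous fun a : ℝ =>
        Complex.exp (-(((t - a : ℝ) : ℂ) * Ψ ξ)) * schwartzFourier φ ξ := by fun_prop
    have hlim := (hcont.tendsto r).comp hT
    refine (tendsto_iff_of_dist ?_).1 hlim
    have hbound : Tendsto (fun n : ℕ => (1 / ((n : ℝ) + 1)) * (1 + ‖ξ‖) * ‖schwartzFourier φ ξ‖)
        atTop (𝓝 0) := by
      simpa using (hone.mul_const (1 + ‖ξ‖)).mul_const ‖schwartzFourier φ ξ‖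
    refine squeeze_zero' (Eventually.of_forall fun n => dist_nonneg) ?_ hbound
    filter_upwards [hj] with n hn
    rw [hval, sum_grid_indicator ht.le hn.1 hn.2 (fun j => m n j ξ * schwartzFourier φ ξ),
      dist_comm, dist_eq_norm, Function.comp_apply, ← sub_mul, norm_mul]
    refine mul_le_mul_of_nonneg_right ?_ (norm_nonneg _)
    have h1 := hw2 n (j n) ξ
    rwa [measureFourier_map hX hΨ, Real.coe_toNNReal _ (by linarith [hn.2.1])] at h1

lemma norm_weakPair_snd_le [IsProbabilityMeasure P'] (hX : IsLevyProcess P' X) (t : ℝ)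
    (φ : 𝓢(Space d, ℝ)) (p : ℝ × Space d) :
    ‖(weakPair P' X t φ).2 p‖ ≤ timeIndicator t p.1 * ‖schwartzFourier φ p.2‖ := by
  simp only [weakPair, atomHat]
  rw [norm_mul, Complex.norm_real, Real.norm_of_nonneg (timeIndicator_nonneg _ _), norm_mul]
  refine mul_le_mul_of_nonneg_left ?_ (timeIndicator_nonneg _ _)
  exact mul_le_of_le_one_left (norm_nonneg _) (norm_measureFourier_le (greenMeasure_univ_le hX t _) _)

lemma hpInner_eq_re {p q : (ℝ × Space d → ℝ) × (ℝ × Space d → ℂ)} (h : Plancherel H f μ p q) :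
    hpInner H f p.1 q.1 = H * (2 * H - 1) *
      (∫ z, spectralIntegrand H p.2 q.2 z ∂((timeMeasure.prod timeMeasure).prod μ)).re := by
  rw [hpInner, ← h.integral_eq, Complex.ofReal_re]

/-- The integrand of the weak solution is a limit of elementary functions. -/
lemma exists_elementary_tendsto [IsProbabilityMeasure P'] (hH : 1 / 2 < H) (hH' : H < 1)
    (hf : IsSpatialCovariance f μ) (hX : IsLevyProcess P' X)
    (hdens : ∀ t : ℝ≥0, 0 < t → (P'.map (X t)) ≪ volume)
    (hΨ : IsCharExponent P' X Ψ) {t : ℝ} (ht : 0 < t) (φ : 𝓢(Space d, ℝ)) :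
    ∃ G : ℕ → (ℝ × Space d → ℝ) × (ℝ × Space d → ℂ),
      (∀ n, G n ∈ spectralPairs μ) ∧ (∀ n, (G n).1 ∈ elementary d) ∧
      Tendsto (fun n => hpInner H f (weakPair P' X t φ - G n).1 (weakPair P' X t φ - G n).1)
        atTop (𝓝 0) := by
  have := hf.tempered
  have := sigmaFinite_of_hasTemperateGrowth μ
  obtain ⟨G, hG1, hG2, hG3, hG4⟩ := exists_elementary_approx (μ := μ) hX hΨ ht φ
  refine ⟨G, hG1, hG2, ?_⟩
  have hmem : ∀ n, weakPair P' X t φ - G n ∈ spectralPairs μ := fun n =>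
    Submodule.sub_mem _ (weakPair_mem hX hdens hΨ t φ) (hG1 n)
  have hb : ∀ n p, ‖(weakPair P' X t φ - G n).2 p‖
      ≤ 2 * (timeIndicator t p.1 * ‖schwartzFourier φ p.2‖) := by
    intro n p
    have h1 := norm_sub_le ((weakPair P' X t φ).2 p) ((G n).2 p)
    have h2 := norm_weakPair_snd_le hX t φ p
    have h3 := hG3 n p
    simp only [Prod.snd_sub, Pi.sub_apply]
    linarith
  have hlim : Tendsto (fun n => ∫ z, spectralIntegrand H (weakPair P' X t φ - G n).2
      (weakPair P' X t φ - G n).2 z ∂((timeMeasure.prod timeMeasure).prod μ)) atTop (𝓝 0) := by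
    have h := tendsto_integral_of_dominated_convergence
      (μ := (timeMeasure.prod timeMeasure).prod μ)
      (F := fun n z => spectralIntegrand H (weakPair P' X t φ - G n).2
        (weakPair P' X t φ - G n).2 z) (f := fun _ => 0)
      (fun z => 4 * (timeKernel H t t z.1 * (‖schwartzFourier φ z.2‖ * ‖schwartzFourier φ z.2‖)))
      (fun n => (plancherel_of_mem hH hH' hf (hmem n) (hmem n)).integrable_spectral.1)
      (((integrable_timeKernel hH hH' t t).mul_prod
        (integrable_norm_schwartzFourier_mul (μ := μ) φ φ)).const_mul 4)
      (fun n => ae_of_all _ fun z => ?_) ?_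
    · simpa using h
    · simp only [spectralIntegrand]
      rw [norm_mul, norm_mul, RCLike.norm_conj, Complex.norm_real,
        Real.norm_of_nonneg (by positivity), timeKernel]
      calc _ ≤ |z.1.1 - z.1.2| ^ (2 * H - 2) *
            (2 * (timeIndicator t z.1.1 * ‖schwartzFourier φ z.2‖)) *
            (2 * (timeIndicator t z.1.2 * ‖schwartzFourier φ z.2‖)) := by
            have := timeIndicator_nonneg t z.1.1
            gcongr
            · exact hb n _
            · exact hb n _
        _ = _ := by ring
    · have hae : ∀ s : ℝ, ∀ᵐ z ∂((timeMeasure.prod timeMeasure).prod μ), z.1.1 ≠ s := fun s =>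
        Measure.quasiMeasurePreserving_fst.ae (ae_fst_ne timeMeasure s)
      filter_upwards [hae 0, hae t] with z hz0 hzt
      have hD : Tendsto (fun n => (weakPair P' X t φ - G n).2 (z.1.1, z.2)) atTop (𝓝 0) := by
        by_cases hz : z.1.1 ∈ Set.Icc 0 t
        · have hpos : 0 < z.1.1 := lt_of_le_of_ne hz.1 (Ne.symm hz0)
          have h1 := (tendsto_const_nhds (x := (weakPair P' X t φ).2 (z.1.1, z.2))).sub
            (hG4 z.1.1 z.2 hpos (lt_of_le_of_ne hz.2 hzt))
          have h2 : (weakPair P' X t φ).2 (z.1.1, z.2)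
              = Complex.exp (-(((t - z.1.1 : ℝ) : ℂ) * Ψ z.2)) * schwartzFourier φ z.2 := by
            have := atomHat_green_eq hX hdens hΨ φ (p := (z.1.1, z.2)) hzt
            refine this.trans ?_
            rw [timeIndicator_of_mem hz, Complex.ofReal_one, one_mul]
          rw [h2, sub_self] at h1
          rw [← h2] at h1
          exact h1
        · have h0 : ∀ n, (weakPair P' X t φ - G n).2 (z.1.1, z.2) = 0 := fun n => by
            have := hb n (z.1.1, z.2)
            rw [timeIndicator_of_notMem hz, zero_mul, mul_zero] at this
            exact norm_le_zero_iff.1 this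
          simp_rw [h0]
          exact tendsto_const_nhds
      have hbdd : ∀ n, ‖(starRingEnd ℂ) ((weakPair P' X t φ - G n).2 (z.1.2, z.2))‖
          ≤ 2 * (timeIndicator t z.1.2 * ‖schwartzFourier φ z.2‖) := fun n => by
        rw [RCLike.norm_conj]
        exact hb n _
      have h3 : Tendsto (fun n => (((|z.1.1 - z.1.2| ^ (2 * H - 2) : ℝ) : ℂ)
          * (weakPair P' X t φ - G n).2 (z.1.1, z.2))) atTop (𝓝 0) := by
        simpa using hD.const_mul ((|z.1.1 - z.1.2| ^ (2 * H - 2) : ℝ) : ℂ)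
      exact h3.zero_mul_isBoundedUnder_le
        (isBoundedUnder_of ⟨_, hbdd⟩)
  have heq : ∀ n, hpInner H f (weakPair P' X t φ - G n).1 (weakPair P' X t φ - G n).1
      = H * (2 * H - 1) * (∫ z, spectralIntegrand H (weakPair P' X t φ - G n).2
      (weakPair P' X t φ - G n).2 z ∂((timeMeasure.prod timeMeasure).prod μ)).re := fun n =>
    hpInner_eq_re (plancherel_of_mem hH hH' hf (hmem n) (hmem n))
  simp_rw [heq]
  have h5 := ((Complex.continuous_re.tendsto 0).comp hlim).const_mul (H * (2 * H - 1))
  simpa using h5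

/-! ### The quadratic form of the noise -/

/-- The quadratic form of the noise as an integral over frequencies of the temporal form. -/
lemma hpInner_self_eq_integral (hH : 1 / 2 < H) (hH' : H < 1) (hf : IsSpatialCovariance f μ)
    {p : (ℝ × Space d → ℝ) × (ℝ × Space d → ℂ)} (hp : p ∈ spectralPairs μ) :
    Integrable (fun ξ => timeForm H fun r => p.2 (r, ξ)) μ ∧
    hpInner H f p.1 p.1
      = H * (2 * H - 1) * ∫ ξ, (timeForm H fun r => p.2 (r, ξ)).re ∂μ := by
  have := hf.tempered
  have := sigmaFinite_of_hasTemperateGrowth μ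
  have h := plancherel_of_mem hH hH' hf hp hp
  have hi : Integrable (fun ξ => timeForm H fun r => p.2 (r, ξ)) μ :=
    h.integrable_spectral.integral_prod_right
  refine ⟨hi, ?_⟩
  rw [hpInner_eq_re h, integral_prod_symm _ h.integrable_spectral]
  congr 1
  exact (integral_re hi).symm

/-- The form is positive semidefinite: `μ` is a positive measure and the temporal form is
nonnegative at every frequency. -/
lemma hpInner_self_nonneg (hH : 1 / 2 < H) (hH' : H < 1) (hf : IsSpatialCovariance f μ)
    {p : (ℝ × Space d → ℝ) × (ℝ × Space d → ℂ)} (hp : p ∈ spectralPairs μ) :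
    0 ≤ hpInner H f p.1 p.1 := by
  have := hf.tempered
  have := sigmaFinite_of_hasTemperateGrowth μ
  rw [(hpInner_self_eq_integral hH hH' hf hp).2]
  refine mul_nonneg (mul_nonneg (by linarith) (by linarith)) (integral_nonneg_of_ae ?_)
  have h := plancherel_of_mem hH hH' hf hp hp
  have h1 : ∀ᵐ ξ ∂μ, AEStronglyMeasurable (fun r => p.2 (r, ξ)) timeMeasure := by
    have h2 := (aestronglyMeasurable_of_mem hp).prod_swap
    exact h2.prodMk_left
  filter_upwards [h1, h.integrable_spectral.prod_left_ae] with ξ hm hi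
  exact timeForm_nonneg hH' hm hi

lemma hpInner_sub_sub (hH : 1 / 2 < H) (hH' : H < 1) (hf : IsSpatialCovariance f μ)
    {p q : (ℝ × Space d → ℝ) × (ℝ × Space d → ℂ)} (hp : p ∈ spectralPairs μ)
    (hq : q ∈ spectralPairs μ) :
    hpInner H f (p - q).1 (p - q).1 = hpInner H f p.1 p.1 - hpInner H f p.1 q.1
      - hpInner H f q.1 p.1 + hpInner H f q.1 q.1 := by
  have hpp := (plancherel_of_mem hH hH' hf hp hp).integrable
  have hpq := (plancherel_of_mem hH hH' hf hp hq).integrable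
  have hqp := (plancherel_of_mem hH hH' hf hq hp).integrable
  have hqq := (plancherel_of_mem hH hH' hf hq hq).integrable
  have h : hpIntegrand H f (p - q).1 (p - q).1 = hpIntegrand H f p.1 p.1 - hpIntegrand H f p.1 q.1
      - hpIntegrand H f q.1 p.1 + hpIntegrand H f q.1 q.1 := by
    funext z
    simp only [hpIntegrand, Prod.fst_sub, Pi.sub_apply, Pi.add_apply]
    ring
  simp only [hpInner, h]
  rw [integral_add' ((hpp.sub hpq).sub hqp) hqq, integral_sub' (hpp.sub hpq) hqp,
    integral_sub' hpp hpq]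
  ring

lemma hpInner_add_add (hH : 1 / 2 < H) (hH' : H < 1) (hf : IsSpatialCovariance f μ)
    {p q : (ℝ × Space d → ℝ) × (ℝ × Space d → ℂ)} (hp : p ∈ spectralPairs μ)
    (hq : q ∈ spectralPairs μ) :
    hpInner H f (p + q).1 (p + q).1 = hpInner H f p.1 p.1 + hpInner H f p.1 q.1
      + hpInner H f q.1 p.1 + hpInner H f q.1 q.1 := by
  have hpp := (plancherel_of_mem hH hH' hf hp hp).integrable
  have hpq := (plancherel_of_mem hH hH' hf hp hq).integrable
  have hqp := (plancherel_of_mem hH hH' hf hq hp).integrable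
  have hqq := (plancherel_of_mem hH hH' hf hq hq).integrable
  have h : hpIntegrand H f (p + q).1 (p + q).1 = hpIntegrand H f p.1 p.1 + hpIntegrand H f p.1 q.1
      + hpIntegrand H f q.1 p.1 + hpIntegrand H f q.1 q.1 := by
    funext z
    simp only [hpIntegrand, Prod.fst_add, Pi.add_apply]
    ring
  simp only [hpInner, h]
  rw [integral_add' ((hpp.add hpq).add hqp) hqq, integral_add' (hpp.add hpq) hqp,
    integral_add' hpp hpq]
  ring

lemma hpInner_sub_le (hH : 1 / 2 < H) (hH' : H < 1) (hf : IsSpatialCovariance f μ)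
    {p q : (ℝ × Space d → ℝ) × (ℝ × Space d → ℂ)} (hp : p ∈ spectralPairs μ)
    (hq : q ∈ spectralPairs μ) :
    hpInner H f (p - q).1 (p - q).1 ≤ 2 * hpInner H f p.1 p.1 + 2 * hpInner H f q.1 q.1 := by
  have h := hpInner_self_nonneg hH hH' hf (Submodule.add_mem _ hp hq)
  rw [hpInner_add_add hH hH' hf hp hq] at h
  rw [hpInner_sub_sub hH hH' hf hp hq]
  linarith

/-! ### Stochastic integrals -/

variable {Ω : Type*} [MeasurableSpace Ω] {P : Measure Ω} {W : elementary d → Ω → ℝ}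

lemma IsFractionalNoise.memLp (hW : IsFractionalNoise P H f W) (g : elementary d) :
    MemLp (W g) 2 P := (hW.gaussian.hasGaussianLaw_eval g).memLp_two

/-- The variable `W(g)` as an element of `L²(Ω)`. -/
def IsFractionalNoise.toL2 (hW : IsFractionalNoise P H f W) (g : elementary d) : Lp ℝ 2 P :=
  (hW.memLp g).toLp (W g)

lemma IsFractionalNoise.inner_toL2 (hW : IsFractionalNoise P H f W) (g g' : elementary d) :
    ⟪hW.toL2 g, hW.toL2 g'⟫_ℝ = hpInner H f (g : _ → ℝ) (g' : _ → ℝ) := by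
  rw [← hW.covariance, L2.inner_def]
  refine integral_congr_ae ?_
  filter_upwards [(hW.memLp g).coeFn_toLp, (hW.memLp g').coeFn_toLp] with ω h h'
  rw [IsFractionalNoise.toL2, IsFractionalNoise.toL2, h, h']
  simp [mul_comm]

lemma IsFractionalNoise.norm_toL2_sub_sq (hH : 1 / 2 < H) (hH' : H < 1)
    (hf : IsSpatialCovariance f μ) (hW : IsFractionalNoise P H f W) {g g' : elementary d}
    {p p' : (ℝ × Space d → ℝ) × (ℝ × Space d → ℂ)} (hp : p ∈ spectralPairs μ)
    (hp' : p' ∈ spectralPairs μ) (hg : p.1 = g) (hg' : p'.1 = g') :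
    ‖hW.toL2 g - hW.toL2 g'‖ ^ 2 = hpInner H f (p - p').1 (p - p').1 := by
  rw [hpInner_sub_sub hH hH' hf hp hp', hg, hg', ← real_inner_self_eq_norm_sq, inner_sub_left,
    inner_sub_right, inner_sub_right, hW.inner_toL2, hW.inner_toL2, hW.inner_toL2, hW.inner_toL2]
  ring

/-- The stochastic integral exists for every limit of elementary functions, by completeness of
`L²(Ω)`. -/
lemma IsFractionalNoise.exists_isStochasticIntegral (hH : 1 / 2 < H) (hH' : H < 1)
    (hf : IsSpatialCovariance f μ) (hW : IsFractionalNoise P H f W)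
    {p : (ℝ × Space d → ℝ) × (ℝ × Space d → ℂ)} (hp : p ∈ spectralPairs μ)
    {G : ℕ → (ℝ × Space d → ℝ) × (ℝ × Space d → ℂ)} (hG : ∀ n, G n ∈ spectralPairs μ)
    (hGe : ∀ n, (G n).1 ∈ elementary d)
    (hlim : Tendsto (fun n => hpInner H f (p - G n).1 (p - G n).1) atTop (𝓝 0)) :
    ∃ Z, IsStochasticIntegral P H f W p.1 Z := by
  set g : ℕ → elementary d := fun n => ⟨(G n).1, hGe n⟩ with hg
  have hmem : ∀ n, p - G n ∈ spectralPairs μ := fun n => Submodule.sub_mem _ hp (hG n)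
  have hcauchy : CauchySeq fun n => hW.toL2 (g n) := by
    refine Metric.cauchySeq_iff'.2 fun ε hε => ?_
    obtain ⟨N, hN⟩ := eventually_atTop.1
      (hlim.eventually (gt_mem_nhds (show 0 < ε ^ 2 / 4 by positivity)))
    refine ⟨N, fun n hn => ?_⟩
    rw [dist_eq_norm]
    refine lt_of_pow_lt_pow_left₀ 2 hε.le ?_
    rw [hW.norm_toL2_sub_sq hH hH' hf (hG n) (hG N) rfl rfl]
    have h1 := hpInner_sub_le hH hH' hf (hmem N) (hmem n)
    rw [sub_sub_sub_cancel_left] at h1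
    linarith [hN n hn, hN N le_rfl]
  obtain ⟨z, hz⟩ := cauchySeq_tendsto_of_complete hcauchy
  refine ⟨z, Lp.memLp z, g, fun n => ?_, hlim, ?_⟩
  · exact (plancherel_of_mem hH hH' hf (hmem n) (hmem n)).integrable
  · refine (Lp.tendsto_Lp_iff_tendsto_eLpNorm'' (fun n => W (g n)) (fun n => hW.memLp (g n)) z
      (Lp.memLp z)).1 ?_
    rw [Lp.toLp_coeFn]
    exact hz

/-- The stochastic integral is bounded in terms of the norm of the noise. (It is an isometry; an
inequality suffices.) -/
lemma IsStochasticIntegral.norm_sub_sq_le (hH : 1 / 2 < H) (hH' : H < 1)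
    (hf : IsSpatialCovariance f μ) (hW : IsFractionalNoise P H f W)
    {p q : (ℝ × Space d → ℝ) × (ℝ × Space d → ℂ)} (hp : p ∈ spectralPairs μ)
    (hq : q ∈ spectralPairs μ) {Z Z' : Ω → ℝ} (hZ : IsStochasticIntegral P H f W p.1 Z)
    (hZ' : IsStochasticIntegral P H f W q.1 Z') :
    ‖hZ.1.toLp Z - hZ'.1.toLp Z'‖ ^ 2 ≤ 2 * hpInner H f (p - q).1 (p - q).1 := by
  obtain ⟨hm, g, -, hg, hgZ⟩ := hZ
  obtain ⟨hm', g', -, hg', hgZ'⟩ := hZ'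
  choose k hk using fun n => exists_pair_of_elementary (μ := μ) (g n).2
  choose k' hk' using fun n => exists_pair_of_elementary (μ := μ) (g' n).2
  have h1 := (Lp.tendsto_Lp_iff_tendsto_eLpNorm'' (fun n => W (g n)) (fun n => hW.memLp (g n)) Z
    hm).2 hgZ
  have h2 := (Lp.tendsto_Lp_iff_tendsto_eLpNorm'' (fun n => W (g' n)) (fun n => hW.memLp (g' n)) Z'
    hm').2 hgZ'
  have h3 : Tendsto (fun n => ‖hW.toL2 (g n) - hW.toL2 (g' n)‖ ^ 2) atTop
      (𝓝 (‖hm.toLp Z - hm'.toLp Z'‖ ^ 2)) := ((h1.sub h2).norm).pow 2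
  have h4 : Tendsto (fun n => 2 * hpInner H f (p - q).1 (p - q).1
      + 2 * (2 * hpInner H f (p.1 - (g n : _ → ℝ)) (p.1 - (g n : _ → ℝ))
        + 2 * hpInner H f (q.1 - (g' n : _ → ℝ)) (q.1 - (g' n : _ → ℝ)))) atTop
      (𝓝 (2 * hpInner H f (p - q).1 (p - q).1)) := by
    simpa using tendsto_const_nhds.add (((hg.const_mul 2).add (hg'.const_mul 2)).const_mul 2)
  refine le_of_tendsto_of_tendsto' h3 h4 fun n => ?_
  rw [hW.norm_toL2_sub_sq hH hH' hf (hk n) (hk' n) rfl rfl]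
  -- Write `gₙ - g'ₙ = (p - q) - ((p - gₙ) - (q - g'ₙ))` and bound the norm of each difference.
  have m1 := Submodule.sub_mem _ hp (hk n)
  have m2 := Submodule.sub_mem _ hq (hk' n)
  have e1 := hpInner_sub_le hH hH' hf (Submodule.sub_mem _ hp hq) (Submodule.sub_mem _ m1 m2)
  have e2 := hpInner_sub_le hH hH' hf m1 m2
  have e3 : (p - q) - ((p - ((g n : _ → ℝ), k n)) - (q - ((g' n : _ → ℝ), k' n)))
      = (((g n : _ → ℝ), k n) - ((g' n : _ → ℝ), k' n)) := by abel
  rw [e3] at e1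
  simp only [Prod.fst_sub] at e1 e2 ⊢
  linarith

/-! ### The norm of the weak solution -/

lemma timeForm_mul_const (u : ℝ → ℂ) (c : ℂ) :
    timeForm H (fun r => u r * c) = timeForm H u * ((‖c‖ ^ 2 : ℝ) : ℂ) := by
  rw [timeForm, timeForm, ← integral_mul_const]
  refine integral_congr_ae (ae_of_all _ fun z => ?_)
  simp only [map_mul]
  rw [← Complex.normSq_eq_norm_sq, ← Complex.mul_conj]
  ring

lemma timeForm_congr {u v : ℝ → ℂ} (h : u =ᵐ[timeMeasure] v) : timeForm H u = timeForm H v := by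
  refine integral_congr_ae ?_
  filter_upwards [Measure.quasiMeasurePreserving_fst.ae h, Measure.quasiMeasurePreserving_snd.ae h]
    with z h1 h2
  rw [h1, h2]

/-- The norm of the noise of the integrand of `u(t,φ) - u(t,ψ)` is `‖φ - ψ‖_t`. -/
lemma ofReal_hpInner_weakPair_sub [IsProbabilityMeasure P'] (hH : 1 / 2 < H) (hH' : H < 1)
    (hf : IsSpatialCovariance f μ) (hX : IsLevyProcess P' X)
    (hdens : ∀ t : ℝ≥0, 0 < t → (P'.map (X t)) ≪ volume)
    (hΨ : IsCharExponent P' X Ψ) {t : ℝ} (ht : 0 ≤ t) (φ ψ : 𝓢(Space d, ℝ)) :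
    ENNReal.ofReal (hpInner H f (weakPair P' X t φ - weakPair P' X t ψ).1
        (weakPair P' X t φ - weakPair P' X t ψ).1)
      = normSq H Ψ μ t (fun ξ => schwartzFourier φ ξ - schwartzFourier ψ ξ) := by
  have := hf.tempered
  have := sigmaFinite_of_hasTemperateGrowth μ
  have hα : 0 < H * (2 * H - 1) := mul_pos (by linarith) (by linarith)
  have hmem : weakPair P' X t φ - weakPair P' X t ψ ∈ spectralPairs μ :=
    Submodule.sub_mem _ (weakPair_mem hX hdens hΨ t φ) (weakPair_mem hX hdens hΨ t ψ)
  obtain ⟨hi, heq⟩ := hpInner_self_eq_integral hH hH' hf hmem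
  have hform : ∀ ξ, timeForm H (fun r => (weakPair P' X t φ - weakPair P' X t ψ).2 (r, ξ))
      = timeForm H (truncExp t (Ψ ξ))
        * ((‖schwartzFourier φ ξ - schwartzFourier ψ ξ‖ ^ 2 : ℝ) : ℂ) := by
    intro ξ
    rw [← timeForm_reverse hH hH' ht (re_charExponent_nonneg hX hΨ ξ), ← timeForm_mul_const]
    refine timeForm_congr ?_
    have hne : ∀ᵐ r ∂timeMeasure, r ≠ t := by
      refine ae_restrict_of_ae ?_
      simp [ae_iff]
    filter_upwards [hne] with r hr
    have h1 := atomHat_green_eq hX hdens hΨ φ (p := (r, ξ)) hr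
    have h2 := atomHat_green_eq hX hdens hΨ ψ (p := (r, ξ)) hr
    simp only [Prod.snd_sub, Pi.sub_apply, weakPair]
    rw [h1, h2, ← mul_sub]
  have hN : ∀ ξ, H * (2 * H - 1)
      * (timeForm H (fun r => (weakPair P' X t φ - weakPair P' X t ψ).2 (r, ξ))).re
      = N H Ψ t ξ * ‖schwartzFourier φ ξ - schwartzFourier ψ ξ‖ ^ 2 := by
    intro ξ
    rw [hform, Complex.re_mul_ofReal, N_eq hH hH' ht (re_charExponent_nonneg hX hΨ ξ)]
    ring
  rw [heq, ← integral_const_mul]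
  simp_rw [hN]
  rw [ofReal_integral_eq_lintegral_ofReal, normSq]
  · refine lintegral_congr fun ξ => ?_
    rw [ENNReal.ofReal_mul (N_nonneg hH hH' ht (re_charExponent_nonneg hX hΨ ξ)),
      ENNReal.ofReal_pow (norm_nonneg _), ofReal_norm]
  · have h1 := hi.re.const_mul (H * (2 * H - 1))
    refine h1.congr (ae_of_all _ fun ξ => ?_)
    exact hN ξ
  · exact ae_of_all _ fun ξ => mul_nonneg
      (N_nonneg hH hH' ht (re_charExponent_nonneg hX hΨ ξ)) (by positivity)

/-! ### Existence of the weak solution -/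

/-- The weak solution exists at every time `t ≥ 0`. At `t = 0` the integrand is supported on a null
set of times, and has norm zero. -/
lemma exists_isStochasticIntegral_weakPair [IsProbabilityMeasure P'] (hH : 1 / 2 < H) (hH' : H < 1)
    (hf : IsSpatialCovariance f μ) (hW : IsFractionalNoise P H f W) (hX : IsLevyProcess P' X)
    (hdens : ∀ t : ℝ≥0, 0 < t → (P'.map (X t)) ≪ volume)
    (hΨ : IsCharExponent P' X Ψ) {t : ℝ} (ht : 0 ≤ t) (φ : 𝓢(Space d, ℝ)) :
    ∃ Z, IsStochasticIntegral P H f W (weakPair P' X t φ).1 Z := by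
  have := hf.tempered
  have := sigmaFinite_of_hasTemperateGrowth μ
  have hmem : weakPair P' X t φ ∈ spectralPairs μ := weakPair_mem hX hdens hΨ t φ
  rcases ht.eq_or_lt with rfl | ht
  · refine hW.exists_isStochasticIntegral hH hH' hf hmem (G := fun _ => 0)
      (fun _ => Submodule.zero_mem _) (fun _ => Submodule.zero_mem _) ?_
    have h0 : hpInner H f (weakPair P' X 0 φ).1 (weakPair P' X 0 φ).1 = 0 := by
      rw [(hpInner_self_eq_integral hH hH' hf hmem).2]
      have hform : ∀ ξ, timeForm H (fun r => (weakPair P' X 0 φ).2 (r, ξ)) = 0 := by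
        intro ξ
        have hne : ∀ᵐ r ∂timeMeasure, r ≠ 0 := by
          refine ae_restrict_of_ae ?_
          simp [ae_iff]
        have hz : (fun r => (weakPair P' X 0 φ).2 (r, ξ)) =ᵐ[timeMeasure] fun _ => 0 := by
          filter_upwards [hne] with r hr
          have h1 := norm_weakPair_snd_le hX 0 φ (r, ξ)
          rw [timeIndicator_of_notMem (fun h => hr (le_antisymm h.2 h.1)), zero_mul] at h1
          exact norm_le_zero_iff.1 h1
        rw [timeForm_congr hz]
        simp [timeForm]
      simp [hform]
    simp only [sub_zero, h0]
    exact tendsto_const_nhds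
  · obtain ⟨G, hG1, hG2, hG3⟩ := exists_elementary_tendsto hH hH' hf hX hdens hΨ ht φ
    exact hW.exists_isStochasticIntegral hH hH' hf hmem hG1 hG2 hG3

/-! ### The Dirac distribution and the parabolic condition -/

lemma enorm_sub_sq_le (x y : ℂ) : ‖x - y‖ₑ ^ 2 ≤ 2 * ‖x‖ₑ ^ 2 + 2 * ‖y‖ₑ ^ 2 := by
  have h : ∀ z : ℂ, ‖z‖ₑ ^ 2 = ENNReal.ofReal (‖z‖ ^ 2) := fun z => by
    rw [ENNReal.ofReal_pow (norm_nonneg _), ofReal_norm]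
  rw [h, h, h, ← ENNReal.ofReal_ofNat, ← ENNReal.ofReal_mul zero_le_two,
    ← ENNReal.ofReal_mul zero_le_two, ← ENNReal.ofReal_add (by positivity) (by positivity)]
  refine ENNReal.ofReal_le_ofReal ?_
  have h1 := norm_sub_le x y
  have h2 := norm_nonneg (x - y)
  nlinarith [sq_nonneg (‖x‖ - ‖y‖)]

lemma normSq_sub_le {t : ℝ} (hN : Measurable (N H Ψ t)) {a b : Space d → ℂ}
    (ha : Measurable a) :
    normSq H Ψ μ t (fun ξ => a ξ - b ξ) ≤ 2 * normSq H Ψ μ t a + 2 * normSq H Ψ μ t b := by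
  have hm : Measurable fun ξ => ENNReal.ofReal (N H Ψ t ξ) * ‖a ξ‖ₑ ^ 2 := by fun_prop
  simp only [normSq]
  rw [← lintegral_const_mul' _ _ (by simp), ← lintegral_const_mul' _ _ (by simp),
    ← lintegral_add_left (hm.const_mul 2)]
  refine lintegral_mono fun ξ => ?_
  calc ENNReal.ofReal (N H Ψ t ξ) * ‖a ξ - b ξ‖ₑ ^ 2
      ≤ ENNReal.ofReal (N H Ψ t ξ) * (2 * ‖a ξ‖ₑ ^ 2 + 2 * ‖b ξ‖ₑ ^ 2) := by
        gcongr
        exact enorm_sub_sq_le _ _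
    _ = _ := by ring

lemma measurable_diracFourier (x : Space d) : Measurable (diracFourier x) :=
  (continuous_diracFourier continuous_const continuous_id).measurable

/-- The Fourier transform of a test function of integral one supported near `x` is close to that of
the Dirac mass at `x`. -/
lemma norm_schwartzFourier_bump_sub_le {x : Space d} {r : ℝ} {B : 𝓢(Space d, ℝ)}
    (hB0 : ∀ y, 0 ≤ B y) (hB1 : ∫ y, B y = 1) (hBs : ∀ y, r ≤ ‖y - x‖ → B y = 0) (ξ : Space d) :
    ‖schwartzFourier B ξ - diracFourier x ξ‖ ≤ min 2 (‖ξ‖ * r) := by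
  have hBi : Integrable (fun y => (B y : ℂ)) := (B.integrable (μ := volume)).ofReal
  have h1 : schwartzFourier B ξ - diracFourier x ξ
      = ∫ y, (diracFourier y ξ - diracFourier x ξ) * (B y : ℂ) := by
    have h2 : Integrable fun y => diracFourier y ξ * (B y : ℂ) :=
      hBi.bdd_mul (c := 1) (Continuous.aestronglyMeasurable (by fun_prop))
        (ae_of_all _ fun y => (norm_diracFourier y ξ).le)
    simp_rw [sub_mul]
    rw [integral_sub h2 (hBi.const_mul _), integral_const_mul, integral_complex_ofReal, hB1]
    simp only [Complex.ofReal_one, mul_one]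
    rfl
  have h3 : ∀ y, ‖(diracFourier y ξ - diracFourier x ξ) * (B y : ℂ)‖ ≤ min 2 (‖ξ‖ * r) * B y := by
    intro y
    rw [norm_mul, Complex.norm_real, Real.norm_of_nonneg (hB0 y)]
    by_cases hy : r ≤ ‖y - x‖
    · rw [hBs y hy, mul_zero, mul_zero]
    · refine mul_le_mul_of_nonneg_right (le_min ?_ ?_) (hB0 y)
      · refine (norm_sub_le _ _).trans ?_
        rw [norm_diracFourier, norm_diracFourier]
        norm_num
      · refine (norm_diracFourier_sub_le y x ξ).trans ?_
        gcongr
        exact (not_le.1 hy).le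
  rw [h1]
  refine (norm_integral_le_of_norm_le ((B.integrable (μ := volume)).const_mul _)
    (ae_of_all _ h3)).trans (le_of_eq ?_)
  rw [integral_const_mul, hB1, mul_one]

/-- Under the parabolic condition the Dirac distribution is a limit of mollifiers. -/
lemma exists_tendsto_dirac [IsProbabilityMeasure P'] (hH : 1 / 2 < H) (hH' : H < 1)
    (hX : IsLevyProcess P' X) (hΨ : IsCharExponent P' X Ψ) (hpar : ParabolicCondition H Ψ μ)
    {t : ℝ} (ht : 0 ≤ t) (x : Space d) :
    ∃ φ : ℕ → 𝓢(Space d, ℝ), Tendsto (fun n =>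
      normSq H Ψ μ t (fun ξ => schwartzFourier (φ n) ξ - diracFourier x ξ)) atTop (𝓝 0) := by
  have hre := re_charExponent_nonneg hX hΨ
  have hNm := measurable_N hH hH' ht hre (measurable_charExponent hX hΨ)
  obtain ⟨C, hC0, hC⟩ := exists_N_le (d := d) hH hH' ht
  choose B hB0 hB1 hBs using fun n : ℕ => exists_bump x (r := 1 / ((n : ℝ) + 1)) (by positivity)
  have hest := fun n ξ => norm_schwartzFourier_bump_sub_le (hB0 n) (hB1 n) (hBs n) ξ
  refine ⟨B, ?_⟩
  have h := tendsto_lintegral_of_dominated_convergence (μ := μ)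
    (F := fun n ξ => ENNReal.ofReal (N H Ψ t ξ) * ‖schwartzFourier (B n) ξ - diracFourier x ξ‖ₑ ^ 2)
    (f := fun _ => 0)
    (fun ξ => ENNReal.ofReal (4 * C) * ENNReal.ofReal ((1 / (1 + (Ψ ξ).re)) ^ (2 * H)))
    (fun n => ?_) (fun n => ae_of_all _ fun ξ => ?_) ?_ (ae_of_all _ fun ξ => ?_)
  · rw [lintegral_zero] at h
    exact h
  · have h1 := (continuous_schwartzFourier (B n)).measurable
    have h2 := measurable_diracFourier x
    fun_prop
  · have h1 : ‖schwartzFourier (B n) ξ - diracFourier x ξ‖ₑ ^ 2 ≤ ENNReal.ofReal 4 := by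
      rw [← ofReal_norm, ← ENNReal.ofReal_pow (norm_nonneg _)]
      refine ENNReal.ofReal_le_ofReal ?_
      have h2 := (hest n ξ).trans (min_le_left _ _)
      nlinarith [norm_nonneg (schwartzFourier (B n) ξ - diracFourier x ξ)]
    calc ENNReal.ofReal (N H Ψ t ξ) * ‖schwartzFourier (B n) ξ - diracFourier x ξ‖ₑ ^ 2
        ≤ ENNReal.ofReal (C * (1 / (1 + (Ψ ξ).re)) ^ (2 * H)) * ENNReal.ofReal 4 := by
          gcongr
          exact hC Ψ ξ (hre ξ)
      _ = ENNReal.ofReal (4 * C) * ENNReal.ofReal ((1 / (1 + (Ψ ξ).re)) ^ (2 * H)) := by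
          rw [← ENNReal.ofReal_mul' (by norm_num), ← ENNReal.ofReal_mul (by positivity)]
          congr 1
          ring
  · rw [lintegral_const_mul' _ _ ENNReal.ofReal_ne_top]
    exact (ENNReal.mul_lt_top ENNReal.ofReal_lt_top hpar).ne
  · have h1 : Tendsto (fun n => ‖schwartzFourier (B n) ξ - diracFourier x ξ‖) atTop (𝓝 0) := by
      refine squeeze_zero (fun n => norm_nonneg _)
        (fun n => (hest n ξ).trans (min_le_right _ _)) ?_
      simpa using tendsto_one_div_add_atTop_nhds_zero_nat.const_mul ‖ξ‖
    have h2 := ENNReal.Tendsto.const_mul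
      (ENNReal.tendsto_ofReal (h1.pow 2)) (Or.inr (ENNReal.ofReal_ne_top (r := N H Ψ t ξ)))
    simp only [ne_eq, OfNat.ofNat_ne_zero, not_false_eq_true, zero_pow, ENNReal.ofReal_zero,
      mul_zero] at h2
    refine h2.congr fun n => ?_
    rw [ENNReal.ofReal_pow (norm_nonneg _), ofReal_norm]

/-- Sufficiency of the parabolic condition. -/
lemma hasRandomFieldSolution_of_parabolic [IsProbabilityMeasure P'] (hH : 1 / 2 < H) (hH' : H < 1)
    (hf : IsSpatialCovariance f μ) (hW : IsFractionalNoise P H f W) (hX : IsLevyProcess P' X)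
    (hdens : ∀ t : ℝ≥0, 0 < t → (P'.map (X t)) ≪ volume)
    (hΨ : IsCharExponent P' X Ψ) (hpar : ParabolicCondition H Ψ μ) :
    HasRandomFieldSolution P P' H f μ W X Ψ := by
  have := hf.tempered
  have := sigmaFinite_of_hasTemperateGrowth μ
  have hre := re_charExponent_nonneg hX hΨ
  have hex : ∀ (t : ℝ) (φ : 𝓢(Space d, ℝ)), ∃ Z, 0 ≤ t →
      IsStochasticIntegral P H f W (weakPair P' X t φ).1 Z := by
    intro t φ
    by_cases ht : 0 ≤ t
    · obtain ⟨Z, hZ⟩ := exists_isStochasticIntegral_weakPair hH hH' hf hW hX hdens hΨ ht φ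
      exact ⟨Z, fun _ => hZ⟩
    · exact ⟨0, fun h => absurd h ht⟩
  choose u hu using hex
  have hval : ∀ (t : ℝ) (x : Space d), ∃ U, 0 < t → IsValueAtDirac P H Ψ μ u t x U := by
    intro t x
    by_cases ht : 0 < t
    swap
    · exact ⟨0, fun h => absurd h ht⟩
    have hNm := measurable_N hH hH' ht.le hre (measurable_charExponent hX hΨ)
    obtain ⟨φ, hφ⟩ := exists_tendsto_dirac (μ := μ) hH hH' hX hΨ hpar ht.le x
    have hcauchy : CauchySeq fun n => (hu t (φ n) ht.le).1.toLp (u t (φ n)) := by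
      refine Metric.cauchySeq_iff'.2 fun ε hε => ?_
      obtain ⟨n₀, hn₀⟩ := eventually_atTop.1 (hφ.eventually
        (gt_mem_nhds (ENNReal.ofReal_pos.2 (show 0 < ε ^ 2 / 16 by positivity))))
      refine ⟨n₀, fun n hn => ?_⟩
      rw [dist_eq_norm]
      refine lt_of_pow_lt_pow_left₀ 2 hε.le ?_
      refine (IsStochasticIntegral.norm_sub_sq_le hH hH' hf hW (weakPair_mem hX hdens hΨ t (φ n))
        (weakPair_mem hX hdens hΨ t (φ n₀)) (hu t (φ n) ht.le) (hu t (φ n₀) ht.le)).trans_lt ?_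
      have h1 : ENNReal.ofReal (hpInner H f (weakPair P' X t (φ n) - weakPair P' X t (φ n₀)).1
          (weakPair P' X t (φ n) - weakPair P' X t (φ n₀)).1) ≤ ENNReal.ofReal (ε ^ 2 / 4) := by
        rw [ofReal_hpInner_weakPair_sub hH hH' hf hX hdens hΨ ht.le]
        have h2 := normSq_sub_le (μ := μ) hNm
          (a := fun ξ => schwartzFourier (φ n) ξ - diracFourier x ξ)
          (b := fun ξ => schwartzFourier (φ n₀) ξ - diracFourier x ξ)
          ((continuous_schwartzFourier (φ n)).measurable.sub (measurable_diracFourier x))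
        simp only [sub_sub_sub_cancel_right] at h2
        refine h2.trans ?_
        calc _ ≤ 2 * ENNReal.ofReal (ε ^ 2 / 16) + 2 * ENNReal.ofReal (ε ^ 2 / 16) := by
              gcongr
              · exact (hn₀ n hn).le
              · exact (hn₀ n₀ le_rfl).le
          _ = ENNReal.ofReal (ε ^ 2 / 4) := by
              rw [← ENNReal.ofReal_ofNat, ← ENNReal.ofReal_mul zero_le_two,
                ← ENNReal.ofReal_add (by positivity) (by positivity)]
              congr 1
              ring
      have h3 := (ENNReal.ofReal_le_ofReal_iff (by positivity)).1 h1
      have : 0 < ε ^ 2 := by positivity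
      linarith
    obtain ⟨z, hz⟩ := cauchySeq_tendsto_of_complete hcauchy
    refine ⟨z, fun _ => ⟨Lp.memLp z, φ, hφ, ?_⟩⟩
    refine (Lp.tendsto_Lp_iff_tendsto_eLpNorm'' (fun n => u t (φ n)) (fun n => (hu t (φ n) ht.le).1)
      z (Lp.memLp z)).1 ?_
    rw [Lp.toLp_coeFn]
    exact hz
  choose V hV using hval
  refine ⟨u, fun t x => if 0 < t then V t x else 0, fun t ht φ => ?_, fun t ht x => ?_, fun x => ?_⟩
  · rw [weakIntegrand_eq hX]
    exact hu t φ ht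
  · simp only [if_pos ht]
    exact hV t x ht
  · simp only [lt_irrefl, if_false]
    exact Filter.EventuallyEq.rfl

/-- If the Dirac mass at one point belongs to the completion at one time, then `N_t` is integrable,
because `N_t` is bounded and the Fourier transform of a Schwartz function is in `L²(μ)`. -/
lemma lintegral_N_lt_top [IsProbabilityMeasure P'] (hH : 1 / 2 < H) (hH' : H < 1)
    (hf : IsSpatialCovariance f μ) (hX : IsLevyProcess P' X) (hΨ : IsCharExponent P' X Ψ)
    {t : ℝ} (ht : 0 ≤ t) {x : Space d} {φ : 𝓢(Space d, ℝ)}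
    (hφ : normSq H Ψ μ t (fun ξ => schwartzFourier φ ξ - diracFourier x ξ) < ∞) :
    ∫⁻ ξ, ENNReal.ofReal (N H Ψ t ξ) ∂μ < ∞ := by
  have := hf.tempered
  have hre := re_charExponent_nonneg hX hΨ
  have hNm := measurable_N hH hH' ht hre (measurable_charExponent hX hΨ)
  obtain ⟨C, hC0, hC⟩ := exists_N_le (d := d) hH hH' ht
  have h1 : normSq H Ψ μ t (schwartzFourier φ) < ∞ := by
    have h2 := (integrable_norm_schwartzFourier_mul (μ := μ) φ φ).const_mul C
    refine lt_of_le_of_lt (lintegral_mono fun ξ => ?_) h2.lintegral_lt_top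
    have hNC : N H Ψ t ξ ≤ C := by
      refine (hC Ψ ξ (hre ξ)).trans (mul_le_of_le_one_right hC0 ?_)
      have h3 := hre ξ
      refine Real.rpow_le_one (by positivity) ?_ (by linarith)
      rw [div_le_one (by positivity)]
      linarith
    rw [← ofReal_norm, ← ENNReal.ofReal_pow (norm_nonneg _), ← sq,
      ENNReal.ofReal_mul hC0]
    gcongr
  have h4 := normSq_sub_le (μ := μ) hNm (a := schwartzFourier φ)
    (b := fun ξ => schwartzFourier φ ξ - diracFourier x ξ) (continuous_schwartzFourier φ).measurable
  simp only [sub_sub_cancel] at h4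
  have h5 : normSq H Ψ μ t (fun ξ => diracFourier x ξ) = ∫⁻ ξ, ENNReal.ofReal (N H Ψ t ξ) ∂μ := by
    refine lintegral_congr fun ξ => ?_
    rw [← ofReal_norm, norm_diracFourier]
    simp
  rw [h5] at h4
  exact h4.trans_lt (ENNReal.add_lt_top.2
    ⟨ENNReal.mul_lt_top (by simp) h1, ENNReal.mul_lt_top (by simp) hφ⟩)

/-- Integrability of `N_t` at a single time implies the parabolic condition, if `Ψ` takes its values
in a sector. -/
lemma parabolicCondition_of_lintegral_N (hH : 1 / 2 < H) (hH' : H < 1)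
    (hre : ∀ ξ, 0 ≤ (Ψ ξ).re) {t K : ℝ} (ht : 0 < t) (hK : 0 < K)
    (hsec : ∀ ξ, |(Ψ ξ).im| ≤ K * (Ψ ξ).re) (hfin : ∫⁻ ξ, ENNReal.ofReal (N H Ψ t ξ) ∂μ < ∞) :
    ParabolicCondition H Ψ μ := by
  obtain ⟨c, hc, hN⟩ := exists_le_N (d := d) hH hH' ht hK
  have h : ∫⁻ ξ, ENNReal.ofReal ((1 / (1 + (Ψ ξ).re)) ^ (2 * H)) ∂μ
      ≤ ∫⁻ ξ, ENNReal.ofReal c⁻¹ * ENNReal.ofReal (N H Ψ t ξ) ∂μ := by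
    refine lintegral_mono fun ξ => ?_
    rw [← ENNReal.ofReal_mul (by positivity)]
    refine ENNReal.ofReal_le_ofReal ?_
    rw [inv_mul_eq_div, le_div_iff₀ hc, mul_comm]
    exact hN Ψ ξ (hre ξ) (hsec ξ)
  refine h.trans_lt ?_
  rw [lintegral_const_mul' _ _ ENNReal.ofReal_ne_top]
  exact ENNReal.mul_lt_top ENNReal.ofReal_lt_top hfin

end FracSPDE

end

theorem mainTheorem1 {d : ℕ} {Ω Ω' : Type*} [MeasurableSpace Ω] [MeasurableSpace Ω']
    (P : Measure Ω) [IsProbabilityMeasure P] (P' : Measure Ω') [IsProbabilityMeasure P']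
    (H : ℝ) (hH : 1 / 2 < H) (hH' : H < 1)
    (f : EuclideanSpace ℝ (Fin d) → ℝ≥0∞) (μ : Measure (EuclideanSpace ℝ (Fin d)))
    (hf : FracSPDE.IsSpatialCovariance f μ)
    (W : FracSPDE.elementary d → Ω → ℝ) (hW : FracSPDE.IsFractionalNoise P H f W)
    (X : ℝ≥0 → Ω' → EuclideanSpace ℝ (Fin d)) (hX : FracSPDE.IsLevyProcess P' X)
    (hdens : ∀ t : ℝ≥0, 0 < t → (P'.map (X t)) ≪ volume)
    (Ψ : EuclideanSpace ℝ (Fin d) → ℂ) (hΨ : FracSPDE.IsCharExponent P' X Ψ) :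
    (FracSPDE.ParabolicCondition H Ψ μ →
      FracSPDE.HasRandomFieldSolution P P' H f μ W X Ψ) ∧
    ((∃ K : ℝ, 0 < K ∧ ∀ ξ, |(Ψ ξ).im| ≤ K * (Ψ ξ).re) →
      FracSPDE.HasRandomFieldSolution P P' H f μ W X Ψ →
      FracSPDE.ParabolicCondition H Ψ μ) := by
  refine ⟨FracSPDE.hasRandomFieldSolution_of_parabolic hH hH' hf hW hX hdens hΨ, ?_⟩
  rintro ⟨K, hK, hsec⟩ ⟨u, U, -, hU, -⟩
  obtain ⟨-, φ, hφ, -⟩ := hU 1 one_pos 0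
  obtain ⟨n, hn⟩ := (hφ.eventually (gt_mem_nhds one_pos)).exists
  exact FracSPDE.parabolicCondition_of_lintegral_N hH hH'
    (FracSPDE.re_charExponent_nonneg hX hΨ) one_pos hK hsec
    (FracSPDE.lintegral_N_lt_top hH hH' hf hX hΨ zero_le_one (hn.trans ENNReal.one_lt_top))
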